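/- **Setting.** Let $N$ planar two-link manipulators with torsional springs at both joints be given. Manipulator $i$ has joint angles $q_i=(q_{i,1},q_{i,2})$, link masses $m_{i,j}$, moments of inertia $I_{i,j}$, link lengths $L_{i,j}$, joint-to-centre-of-mass distances $l_{i,j}$ and spring stiffnesses $K_{i,j}$ (all positive, $j=1,2$), an orientation angle $\beta_i$ and a fixed base $x_i^{\rm base}\in\mathbb R^2$. Put $\alpha_{i,1}=m_{i,1}l_{i,1}^2+m_{i,2}L_{i,1}^2+I_{i,1}$, $\alpha_{i,2}=m_{i,2}l_{i,2}^2+I_{i,2}$, $\alpha_{i,3}=m_{i,2}L_{i,1}l_{i,2}$. The motion obeys $M_i(q_i)\ddot q_i+C_i(q_i,\dot q_i)\dot q_i+K_iq_i=u_i$ with $K_i=\mathrm{diag}(K_{i,1},K_{i,2})$, $$M_i=\begin{pmatrix}\alpha_{i,1}+\alpha_{i,2}+2\alpha_{i,3}\cos q_{i,2}&\alpha_{i,2}+\alpha_{i,3}\cos q_{i,2}\\ \alpha_{i,2}+\alpha_{i,3}\cos q_{i,2}&\alpha_{i,2}\end{pmatrix},\quad C_i=\alpha_{i,3}\sin q_{i,2}\begin{pmatrix}-\dot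 q_{i,2}&-\dot q_{i,1}-\dot q_{i,2}\\ \dot q_{i,1}&0\end{pmatrix}.$$ Each manipulator is fully actuated (FA), active-passive (AP: $u_{i,2}=0$, passive angle $q_{i,2}$) or passive-active (PA: $u_{i,1}=0$, passive angle $q_{i,1}$); the other angles are active. Let $$h_i(q_i)=\begin{pmatrix}-L_{i,1}\sin(q_{i,1}+\beta_i)-L_{i,2}\sin(q_{i,1}+q_{i,2}+\beta_i)\\ L_{i,1}\cos(q_{i,1}+\beta_i)+L_{i,2}\cos(q_{i,1}+q_{i,2}+\beta_i)\end{pmatrix},\qquad J_i=\frac{\partial h_i}{\partial q_i},$$ and $\bar J_i(\theta)=(-\cos(\theta+\beta_i),-\sin(\theta+\beta_i))^{\rm T}$. The end-effector is $x_i^{\rm end}=h_i(q_i)+x_i^{\rm base}$, the middle joint is $x_i^{\rm mid}=L_{i,1}(-\sin(q_{i,1}+\beta_i),\cos(q_{i,1}+\beta_i))^{\rm T}+x_i^{\rm base}$, and the virtual end-effector $\widehat x_i^{\rm end}$ is $x_i^{\rm end}$ with the passive angle (if any) replaced by $0$; $\mathcal W_i$ is the set of all values of $\widehat x_i^{\rm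 end}$ and $\mathcal W=\prod_i\mathcal W_i$. Let $\mathcal G$ be a finite graph on $\{1,\dots,N\}$ without loops, with oriented edges $(i,j)\in\mathcal E$, and let $x^*\in\mathbb R^{2N}$. Either (distance-based) $f_{\mathcal G}(x)=(\|x_i-x_j\|^2)_{(i,j)\in\mathcal E}$ and $(\mathcal G,x^*)$ is infinitesimally rigid, i.e. the Jacobian of $f_{\mathcal G}$ at $x^*$ has rank $2N-3$; or (displacement-based) $f_{\mathcal G}(x)=(x_i-x_j)_{(i,j)\in\mathcal E}$ and $\mathcal G$ is connected. Put $e=f_{\mathcal G}(\widehat x^{\rm end})-f_{\mathcal G}(x^*)$, $V=\frac12e^{\rm T}k_Se$ with $k_S$ diagonal with positive entries, $\widehat e_i=\partial V/\partial\widehat x_i^{\rm end}$, and $$\mathcal S_W=\{x\in\mathcal W: f_{\mathcal G}(x)=f_{\mathcal G}(x^*)\},\qquad \mathcal S=\{((Rx_i^*+c))_{i}: R\in SO(2),\ c\in\mathbb R^2\}.$$ **Assumptions.** $\alpha_{i,2}\ne\alpha_{i,3}$ for every PA manipulator $i$; $\mathcal S_W\neq\emptyset$; and there is $\mu>0$ such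 that whenever the active angles satisfy $\|e\|\le\mu$, one has for all $k\in\mathbb Z$: $q_{i,2}+\beta_i\ne k\pi$ for FA, $q_{i,1}+\beta_i\neq k\pi/2$ for AP, and $q_{i,2}+\beta_i\ne k\pi/2$ for PA manipulators. **Theorem.** Let $k_D>0$ and let the controllers be $$u_i=-J_i^{\rm T}(q_i)\widehat e_i-k_D\dot q_i+K_iq_i\ \text{(FA)},$$ $$u_i=\begin{pmatrix}-(L_{i,1}+L_{i,2})\bar J_i^{\rm T}(q_{i,1})\widehat e_i-k_D\dot q_{i,1}+K_{i,1}q_{i,1}\\0\end{pmatrix}\ \text{(AP)},\qquad u_i=\begin{pmatrix}0\\-L_{i,2}\bar J_i^{\rm T}(q_{i,2})\widehat e_i-k_D\dot q_{i,2}+K_{i,2}q_{i,2}\end{pmatrix}\ \text{(PA)}.$$ They are distributed: $u_i$ is a function of $q_i$, $\dot q_i$ and of $x_j^{\rm end},x_j^{\rm mid}$ for the neighbours $j$ of $i$. They solve the formation problem locally: with the energy $$U=V+\tfrac12\sum_i\dot q_i^{\rm T}M_i(q_i)\dot q_i+\tfrac12\sum_{i\ \mathrm{AP}}K_{i,2}q_{i,2}^2+\tfrac12\sum_{i\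 \mathrm{PA}}K_{i,1}q_{i,1}^2,$$ there is $\gamma>0$ such that 1. from every initial state with $U\le\gamma$ there is a solution of the closed loop on $[0,\infty)$; 2. along every solution on $[0,\infty)$ with $U(0)\le\gamma$, as $t\to\infty$, the distances of $\widehat x^{\rm end}(t)$ and of $x^{\rm end}(t)$ to $\mathcal S_W$ tend to $0$, all passive joint angles tend to $0$, $x^{\rm end}(t)-\widehat x^{\rm end}(t)\to0$, and $\dot q(t)\to0$; 3. there is $\delta>0$ such that, if moreover $\widehat x^{\rm end}(0)$ is within distance $\delta$ of a point of $\mathcal S_W\cap\mathcal S$, then the distances of $\widehat x^{\rm end}(t)$ and $x^{\rm end}(t)$ to $\mathcal S_W\cap\mathcal S$ tend to $0$. -/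

import Mathlib

open Filter Topology Matrix

noncomputable section

namespace FormationControl

/-- Planar vectors.  Norms on finite products are equivalent, so the sup metric of this type is used
for limits only; Euclidean norms are written out where their value matters. -/
abbrev Vec2 := Fin 2 → ℝ

/-- Actuation pattern: fully actuated, active-passive, passive-active. -/
inductive Kind
  | fa
  | ap
  | pa

/-- A planar two-link manipulator with a torsional spring at each joint.
Index `0` is the first link / base joint, index `1` the second link / middle joint. -/
structure Manipulator where
  kind : Kind
  /-- link masses -/
  m : Fin 2 → ℝ
  /-- moments of inertia about the centres of mass -/
  inertia : Fin 2 → ℝ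
  /-- link lengths -/
  L : Fin 2 → ℝ
  /-- distances from the joints to the centres of mass -/
  l : Fin 2 → ℝ
  /-- torsional stiffnesses -/
  K : Fin 2 → ℝ
  /-- orientation of the local frame relative to the world frame -/
  β : ℝ
  /-- position of the fixed base -/
  base : Vec2
  m_pos : ∀ j, 0 < m j
  inertia_pos : ∀ j, 0 < inertia j
  L_pos : ∀ j, 0 < L j
  l_pos : ∀ j, 0 < l j
  K_pos : ∀ j, 0 < K j

namespace Manipulator

variable (P : Manipulator)

def α₁ : ℝ := P.m 0 * P.l 0 ^ 2 + P.m 1 * P.L 0 ^ 2 + P.inertia 0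

def α₂ : ℝ := P.m 1 * P.l 1 ^ 2 + P.inertia 1

def α₃ : ℝ := P.m 1 * P.L 0 * P.l 1

/-- Mass matrix. -/
def massMatrix (q : Vec2) : Matrix (Fin 2) (Fin 2) ℝ :=
  !![P.α₁ + P.α₂ + 2 * P.α₃ * Real.cos (q 1), P.α₂ + P.α₃ * Real.cos (q 1);
     P.α₂ + P.α₃ * Real.cos (q 1), P.α₂]

/-- Coriolis and centrifugal matrix. -/
def coriolis (q v : Vec2) : Matrix (Fin 2) (Fin 2) ℝ :=
  (P.α₃ * Real.sin (q 1)) • !![-v 1, -v 0 - v 1; v 0, 0]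

/-- Stiffness matrix of the joint springs. -/
def stiffness : Matrix (Fin 2) (Fin 2) ℝ := Matrix.diagonal P.K

/-- Forward kinematics relative to the base. -/
def h (q : Vec2) : Vec2 :=
  ![-P.L 0 * Real.sin (q 0 + P.β) - P.L 1 * Real.sin (q 0 + q 1 + P.β),
    P.L 0 * Real.cos (q 0 + P.β) + P.L 1 * Real.cos (q 0 + q 1 + P.β)]

/-- Jacobian matrix of `h`. -/
def J (q : Vec2) : Matrix (Fin 2) (Fin 2) ℝ :=
  !![-P.L 0 * Real.cos (q 0 + P.β) - P.L 1 * Real.cos (q 0 + q 1 + P.β),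
     -P.L 1 * Real.cos (q 0 + q 1 + P.β);
     -P.L 0 * Real.sin (q 0 + P.β) - P.L 1 * Real.sin (q 0 + q 1 + P.β),
     -P.L 1 * Real.sin (q 0 + q 1 + P.β)]

theorem hasDerivAt_h {q : ℝ → Vec2} {v : Vec2} {t : ℝ} (hq : HasDerivAt q v t) :
    HasDerivAt (fun s => P.h (q s)) (P.J (q t) *ᵥ v) t := by
  have h0 := hasDerivAt_pi.1 hq 0
  have h1 := hasDerivAt_pi.1 hq 1
  refine hasDerivAt_pi.2 fun j => ?_
  fin_cases j
  · refine ((((h0.add_const P.β).sin.const_mul (-P.L 0)).sub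
      (((h0.add h1).add_const P.β).sin.const_mul (P.L 1)))).congr_deriv ?_
    simp [J, Matrix.mulVec, dotProduct, Fin.sum_univ_two]
    ring
  · refine ((((h0.add_const P.β).cos.const_mul (P.L 0)).add
      (((h0.add h1).add_const P.β).cos.const_mul (P.L 1)))).congr_deriv ?_
    simp [J, Matrix.mulVec, dotProduct, Fin.sum_univ_two]
    ring

/-- Position of the actual end-effector. -/
def xEnd (q : Vec2) : Vec2 := P.h q + P.base

/-- Position of the middle joint. -/
def xMid (q : Vec2) : Vec2 :=
  ![-P.L 0 * Real.sin (q 0 + P.β), P.L 0 * Real.cos (q 0 + P.β)] + P.base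

/-- Position of the virtual end-effector: the passive joint angle is replaced by zero. -/
def xHat (q : Vec2) : Vec2 :=
  match P.kind with
  | .fa => P.h q + P.base
  | .ap => P.h ![q 0, 0] + P.base
  | .pa => P.h ![0, q 1] + P.base

/-- The passive joint angle (`0` by convention if there is none). -/
def passiveAngle (q : Vec2) : ℝ :=
  match P.kind with
  | .fa => 0
  | .ap => q 1
  | .pa => q 0

/-- The stiffness at the passive joint (`0` by convention if there is none). -/
def passiveStiffness : ℝ :=
  match P.kind with
  | .fa => 0
  | .ap => P.K 1
  | .pa => P.K 0

def Jbar (θ : ℝ) : Vec2 := ![-Real.cos (θ + P.β), -Real.sin (θ + P.β)]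

/-- The feedback torque, given the gradient `w` of the virtual-spring potential with respect to the
virtual end-effector position of this manipulator. -/
def torque (kD : ℝ) (w q v : Vec2) : Vec2 :=
  match P.kind with
  | .fa => -((P.J q)ᵀ *ᵥ w) - kD • v + P.stiffness *ᵥ q
  | .ap => ![-(P.L 0 + P.L 1) * (P.Jbar (q 0) ⬝ᵥ w) - kD * v 0 + P.K 0 * q 0, 0]
  | .pa => ![0, -P.L 1 * (P.Jbar (q 1) ⬝ᵥ w) - kD * v 1 + P.K 1 * q 1]

/-- The configuration is not one of the excluded singular ones. -/
def Nonsingular (q : Vec2) : Prop :=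
  match P.kind with
  | .fa => ∀ k : ℤ, q 1 + P.β ≠ k * Real.pi
  | .ap => ∀ k : ℤ, q 0 + P.β ≠ k * Real.pi / 2
  | .pa => ∀ k : ℤ, q 1 + P.β ≠ k * Real.pi / 2

end Manipulator

/-- An undirected formation graph on `Fin N`, given by its enumerated oriented edges. -/
structure FormationGraph (N : ℕ) where
  numEdges : ℕ
  tail : Fin numEdges → Fin N
  head : Fin numEdges → Fin N
  loopless : ∀ k, tail k ≠ head k
  injective : Function.Injective fun k => (tail k, head k)

/-- The two ways of describing a shape by edge constraints. -/
inductive Method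
  | distance
  | displacement

namespace Method

/-- Number of scalar constraints per edge. -/
def p : Method → ℕ
  | .distance => 1
  | .displacement => 2

/-- The constraint function of one edge, as a function of the relative position. -/
def edgeFun : (M : Method) → Vec2 → Fin M.p → ℝ
  | .distance, z => fun _ => z 0 ^ 2 + z 1 ^ 2
  | .displacement, z => z

/-- Transposed Jacobian of `edgeFun`. -/
def D : (M : Method) → Vec2 → Matrix (Fin 2) (Fin M.p) ℝ
  | .distance, z => fun a _ => 2 * z a
  | .displacement, _ => (1 : Matrix (Fin 2) (Fin 2) ℝ)

end Method

namespace FormationGraph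

variable {N : ℕ} (G : FormationGraph N)

/-- The underlying simple graph. -/
def toSimpleGraph : SimpleGraph (Fin N) :=
  SimpleGraph.fromRel fun i j => ∃ k, G.tail k = i ∧ G.head k = j

/-- Incidence matrix. -/
def B : Matrix (Fin N) (Fin G.numEdges) ℝ := fun i k =>
  if i = G.tail k then 1 else if i = G.head k then -1 else 0

/-- The function `f_G` of a stacked position vector. -/
def f (M : Method) (x : Fin N → Vec2) : Fin G.numEdges → Fin M.p → ℝ := fun k =>
  M.edgeFun (x (G.tail k) - x (G.head k))

/-- Infinitesimal rigidity in the plane: the Jacobian of the squared edge lengths has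
rank `2N - 3`. -/
def InfinitesimallyRigid (x : Fin N → Vec2) : Prop :=
  Module.finrank ℝ (LinearMap.range (fderiv ℝ (G.f .distance) x).toLinearMap) + 3 = 2 * N

/-- The standing assumption on the framework `(G, x*)`, for each method. -/
def Admissible (xstar : Fin N → Vec2) : Method → Prop
  | .distance => G.InfinitesimallyRigid xstar
  | .displacement => G.toSimpleGraph.Connected

end FormationGraph

/-- All positions obtained from `x*` by a common rotation and translation. -/
def shapeSet {N : ℕ} (xstar : Fin N → Vec2) : Set (Fin N → Vec2) :=
  {x | ∃ R ∈ Matrix.specialOrthogonalGroup (Fin 2) ℝ, ∃ c : Vec2, ∀ i, x i = R *ᵥ xstar i + c}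

/-- The data of the formation problem and of the controller. -/
structure Setup (N : ℕ) where
  manip : Fin N → Manipulator
  G : FormationGraph N
  /-- reference position defining the desired shape -/
  xstar : Fin N → Vec2
  method : Method
  /-- diagonal entries of the virtual stiffness matrix -/
  kS : Fin G.numEdges → Fin method.p → ℝ
  /-- damping gain -/
  kD : ℝ
  kS_pos : ∀ k a, 0 < kS k a
  kD_pos : 0 < kD

namespace Setup

variable {N : ℕ} (S : Setup N)

def xEnd (q : Fin N → Vec2) : Fin N → Vec2 := fun i => (S.manip i).xEnd (q i)

def xHat (q : Fin N → Vec2) : Fin N → Vec2 := fun i => (S.manip i).xHat (q i)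

/-- The error `e` at a stacked position `x`. -/
def err (x : Fin N → Vec2) : Fin S.G.numEdges → Fin S.method.p → ℝ :=
  S.G.f S.method x - S.G.f S.method S.xstar

/-- Virtual-spring potential. -/
def V (x : Fin N → Vec2) : ℝ := 1 / 2 * ∑ k, ∑ a, S.kS k a * S.err x k a ^ 2

/-- The gradient of `V` with respect to the `i`-th position: `B̄ D(ẑ) k_S e`. -/
def eHat (x : Fin N → Vec2) (i : Fin N) : Vec2 :=
  ∑ k, S.G.B i k •
    (S.method.D (x (S.G.tail k) - x (S.G.head k)) *ᵥ fun a => S.kS k a * S.err x k a)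

/-- The reachable set of virtual end-effector positions. -/
def reachable : Set (Fin N → Vec2) := {x | ∀ i, x i ∈ Set.range (S.manip i).xHat}

/-- The set `S_W` of desired and reachable shapes. -/
def SW : Set (Fin N → Vec2) := {x | x ∈ S.reachable ∧ S.G.f S.method x = S.G.f S.method S.xstar}

/-- The neighbourhood `{x : ‖e‖ ≤ μ}` of `S_W`, with the Euclidean norm. -/
def SWnhd (μ : ℝ) : Set (Fin N → Vec2) := {x | Real.sqrt (∑ k, ∑ a, S.err x k a ^ 2) ≤ μ}

/-- `S_W` is nonempty, and singular configurations are avoided in a neighbourhood of it. -/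
def AvoidsSingularities : Prop :=
  S.SW.Nonempty ∧ ∃ μ : ℝ, 0 < μ ∧ ∀ q : Fin N → Vec2, S.xHat q ∈ S.SWnhd μ →
    ∀ i, (S.manip i).Nonsingular (q i)

/-- The controllers. -/
def control (q v : Fin N → Vec2) (i : Fin N) : Vec2 :=
  (S.manip i).torque S.kD (S.eHat (S.xHat q) i) (q i) (v i)

/-- `q` is a motion of the closed loop on `[0, ∞)` with joint velocity `v`. -/
def IsSolution (q v : ℝ → Fin N → Vec2) : Prop :=
  ∀ t, 0 ≤ t → HasDerivWithinAt q (v t) (Set.Ici 0) t ∧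
    ∃ a : Fin N → Vec2, HasDerivWithinAt v a (Set.Ici 0) t ∧
      ∀ i, (S.manip i).massMatrix (q t i) *ᵥ a i
        + (S.manip i).coriolis (q t i) (v t i) *ᵥ v t i
        + (S.manip i).stiffness *ᵥ q t i = S.control (q t) (v t) i

/-- Total energy: virtual springs, kinetic energy, and springs at the passive joints. -/
def energy (q v : Fin N → Vec2) : ℝ :=
  S.V (S.xHat q) + 1 / 2 * ∑ i, v i ⬝ᵥ ((S.manip i).massMatrix (q i) *ᵥ v i)
    + 1 / 2 * ∑ i, (S.manip i).passiveStiffness * (S.manip i).passiveAngle (q i) ^ 2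

/-- The `i`-th torque is a function of `q_i`, its velocity, and the end-effector and middle-joint
positions of the neighbours of `i`. -/
def IsDistributed : Prop :=
  ∀ i, ∃ σ : ({j // S.G.toSimpleGraph.Adj i j} → Vec2 × Vec2) → Vec2 → Vec2 → Vec2,
    ∀ q v : Fin N → Vec2, S.control q v i =
      σ (fun j => ((S.manip j).xEnd (q j), (S.manip j).xMid (q j))) (q i) (v i)

end Setup

namespace Method

theorem hasDerivAt_edgeFun (M : Method) {z : ℝ → Vec2} {w : Vec2} {t : ℝ} (hz : HasDerivAt z w t) :
    HasDerivAt (fun s => M.edgeFun (z s)) ((M.D (z t))ᵀ *ᵥ w) t := by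
  have h0 := hasDerivAt_pi.1 hz 0
  have h1 := hasDerivAt_pi.1 hz 1
  cases M
  · refine hasDerivAt_pi.2 fun j => ?_
    refine ((h0.pow 2).add (h1.pow 2)).congr_deriv ?_
    simp [D, Matrix.mulVec, dotProduct, Fin.sum_univ_two]
    rfl
  · simp only [edgeFun, D]
    refine hz.congr_deriv ?_
    exact ((congrArg (· *ᵥ w) Matrix.transpose_one).trans (Matrix.one_mulVec w)).symm

end Method

/-- `eHat` is the gradient of `V`. -/
theorem Setup.hasDerivAt_V {N : ℕ} (S : Setup N) {x : ℝ → Fin N → Vec2} {w : Fin N → Vec2} {t : ℝ}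
    (hx : HasDerivAt x w t) :
    HasDerivAt (fun s => S.V (x s)) (∑ i, S.eHat (x t) i ⬝ᵥ w i) t := by
  have hx' := hasDerivAt_pi.1 hx
  have he : ∀ k, HasDerivAt (fun s => S.err (x s) k)
      ((S.method.D (x t (S.G.tail k) - x t (S.G.head k)))ᵀ *ᵥ (w (S.G.tail k) - w (S.G.head k))) t :=
    fun k => (S.method.hasDerivAt_edgeFun ((hx' _).sub (hx' _))).sub_const _
  have hB : ∀ k (g : Fin N → ℝ), ∑ i, S.G.B i k * g i = g (S.G.tail k) - g (S.G.head k) := by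
    intro k g
    have : ∀ i, S.G.B i k * g i = (if i = S.G.tail k then g i else 0)
        - (if i = S.G.head k then g i else 0) := by
      intro i
      have := S.G.loopless k
      simp only [FormationGraph.B]
      split_ifs with h1 h2 <;> simp_all
    simp [this, Finset.sum_sub_distrib]
  have hV := (HasDerivAt.fun_sum (u := Finset.univ) fun k _ =>
    HasDerivAt.fun_sum (u := Finset.univ) fun a _ =>
      (((hasDerivAt_pi.1 (he k) a).pow 2).const_mul (S.kS k a))).const_mul (1 / 2 : ℝ)
  refine hV.congr_deriv ?_
  simp only [Setup.eHat, sum_dotProduct, smul_dotProduct, smul_eq_mul]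
  rw [Finset.mul_sum]
  conv_rhs => rw [Finset.sum_comm]
  refine Finset.sum_congr rfl fun k _ => ?_
  rw [hB k (fun i => (S.method.D (x t (S.G.tail k) - x t (S.G.head k)) *ᵥ
    fun a => S.kS k a * S.err (x t) k a) ⬝ᵥ w i), ← dotProduct_sub, dotProduct_comm,
    Matrix.dotProduct_mulVec, ← Matrix.mulVec_transpose, dotProduct, Finset.mul_sum]
  refine Finset.sum_congr rfl fun a _ => ?_
  push_cast
  ring

end FormationControl

end

open FormationControl

noncomputable section

namespace FormationControl

/-! The proof combines LaSalle's invariance principle with an algebraic form of Sard's theorem.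

Along the closed loop the energy U loses exactly k_D times the sum of the squared active velocities
(`Setup.hasDerivAt_energy`). Sublevel sets of U are unbounded only in the active angles, and the
closed loop is invariant under full turns of the active joints. Hence time shifts of a trajectory,
turned back into a bounded set, subconverge to a trajectory on which U is constant, equal to its
limit (`exists_limit_trajectory`). There the active joints are at rest, so each manipulator feels a
constant virtual force and its passive coordinate satisfies two equations of motion at once. This
overdetermined system confines the passive angle to a countable set; by continuity it is constant,
and then the spring forces it to be zero (`passive_eq_zero_of_ap`, `passive_eq_zero_of_pa`). So the
limiting motion is an equilibrium, at a critical point of V as a function of the active angles, and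
the limit of U is a critical value of V.

In the cosines and sines of the arm angles V is a polynomial, and the critical points form an
algebraic set. In the function field of each irreducible component every derivation kills V, so V is
algebraic over the constants; thus there are only finitely many critical values
(`exists_polynomial_of_derivation_eq_zero`). If γ lies below the smallest positive one, the limit of
U is zero (`exists_isolated_critical_value`).

Once U tends to zero, compactness of the reachable set gives convergence to S_W, and kinetic and
spring energies control velocities and passive angles. For the last claim, the shapes congruent to
x* are isolated, with a uniform radius, among all solutions of the edge constraints
(`Admissible.exists_shapeSet_isolated`): a pinned infinitesimally rigid framework is locally unique,
and displacements along a connected graph determine the shape up to translation. For small energy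
the virtual end-effectors stay within half this radius of S_W, so by connectedness they cannot pass
to another part of it (`infDist_inter_le_of_continuousOn`). -/

/-! ### Derivations of function fields and the algebraic Sard theorem -/

/-- Through X ↦ x the field K is formally smooth over k[X]: it is so over k(X) in characteristic
zero, and k(X) is a localization of k[X]. The identity of K therefore lifts to the dual numbers over
K, made a k[X]-algebra by X ↦ x + ε; the ε-part of the lift is the derivation. -/
theorem exists_derivation_apply_eq_one {k K : Type*} [Field k] [CharZero k] [Field K] [Algebra k K]
    [Algebra.EssFiniteType k K] {x : K} (hx : Transcendental k x) :
    ∃ δ : Derivation k K K, δ x = 1 := by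
  let : Algebra (Polynomial k) K := (Polynomial.aeval x).toRingHom.toAlgebra
  have hmap : ∀ p : Polynomial k, algebraMap (Polynomial k) K p = Polynomial.aeval x p :=
    fun _ => rfl
  have : IsScalarTower k (Polynomial k) K := .of_algebraMap_eq fun r => by
    rw [hmap]; simp
  have : FaithfulSMul (Polynomial k) K :=
    (faithfulSMul_iff_algebraMap_injective _ _).2 (transcendental_iff_injective.1 hx)
  let : Algebra (FractionRing (Polynomial k)) K := FractionRing.liftAlgebra _ _
  have : IsScalarTower (Polynomial k) (FractionRing (Polynomial k)) K :=
    FractionRing.isScalarTower_liftAlgebra _ _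
  have : IsScalarTower k (FractionRing (Polynomial k)) K := by
    refine .of_algebraMap_eq fun r => ?_
    rw [IsScalarTower.algebraMap_apply k (Polynomial k) (FractionRing (Polynomial k)),
      ← IsScalarTower.algebraMap_apply (Polynomial k) (FractionRing (Polynomial k)) K,
      ← IsScalarTower.algebraMap_apply]
  have : CharZero (FractionRing (Polynomial k)) :=
    charZero_of_injective_algebraMap (algebraMap k _).injective
  have : Algebra.EssFiniteType (FractionRing (Polynomial k)) K := .of_comp k _ _
  have : Algebra.FormallySmooth (Polynomial k) (FractionRing (Polynomial k)) :=
    .of_isLocalization (nonZeroDivisors _)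
  have : Algebra.FormallySmooth (Polynomial k) K := .comp _ (FractionRing (Polynomial k)) _
  let e : Polynomial k →ₐ[k] TrivSqZeroExt K K :=
    Polynomial.aeval (TrivSqZeroExt.inl x + TrivSqZeroExt.inr 1)
  let : Algebra (Polynomial k) (TrivSqZeroExt K K) := e.toRingHom.toAlgebra
  have hfst : ∀ p : Polynomial k, (e p).fst = Polynomial.aeval x p := by
    intro p
    have : (TrivSqZeroExt.fstHom k K K).comp e = Polynomial.aeval x := by
      ext; simp [e]
    exact DFunLike.congr_fun this p
  let g : TrivSqZeroExt K K →ₐ[Polynomial k] K :=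
    { (TrivSqZeroExt.fstHom k K K).toRingHom with commutes' := fun p => hfst p }
  have hg : Function.Surjective g := fun y => ⟨TrivSqZeroExt.inl y, by simp [g]⟩
  have hnil : IsNilpotent (RingHom.ker (g : TrivSqZeroExt K K →ₐ[Polynomial k] K)) := by
    refine ⟨2, ?_⟩
    refine (pow_two (RingHom.ker g)).trans ?_
    rw [Ideal.zero_eq_bot, eq_bot_iff, Ideal.mul_le]
    intro a ha b hb
    have ha' : a.fst = 0 := ha
    have hb' : b.fst = 0 := hb
    rw [Ideal.mem_bot]
    ext <;> simp [ha', hb']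
  let s := Algebra.FormallySmooth.liftOfSurjective (AlgHom.id (Polynomial k) K) g hg hnil
  have hs : ∀ y, (s y).fst = y := fun y =>
    Algebra.FormallySmooth.liftOfSurjective_apply (AlgHom.id (Polynomial k) K) g hg hnil y
  have hsm : ∀ p : Polynomial k, s (Polynomial.aeval x p) = e p := fun p => s.commutes p
  refine ⟨Derivation.mk' (R := k) { toFun := fun y => (s y).snd, map_add' := ?_, map_smul' := ?_ }
    ?_, ?_⟩
  · intro a b; simp
  · intro r a
    have h1 : s (algebraMap k K r) = TrivSqZeroExt.inl (algebraMap k K r) := by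
      simp [TrivSqZeroExt.algebraMap_eq_inl']
    simp [Algebra.smul_def, h1]
  · intro a b
    simp [hs]
    ring
  · have := hsm Polynomial.X
    simp only [Polynomial.aeval_X, e] at this
    simp [this]

/-- Algebraic Sard theorem: a function all of whose differentials along a finite type variety vanish
takes finitely many values. -/
theorem exists_polynomial_of_derivation_eq_zero {k A : Type} [Field k] [CharZero k] [CommRing A]
    [Algebra k A] [Algebra.FiniteType k A] (I : Ideal A) (a : A)
    (h : ∀ (K : Type) [Field K] [Algebra k K] (φ : A →ₐ[k] K) (δ : Derivation k K K),
      (∀ b ∈ I, φ b = 0) → δ (φ a) = 0) :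
    ∃ m : Polynomial k, m ≠ 0 ∧ ∀ ψ : A →ₐ[k] k, (∀ b ∈ I, ψ b = 0) → m.eval (ψ a) = 0 := by
  have : IsNoetherianRing A := Algebra.FiniteType.isNoetherianRing k A
  -- Work in the function field of each irreducible component. If the class of `a` were
  -- transcendental, some derivation would send it to 1, against `h`.
  have hp : ∀ p ∈ I.minimalPrimes, ∃ m : Polynomial k, m ≠ 0 ∧ Polynomial.aeval a m ∈ p := by
    intro p hp
    have : p.IsPrime := hp.1.1
    let K := FractionRing (A ⧸ p)
    let φ : A →ₐ[k] K := (IsScalarTower.toAlgHom k (A ⧸ p) K).comp (Ideal.Quotient.mkₐ k p)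
    have hker : ∀ b, φ b = 0 ↔ b ∈ p := by
      intro b
      simp only [φ, AlgHom.comp_apply, IsScalarTower.coe_toAlgHom', Ideal.Quotient.mkₐ_eq_mk]
      rw [FaithfulSMul.algebraMap_eq_zero_iff, Ideal.Quotient.eq_zero_iff_mem]
    have : Algebra.EssFiniteType (A ⧸ p) K := .of_isLocalization _ (nonZeroDivisors (A ⧸ p))
    have : Algebra.EssFiniteType k K := .comp k (A ⧸ p) K
    by_cases hx : Transcendental k (φ a)
    · obtain ⟨δ, hδ⟩ := exists_derivation_apply_eq_one hx
      have := h K φ δ fun b hb => (hker b).2 (hp.1.2 hb)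
      rw [this] at hδ
      exact absurd hδ zero_ne_one
    · obtain ⟨m, hm0, hm⟩ := not_not.1 hx
      refine ⟨m, hm0, (hker _).1 ?_⟩
      rw [← hm, Polynomial.aeval_algHom_apply]
  choose! m hm0 hm using hp
  have hfin := I.finite_minimalPrimes_of_isNoetherianRing A
  refine ⟨∏ p ∈ hfin.toFinset, m p, Finset.prod_ne_zero_iff.2 fun p hp => hm0 p (by simpa using hp),
    fun ψ hψ => ?_⟩
  have hle : I ≤ RingHom.ker ψ := hψ
  have : (RingHom.ker ψ).IsPrime := RingHom.ker_isPrime _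
  -- A rational point of the zero set of `I` lies on one of the finitely many components, whose
  -- factor of the product vanishes there.
  obtain ⟨p, hpm, hpk⟩ := Ideal.exists_minimalPrimes_le hle
  rw [Polynomial.eval_prod]
  refine Finset.prod_eq_zero (i := p) (by simpa using hpm) ?_
  have : ψ (Polynomial.aeval a (m p)) = 0 := hpk (hm p hpm)
  rw [← Polynomial.aeval_algHom_apply] at this
  simpa [Polynomial.coe_aeval_eq_eval] using this

theorem _root_.Derivation.map_mvPolynomial_aeval {k K σ : Type*} [Fintype σ] [CommRing k] [CommRing K]
    [Algebra k K] (δ : Derivation k K K) (f : σ → K) (p : MvPolynomial σ k) :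
    δ (MvPolynomial.aeval f p) =
      ∑ v, MvPolynomial.aeval f (MvPolynomial.pderiv v p) * δ (f v) := by
  classical
  induction p using MvPolynomial.induction_on with
  | C a => simp
  | add p q hp hq => simp [hp, hq, add_mul, Finset.sum_add_distrib]
  | mul_X p v hp =>
    simp only [map_mul, MvPolynomial.aeval_X, Derivation.leibniz, hp, smul_eq_mul, map_add,
      MvPolynomial.pderiv_X, add_mul, Finset.sum_add_distrib, Finset.mul_sum]
    congr 1
    · simp [Pi.single_apply, apply_ite]
    · exact Finset.sum_congr rfl fun _ _ => by ring

theorem hasDerivAt_mvPolynomial_eval {σ : Type*} [Fintype σ] {x : ℝ → σ → ℝ} {w : σ → ℝ} {t : ℝ}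
    (hx : ∀ v, HasDerivAt (fun s => x s v) (w v) t) (p : MvPolynomial σ ℝ) :
    HasDerivAt (fun s => MvPolynomial.eval (x s) p)
      (∑ v, MvPolynomial.eval (x t) (MvPolynomial.pderiv v p) * w v) t := by
  classical
  induction p using MvPolynomial.induction_on with
  | C a => simpa using hasDerivAt_const t a
  | add p q hp hq =>
    simp only [map_add, add_mul, Finset.sum_add_distrib]
    exact hp.add hq
  | mul_X p v hp =>
    simp only [map_mul, MvPolynomial.eval_X]
    refine (hp.mul (hx v)).congr_deriv ?_
    simp only [Derivation.leibniz, smul_eq_mul, map_add, map_mul, MvPolynomial.eval_X,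
      MvPolynomial.pderiv_X, add_mul, Finset.sum_add_distrib, Finset.sum_mul]
    rw [add_comm]
    congr 1
    · simp [Pi.single_apply, apply_ite]
    · exact Finset.sum_congr rfl fun _ _ => by ring

/-! ### Virtual arms and isolation of the critical value zero -/

namespace Manipulator

variable (P : Manipulator)

/-- The virtual end-effector is `armOffset` plus two planar vectors of these lengths, pointing in
the directions `armAngle`. -/
def armLength : Fin 2 → ℝ :=
  match P.kind with
  | .fa => ![P.L 0, P.L 1]
  | .ap => ![P.L 0 + P.L 1, 0]
  | .pa => ![0, P.L 1]

/-- An entry whose arm has length zero is a dummy and is set to 0. -/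
def armAngle (q : Vec2) : Fin 2 → ℝ :=
  match P.kind with
  | .fa => ![q 0 + P.β, q 0 + q 1 + P.β]
  | .ap => ![q 0 + P.β, 0]
  | .pa => ![0, q 1 + P.β]

def armOffset : Vec2 :=
  match P.kind with
  | .fa => P.base
  | .ap => P.base
  | .pa => ![-P.L 0 * Real.sin P.β, P.L 0 * Real.cos P.β] + P.base

theorem xHat_zero (q : Vec2) : P.xHat q 0 = P.armOffset 0
    - P.armLength 0 * Real.sin (P.armAngle q 0) - P.armLength 1 * Real.sin (P.armAngle q 1) := by
  simp only [xHat, armOffset, armLength, armAngle, h]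
  cases P.kind <;> simp <;> ring

theorem xHat_one (q : Vec2) : P.xHat q 1 = P.armOffset 1
    + P.armLength 0 * Real.cos (P.armAngle q 0) + P.armLength 1 * Real.cos (P.armAngle q 1) := by
  simp only [xHat, armOffset, armLength, armAngle, h]
  cases P.kind <;> simp <;> ring

/-- The force `w` at the virtual end-effector produces no torque at the active joints. -/
def Balanced (q w : Vec2) : Prop :=
  ∀ j, P.armLength j *
    (Real.cos (P.armAngle q j) * w 0 + Real.sin (P.armAngle q j) * w 1) = 0

end Manipulator

namespace Setup

variable {N : ℕ} (S : Setup N)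

/-- The polynomial functions form a subalgebra, and V is built from coordinates and constants by
ring operations; no explicit polynomial is needed. -/
theorem exists_mvPolynomial_eval_eq_V :
    ∃ p : MvPolynomial (Fin N × Fin 2) ℝ, ∀ x : Fin N → Vec2,
      MvPolynomial.eval (fun v => x v.1 v.2) p = S.V x := by
  let A : Subalgebra ℝ ((Fin N → Vec2) → ℝ) :=
    (MvPolynomial.aeval fun (v : Fin N × Fin 2) (x : Fin N → Vec2) => x v.1 v.2 :
      MvPolynomial (Fin N × Fin 2) ℝ →ₐ[ℝ] ((Fin N → Vec2) → ℝ)).range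
  have hX : ∀ i j, (fun x : Fin N → Vec2 => x i j) ∈ A :=
    fun i j => ⟨MvPolynomial.X (i, j), by simp⟩
  have hC : ∀ c : ℝ, (fun _ : Fin N → Vec2 => c) ∈ A := fun c => A.algebraMap_mem c
  have hedge : ∀ (M : Method) (i j : Fin N) (a : Fin M.p),
      (fun x : Fin N → Vec2 => M.edgeFun (x i - x j) a) ∈ A := by
    intro M i j a
    cases M
    · exact A.add_mem (A.pow_mem (A.sub_mem (hX i 0) (hX j 0)) 2)
        (A.pow_mem (A.sub_mem (hX i 1) (hX j 1)) 2)
    · exact A.sub_mem (hX i a) (hX j a)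
  have hV : S.V ∈ A := by
    have : S.V = (fun _ => (1 / 2 : ℝ)) * ∑ k, ∑ a, (fun _ => S.kS k a) *
        ((fun x => S.method.edgeFun (x (S.G.tail k) - x (S.G.head k)) a)
          - fun _ => S.G.f S.method S.xstar k a) ^ 2 := by
      ext x
      simp [V, err, FormationGraph.f]
    rw [this]
    exact A.mul_mem (hC _) (A.sum_mem fun k _ => A.sum_mem fun a _ =>
      A.mul_mem (hC _) (A.pow_mem (A.sub_mem (hedge _ _ _ _) (hC _)) 2))
  obtain ⟨p, hp⟩ := hV
  refine ⟨p, fun x => ?_⟩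
  rw [← hp]
  let ev : ((Fin N → Vec2) → ℝ) →ₐ[ℝ] ℝ := Pi.evalAlgHom ℝ (fun _ => ℝ) x
  have : ev.comp (MvPolynomial.aeval fun (v : Fin N × Fin 2) (x : Fin N → Vec2) => x v.1 v.2) =
      MvPolynomial.aeval fun v => x v.1 v.2 := by
    ext v; simp [ev]
  have h2 := DFunLike.congr_fun this p
  rw [← MvPolynomial.coe_aeval_eq_eval]
  exact h2.symm

/-- Both sides are the derivative of V along the line through `x` in the coordinate direction `(i,
a)`. This links the formal gradient used in the Sard argument to the force in the controller. -/
theorem eval_pderiv_eq_eHat {p : MvPolynomial (Fin N × Fin 2) ℝ}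
    (hp : ∀ x : Fin N → Vec2, MvPolynomial.eval (fun v => x v.1 v.2) p = S.V x)
    (x : Fin N → Vec2) (i : Fin N) (a : Fin 2) :
    MvPolynomial.eval (fun v => x v.1 v.2) (MvPolynomial.pderiv (i, a) p) = S.eHat x i a := by
  classical
  let w : Fin N → Vec2 := Pi.single i (Pi.single a 1)
  have hx : HasDerivAt (fun s : ℝ => x + s • w) w 0 := by
    simpa using ((hasDerivAt_id (0 : ℝ)).smul_const w).const_add x
  have h1 := S.hasDerivAt_V hx
  have h2 := hasDerivAt_mvPolynomial_eval (x := fun s v => (x + s • w) v.1 v.2)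
    (w := fun v => w v.1 v.2) (t := 0)
    (fun v => hasDerivAt_pi.1 (hasDerivAt_pi.1 hx v.1) v.2) p
  have h3 := h2.unique (h1.congr_of_eventuallyEq (.of_forall fun s => hp _))
  have hw : ∀ v : Fin N × Fin 2, w v.1 v.2 = if v = (i, a) then 1 else 0 := by
    rintro ⟨j, b⟩
    by_cases hj : j = i
    · subst hj; simp [w, Pi.single_apply]
    · simp [w, hj]
  have hw' : ∀ j, S.eHat x j ⬝ᵥ w j = if j = i then S.eHat x i a else 0 := by
    intro j
    by_cases hj : j = i
    · subst hj; simp [w]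
    · simp [w, hj]
  simpa [hw, hw'] using h3

/-- Zero is an isolated critical value of the virtual-spring potential as a function of the active
joint angles. -/
theorem exists_isolated_critical_value :
    ∃ γ : ℝ, 0 < γ ∧ ∀ q : Fin N → Vec2,
      (∀ i, (S.manip i).Balanced (q i) (S.eHat (S.xHat q) i)) → S.V (S.xHat q) ≤ γ →
      S.V (S.xHat q) ≤ 0 := by
  obtain ⟨p, hp⟩ := S.exists_mvPolynomial_eval_eq_V
  let A := MvPolynomial (Fin N × Fin 2 × Fin 2) ℝ
  let cs : Fin N → Fin 2 → A := fun i j => MvPolynomial.X (i, j, 0)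
  let sn : Fin N → Fin 2 → A := fun i j => MvPolynomial.X (i, j, 1)
  let r : ℝ → A := fun a => MvPolynomial.C a
  let f : Fin N × Fin 2 → A := fun v => ![
    r ((S.manip v.1).armOffset 0) - r ((S.manip v.1).armLength 0) * sn v.1 0
      - r ((S.manip v.1).armLength 1) * sn v.1 1,
    r ((S.manip v.1).armOffset 1) + r ((S.manip v.1).armLength 0) * cs v.1 0
      + r ((S.manip v.1).armLength 1) * cs v.1 1] v.2
  let w : Fin N × Fin 2 → A := fun v => MvPolynomial.aeval f (MvPolynomial.pderiv v p)
  let circ : Fin N × Fin 2 → A := fun v => cs v.1 v.2 ^ 2 + sn v.1 v.2 ^ 2 - 1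
  let bal : Fin N × Fin 2 → A := fun v => r ((S.manip v.1).armLength v.2) *
    (cs v.1 v.2 * w (v.1, 0) + sn v.1 v.2 * w (v.1, 1))
  -- Critical locus: the variables are cosines and sines on unit circles, and the virtual force is
  -- balanced on every arm.
  let I : Ideal A := Ideal.span (Set.range circ ∪ Set.range bal)
  obtain ⟨m, hm0, hm⟩ := exists_polynomial_of_derivation_eq_zero (k := ℝ) I (MvPolynomial.aeval f p) (by
    intro K _ _ φ δ hI
    have hcirc : ∀ v, φ (circ v) = 0 := fun v => hI _ (Ideal.subset_span (.inl ⟨v, rfl⟩))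
    have hbal : ∀ v, φ (bal v) = 0 := fun v => hI _ (Ideal.subset_span (.inr ⟨v, rfl⟩))
    have hcomp : ∀ g, φ (MvPolynomial.aeval f g) = MvPolynomial.aeval (fun v => φ (f v)) g :=
      fun g => MvPolynomial.comp_aeval_apply (φ := φ) (f := f) g
    rw [hcomp, δ.map_mvPolynomial_aeval, Fintype.sum_prod_type]
    have hr : ∀ a, φ (r a) = algebraMap ℝ K a := fun a => φ.commutes a
    refine Finset.sum_eq_zero fun i _ => ?_
    -- On the circle the vector (δc, δs) is a multiple of its tangent (-s, c), so the variation of V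
    -- due to arm j is a multiple of its balance relation.
    have key : ∀ j, algebraMap ℝ K ((S.manip i).armLength j) *
        (-(φ (w (i, 0)) * δ (φ (sn i j))) + φ (w (i, 1)) * δ (φ (cs i j))) = 0 := by
      intro j
      have h1 := hcirc (i, j)
      have h2 := hbal (i, j)
      have h3 : φ (cs i j) * δ (φ (cs i j)) + φ (sn i j) * δ (φ (sn i j)) = 0 := by
        have h4 := congrArg δ h1
        simp only [circ, map_sub, map_add, map_pow, map_one, Derivation.leibniz_pow, map_zero,
          Derivation.map_one_eq_zero, smul_eq_mul, nsmul_eq_mul] at h4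
        have : CharZero K := charZero_of_injective_algebraMap (algebraMap ℝ K).injective
        apply mul_left_cancel₀ (two_ne_zero (α := K))
        push_cast at h4
        linear_combination h4
      simp only [circ, bal, map_sub, map_add, map_pow, map_one, map_mul, hr] at h1 h2
      generalize φ (cs i j) = c at *
      generalize φ (sn i j) = s at *
      generalize φ (w (i, 0)) = w0 at *
      generalize φ (w (i, 1)) = w1 at *
      generalize algebraMap ℝ K ((S.manip i).armLength j) = l at *
      linear_combination (-(c * δ s) + s * δ c) * h2 + l * (w1 * c - w0 * s) * h3
        - l * (-w0 * δ s + w1 * δ c) * h1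
    have hf : ∀ a, MvPolynomial.aeval (fun v => φ (f v)) (MvPolynomial.pderiv (i, a) p)
        = φ (w (i, a)) := fun a => (hcomp _).symm
    simp only [Fin.sum_univ_two, hf]
    have hf0 : δ (φ (f (i, 0))) = - algebraMap ℝ K ((S.manip i).armLength 0) * δ (φ (sn i 0))
        - algebraMap ℝ K ((S.manip i).armLength 1) * δ (φ (sn i 1)) := by
      simp [f, hr]
    have hf1 : δ (φ (f (i, 1))) = algebraMap ℝ K ((S.manip i).armLength 0) * δ (φ (cs i 0))
        + algebraMap ℝ K ((S.manip i).armLength 1) * δ (φ (cs i 1)) := by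
      simp [f, hr]
    rw [hf0, hf1]
    linear_combination key 0 + key 1)
  have hroot : ∀ q : Fin N → Vec2,
      (∀ i, (S.manip i).Balanced (q i) (S.eHat (S.xHat q) i)) → m.IsRoot (S.V (S.xHat q)) := by
    intro q hq
    let ψ : A →ₐ[ℝ] ℝ := MvPolynomial.aeval fun v =>
      ![Real.cos ((S.manip v.1).armAngle (q v.1) v.2.1),
        Real.sin ((S.manip v.1).armAngle (q v.1) v.2.1)] v.2.2
    have hcs : ∀ i j, ψ (cs i j) = Real.cos ((S.manip i).armAngle (q i) j) := fun i j => MvPolynomial.aeval_X _ (i, j, 0)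
    have hsn : ∀ i j, ψ (sn i j) = Real.sin ((S.manip i).armAngle (q i) j) := fun i j => MvPolynomial.aeval_X _ (i, j, 1)
    have hr : ∀ a, ψ (r a) = a := fun a => ψ.commutes a
    have hf : (fun v => ψ (f v)) = fun v => S.xHat q v.1 v.2 := by
      ext ⟨i, a⟩
      fin_cases a
      · simp [f, hr, hsn, xHat, Manipulator.xHat_zero]
      · simp [f, hr, hcs, xHat, Manipulator.xHat_one]
    have hcomp : ∀ g, ψ (MvPolynomial.aeval f g) =
        MvPolynomial.eval (fun v => S.xHat q v.1 v.2) g := by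
      intro g
      rw [← hf, ← MvPolynomial.coe_aeval_eq_eval]
      exact MvPolynomial.comp_aeval_apply (φ := ψ) (f := f) g
    have hw : ∀ i a, ψ (w (i, a)) = S.eHat (S.xHat q) i a := fun i a => by
      rw [hcomp, S.eval_pderiv_eq_eHat hp]
    have hle : I ≤ RingHom.ker ψ := by
      refine Ideal.span_le.2 ?_
      rintro _ (⟨v, rfl⟩ | ⟨v, rfl⟩)
      · simp [circ, hcs, hsn, RingHom.mem_ker]
      · simpa [bal, hcs, hsn, hr, hw, RingHom.mem_ker] using hq v.1 v.2
    have := hm ψ hle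
    rwa [hcomp, hp] at this
  have hmem : ∀ q : Fin N → Vec2,
      (∀ i, (S.manip i).Balanced (q i) (S.eHat (S.xHat q) i)) → 0 < S.V (S.xHat q) →
      S.V (S.xHat q) ∈ m.roots.toFinset.filter fun c => 0 < c := by
    intro q hq h0
    simpa [hm0, h0] using hroot q hq
  by_cases hne : (m.roots.toFinset.filter fun c => 0 < c).Nonempty
  · obtain ⟨c, hc, hmin⟩ := Finset.exists_min_image _ id hne
    have hc0 : 0 < c := (Finset.mem_filter.1 hc).2
    -- Half of the smallest positive root of `m`: no positive critical value lies below it.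
    refine ⟨c / 2, half_pos hc0, fun q hq hle => ?_⟩
    by_contra h0
    have := hmin _ (hmem q hq (not_le.1 h0))
    simp only [id] at this
    linarith
  · refine ⟨1, one_pos, fun q hq _ => ?_⟩
    by_contra h0
    exact hne ⟨_, hmem q hq (not_le.1 h0)⟩

end Setup

/-! ### Global trajectories of vector fields with a Lyapunov function -/

section ODE

open Set

variable {E : Type*} [NormedAddCommGroup E] [NormedSpace ℝ E]

theorem _root_.ContDiff.exists_lipschitzOnWith_closedBall [FiniteDimensional ℝ E] {F : E → E}
    (hF : ContDiff ℝ 1 F) (x : E) (r : ℝ) : ∃ K, LipschitzOnWith K F (Metric.closedBall x r) := by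
  have := FiniteDimensional.proper_real E
  exact hF.locallyLipschitz.locallyLipschitzOn.exists_lipschitzOnWith_of_compact
    (isCompact_closedBall x r)

/-- `x` is a forward trajectory of the vector field `F`. -/
def IsTrajectory (F : E → E) (x : ℝ → E) : Prop :=
  ∀ t, 0 ≤ t → HasDerivWithinAt x (F (x t)) (Ici 0) t

namespace IsTrajectory

variable {F : E → E} {x y : ℝ → E}

theorem continuousOn (hx : IsTrajectory F x) : ContinuousOn x (Ici 0) :=
  fun t ht => (hx t ht).continuousWithinAt

theorem hasDerivWithinAt_Ici (hx : IsTrajectory F x) {t : ℝ} (ht : 0 ≤ t) :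
    HasDerivWithinAt x (F (x t)) (Ici t) t :=
  (hx t ht).mono (Ici_subset_Ici.2 ht)

theorem comp_add (hx : IsTrajectory F x) {a : ℝ} (ha : 0 ≤ a) :
    IsTrajectory F fun t => x (a + t) := by
  intro t ht
  have h := (hx (a + t) (add_nonneg ha ht)).scomp t
    ((hasDerivWithinAt_id t (Ici 0)).const_add a) (fun s hs => add_nonneg ha hs)
  simpa [Function.comp_def] using h

theorem dist_le {C : ℝ} (hx : IsTrajectory F x) (hC : ∀ t, 0 ≤ t → ‖F (x t)‖ ≤ C) {t : ℝ}
    (ht : 0 ≤ t) : dist (x t) (x 0) ≤ C * t := by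
  have := Convex.norm_image_sub_le_of_norm_hasDerivWithin_le (s := Ici (0 : ℝ)) (C := C)
    (fun s hs => hx s hs) (fun s hs => hC s hs) (convex_Ici 0) self_mem_Ici ht
  simpa [dist_eq_norm, abs_of_nonneg ht] using this

theorem dist_le_mul_exp {K : NNReal} {s : Set E} (hK : LipschitzOnWith K F s) {T : ℝ}
    (hx : IsTrajectory F x) (hy : IsTrajectory F y) (hxs : ∀ t ∈ Ico 0 T, x t ∈ s)
    (hys : ∀ t ∈ Ico 0 T, y t ∈ s) {t : ℝ} (ht : t ∈ Icc 0 T) :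
    dist (x t) (y t) ≤ dist (x 0) (y 0) * Real.exp (K * t) := by
  have := dist_le_of_trajectories_ODE_of_mem (v := fun _ => F) (s := fun _ => s) (a := 0) (b := T)
    (fun _ _ => hK) (hx.continuousOn.mono Icc_subset_Ici_self)
    (fun t ht => hx.hasDerivWithinAt_Ici ht.1) hxs (hy.continuousOn.mono Icc_subset_Ici_self)
    (fun t ht => hy.hasDerivWithinAt_Ici ht.1) hys le_rfl t ht
  simpa using this

end IsTrajectory

theorem exists_isTrajectory_of_bounded [FiniteDimensional ℝ E] {F : E → E} (hF : ContDiff ℝ 1 F)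
    {C : ℝ} (hC : ∀ x, ‖F x‖ ≤ C) (x₀ : E) : ∃ x, IsTrajectory F x ∧ x 0 = x₀ := by
  have hC0 : 0 ≤ C := (norm_nonneg _).trans (hC x₀)
  have hloc : ∀ n : ℕ, ∃ α : ℝ → E, α 0 = x₀ ∧
      ∀ t ∈ Icc (0 : ℝ) n, HasDerivWithinAt α (F (α t)) (Icc 0 (n : ℝ)) t := by
    intro n
    obtain ⟨K, hK⟩ := hF.exists_lipschitzOnWith_closedBall x₀ (C * n)
    -- A field bounded by C cannot leave the ball of radius C n within time n, so Picard–Lindelöf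
    -- applies on the whole interval.
    have hpl : IsPicardLindelof (fun _ => F) (tmin := 0) (tmax := n)
        ⟨0, left_mem_Icc.2 n.cast_nonneg⟩ x₀ ⟨C * n, by positivity⟩ 0 ⟨C, hC0⟩ K :=
      .of_time_independent (fun x _ => hC x) hK (by simp; rfl)
    exact hpl.exists_eq_forall_mem_Icc_hasDerivWithinAt₀
  choose α hα0 hα using hloc
  have hcont : ∀ n, ContinuousOn (α n) (Icc 0 (n : ℝ)) :=
    fun n t ht => (hα n t ht).continuousWithinAt
  have hder : ∀ n : ℕ, ∀ t ∈ Ico (0 : ℝ) n, HasDerivWithinAt (α n) (F (α n t)) (Ici t) t :=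
    fun n t ht => (hα n t ⟨ht.1, ht.2.le⟩).mono_of_mem_nhdsWithin
      (mem_of_superset (Icc_mem_nhdsGE ht.2) (Icc_subset_Icc_left ht.1))
  have hball : ∀ n : ℕ, ∀ t ∈ Icc (0 : ℝ) n, α n t ∈ Metric.closedBall x₀ (C * n) := by
    intro n t ht
    have := Convex.norm_image_sub_le_of_norm_hasDerivWithin_le (C := C) (hα n)
      (fun s _ => hC _) (convex_Icc _ _) (left_mem_Icc.2 n.cast_nonneg) ht
    rw [hα0, sub_zero, Real.norm_of_nonneg ht.1] at this
    rw [Metric.mem_closedBall, dist_eq_norm]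
    exact this.trans (by gcongr; exact ht.2)
  have hagree : ∀ m n : ℕ, m ≤ n → EqOn (α m) (α n) (Icc 0 (m : ℝ)) := by
    intro m n hmn
    have hmn' : (m : ℝ) ≤ n := Nat.cast_le.2 hmn
    obtain ⟨K, hK⟩ := hF.exists_lipschitzOnWith_closedBall x₀ (C * n)
    refine ODE_solution_unique_of_mem_Icc_right (v := fun _ => F)
      (s := fun _ => Metric.closedBall x₀ (C * n)) (fun _ _ => hK) (hcont m) (hder m)
      (fun t ht => Metric.closedBall_subset_closedBall (by gcongr) (hball m t ⟨ht.1, ht.2.le⟩))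
      ((hcont n).mono (Icc_subset_Icc_right hmn'))
      (fun t ht => hder n t ⟨ht.1, ht.2.trans_le hmn'⟩)
      (fun t ht => hball n t ⟨ht.1, ht.2.le.trans hmn'⟩) (by rw [hα0, hα0])
  -- The extra 1 puts `t` strictly before the end of the interval, so that the derivative there
  -- passes to the half-line.
  let x : ℝ → E := fun t => α (⌈t⌉₊ + 1) t
  have hx : ∀ n : ℕ, EqOn x (α n) (Icc 0 (n : ℝ)) := by
    intro n t ht
    have h1 : t ≤ (⌈t⌉₊ + 1 : ℕ) := (Nat.le_ceil t).trans (Nat.cast_le.2 (Nat.le_succ _))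
    rcases le_total n (⌈t⌉₊ + 1) with h | h
    · exact (hagree _ _ h ht).symm
    · exact hagree _ _ h ⟨ht.1, h1⟩
  refine ⟨x, fun t ht => ?_, by rw [hx 0 (by simp), hα0]⟩
  have htn : t < (⌈t⌉₊ + 1 : ℕ) := by push_cast; linarith [Nat.le_ceil t]
  have hmem : t ∈ Icc (0 : ℝ) (⌈t⌉₊ + 1 : ℕ) := ⟨ht, htn.le⟩
  have h := ((hα _ t hmem).congr (fun s hs => hx _ hs) (hx _ hmem))
  rw [hx _ hmem]
  refine h.mono_of_mem_nhdsWithin ?_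
  rw [← Ici_inter_Iic]
  exact inter_mem self_mem_nhdsWithin (mem_nhdsWithin_of_mem_nhds (Iic_mem_nhds htn))

theorem antitoneOn_of_isTrajectory {F : E → E} {U : E → ℝ} (hU : Differentiable ℝ U)
    (hdec : ∀ x, fderiv ℝ U x (F x) ≤ 0) {x : ℝ → E} (hx : IsTrajectory F x) :
    AntitoneOn (fun t => U (x t)) (Ici 0) := by
  have hd : ∀ t, 0 ≤ t → HasDerivWithinAt (fun s => U (x s)) (fderiv ℝ U (x t) (F (x t))) (Ici 0) t :=
    fun t ht => (hU (x t)).hasFDerivAt.comp_hasDerivWithinAt t (hx t ht)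
  refine antitoneOn_of_deriv_nonpos (convex_Ici 0) (fun t ht => (hd t ht).continuousWithinAt)
    (fun t ht => ?_) fun t ht => ?_
  · exact ((hd t (interior_subset ht)).differentiableWithinAt).mono interior_subset
  · rw [interior_Ici] at ht
    rw [((hd t ht.le).hasDerivAt (Ici_mem_nhds ht)).deriv]
    exact hdec _

/-- A vector field that is bounded on the sublevel sets of a Lyapunov function has global forward
trajectories. -/
theorem exists_isTrajectory_of_lyapunov [FiniteDimensional ℝ E] {F : E → E} (hF : ContDiff ℝ 1 F)
    {U : E → ℝ} (hU : Differentiable ℝ U) (hdec : ∀ x, fderiv ℝ U x (F x) ≤ 0) {γ C : ℝ}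
    (hC : ∀ x, U x ≤ γ → ‖F x‖ ≤ C) {x₀ : E} (hx₀ : U x₀ ≤ γ) :
    ∃ x, IsTrajectory F x ∧ x 0 = x₀ := by
  have hC1 : 0 < |C| + 1 := by positivity
  -- The cutoff is applied to the value of F, not to the state. It makes the field bounded but only
  -- rescales it by a nonnegative factor, so U still decreases; the trajectory stays where ‖F‖ ≤ C,
  -- and there the cutoff equals 1.
  let φ : ContDiffBump (0 : E) := ⟨|C| + 1, |C| + 2, hC1, by linarith⟩
  let F' : E → E := fun x => φ (F x) • F x
  have hF' : ContDiff ℝ 1 F' := (φ.contDiff.comp hF).smul hF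
  have hbd : ∀ x, ‖F' x‖ ≤ |C| + 2 := by
    intro x
    by_cases h : ‖F x‖ < |C| + 2
    · rw [norm_smul, Real.norm_of_nonneg φ.nonneg]
      exact (mul_le_of_le_one_left (norm_nonneg _) φ.le_one).trans h.le
    · have : φ (F x) = 0 := φ.zero_of_le_dist (by simpa using not_lt.1 h)
      simp only [F', this, zero_smul, norm_zero]
      positivity
  obtain ⟨x, hx, hx0⟩ := exists_isTrajectory_of_bounded hF' hbd x₀
  have hanti := antitoneOn_of_isTrajectory hU (F := F') (fun z => by
    simpa [F'] using mul_nonpos_of_nonneg_of_nonpos φ.nonneg (hdec z)) hx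
  refine ⟨x, fun t ht => ?_, hx0⟩
  have hle : U (x t) ≤ γ := (hanti self_mem_Ici ht ht).trans (by simpa [hx0] using hx₀)
  have h1 : φ (F (x t)) = 1 := by
    refine φ.one_of_mem_closedBall ?_
    rw [mem_closedBall_zero_iff]
    exact (hC _ hle).trans ((le_abs_self C).trans (le_add_of_nonneg_right zero_le_one))
  simpa [F', h1] using hx t ht

/-- Trajectories in a sublevel set depend continuously on the initial state, locally uniformly in
time; in particular pointwise limits of trajectories are trajectories. -/
theorem exists_isTrajectory_tendsto [FiniteDimensional ℝ E] {F : E → E} (hF : ContDiff ℝ 1 F)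
    {U : E → ℝ} (hU : Differentiable ℝ U) (hdec : ∀ x, fderiv ℝ U x (F x) ≤ 0) {γ C : ℝ}
    (hC : ∀ x, U x ≤ γ → ‖F x‖ ≤ C) {y : ℕ → ℝ → E} (hy : ∀ n, IsTrajectory F (y n))
    (hyγ : ∀ n, U (y n 0) ≤ γ) {s : E} (hs : Tendsto (fun n => y n 0) atTop (𝓝 s)) :
    ∃ z, IsTrajectory F z ∧ z 0 = s ∧
      ∀ t, 0 ≤ t → Tendsto (fun n => y n t) atTop (𝓝 (z t)) := by
  have hsγ : U s ≤ γ := le_of_tendsto ((hU.continuous.tendsto s).comp hs) (.of_forall hyγ)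
  obtain ⟨z, hz, hz0⟩ := exists_isTrajectory_of_lyapunov hF hU hdec hC hsγ
  refine ⟨z, hz, hz0, fun T hT => ?_⟩
  obtain ⟨K, hK⟩ := hF.exists_lipschitzOnWith_closedBall s (C * T + 1)
  have hC0 : 0 ≤ C := (norm_nonneg _).trans (hC s hsγ)
  have hmem : ∀ x : ℝ → E, IsTrajectory F x → U (x 0) ≤ γ → dist (x 0) s ≤ 1 →
      ∀ t ∈ Ico 0 T, x t ∈ Metric.closedBall s (C * T + 1) := by
    intro x hx hxγ hx0 t ht
    have hanti := antitoneOn_of_isTrajectory hU hdec hx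
    have h1 := hx.dist_le (fun τ hτ => hC _ ((hanti self_mem_Ici hτ hτ).trans hxγ)) ht.1
    have h2 : C * t ≤ C * T := by gcongr; exact ht.2.le
    rw [Metric.mem_closedBall]
    linarith [dist_triangle (x t) (x 0) s]
  have hzmem := hmem z hz (hz0 ▸ hsγ) (by simp [hz0])
  rw [tendsto_iff_dist_tendsto_zero]
  have hlim : Tendsto (fun n => dist (y n 0) s * Real.exp (K * T)) atTop (𝓝 0) := by
    simpa using (tendsto_iff_dist_tendsto_zero.1 hs).mul_const (Real.exp (K * T))
  refine squeeze_zero' (.of_forall fun _ => dist_nonneg) ?_ hlim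
  filter_upwards [Metric.tendsto_nhds.1 hs 1 one_pos] with n hn
  have := (hy n).dist_le_mul_exp hK hz (hmem _ (hy n) (hyγ n) hn.le) hzmem (right_mem_Icc.2 hT)
  rwa [hz0] at this

end ODE

/-! ### Rigidity and isolation of the desired shapes -/

namespace FormationGraph

variable {N : ℕ} (G : FormationGraph N)

/-- Differential of the squared edge lengths at `x`. -/
def edgeDifferential (x : Fin N → Vec2) : (Fin N → Vec2) →ₗ[ℝ] (Fin G.numEdges → ℝ) where
  toFun w k := 2 * (x (G.tail k) 0 - x (G.head k) 0) * (w (G.tail k) 0 - w (G.head k) 0)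
      + 2 * (x (G.tail k) 1 - x (G.head k) 1) * (w (G.tail k) 1 - w (G.head k) 1)
  map_add' _ _ := by ext; simp; ring
  map_smul' _ _ := by ext; simp; ring

theorem f_distance_eq_iff {x y : Fin N → Vec2} : G.f .distance x = G.f .distance y ↔ ∀ k,
    (x (G.tail k) 0 - x (G.head k) 0) ^ 2 + (x (G.tail k) 1 - x (G.head k) 1) ^ 2 =
      (y (G.tail k) 0 - y (G.head k) 0) ^ 2 + (y (G.tail k) 1 - y (G.head k) 1) ^ 2 :=
  ⟨fun h k => congrFun (congrFun h k) (0 : Fin 1), fun h => funext fun k => funext fun _ => h k⟩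

theorem fderiv_f_distance_apply (x w : Fin N → Vec2) (k : Fin G.numEdges)
    (a : Fin Method.distance.p) :
    fderiv ℝ (G.f .distance) x w k a = G.edgeDifferential x w k := by
  have hd : DifferentiableAt ℝ (G.f .distance) x := by
    refine differentiableAt_pi.2 fun k => differentiableAt_pi.2 fun a => ?_
    change DifferentiableAt ℝ (fun x : Fin N → Vec2 =>
      (x (G.tail k) 0 - x (G.head k) 0) ^ 2 + (x (G.tail k) 1 - x (G.head k) 1) ^ 2) x
    fun_prop
  have hx : HasDerivAt (fun s : ℝ => x + s • w) w 0 := by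
    simpa using ((hasDerivAt_id (0 : ℝ)).smul_const w).const_add x
  have h1 : HasDerivAt (G.f .distance ∘ fun s : ℝ => x + s • w)
      (fderiv ℝ (G.f .distance) x w) 0 := by
    refine HasFDerivAt.comp_hasDerivAt (0 : ℝ) ?_ hx
    simpa using hd.hasFDerivAt
  have hx' := hasDerivAt_pi.1 hx
  have h2 := Method.hasDerivAt_edgeFun .distance ((hx' (G.tail k)).sub (hx' (G.head k)))
  have h3 := (hasDerivAt_pi.1 h1 k).unique h2
  rw [h3]
  simp [Method.D, Matrix.mulVec, dotProduct, Fin.sum_univ_two, edgeDifferential, Matrix.transpose]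

theorem ker_fderiv_f_distance (x : Fin N → Vec2) :
    LinearMap.ker (fderiv ℝ (G.f .distance) x).toLinearMap = LinearMap.ker (G.edgeDifferential x) := by
  ext w
  simp only [LinearMap.mem_ker, ContinuousLinearMap.coe_coe]
  constructor
  · intro h
    ext k
    rw [← G.fderiv_f_distance_apply x w k (0 : Fin 1), h]
    rfl
  · intro h
    ext k a
    rw [G.fderiv_f_distance_apply, h]
    rfl

theorem finrank_ker_edgeDifferential {x : Fin N → Vec2} (h : G.InfinitesimallyRigid x) :
    Module.finrank ℝ (LinearMap.ker (G.edgeDifferential x)) = 3 := by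
  have h1 := LinearMap.finrank_range_add_finrank_ker (fderiv ℝ (G.f .distance) x).toLinearMap
  have h2 : Module.finrank ℝ (Fin N → Vec2) = N * 2 := by
    rw [Module.finrank_pi_fintype]; simp
  rw [ker_fderiv_f_distance] at h1
  rw [InfinitesimallyRigid] at h
  omega

/-- If all edges were degenerate, the differential would vanish and its kernel would have even
dimension 2N, whereas rigidity makes it 3. -/
theorem exists_edge_ne_of_infinitesimallyRigid {x : Fin N → Vec2} (h : G.InfinitesimallyRigid x) :
    ∃ k, x (G.tail k) ≠ x (G.head k) := by
  by_contra! hne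
  have h0 : G.edgeDifferential x = 0 := by
    refine LinearMap.ext fun w => funext fun k => ?_
    simp [edgeDifferential, hne k]
  have h1 := G.finrank_ker_edgeDifferential h
  rw [h0, LinearMap.ker_zero, finrank_top, Module.finrank_pi_fintype] at h1
  simp at h1
  omega

/-- In an infinitesimally rigid framework, an infinitesimal motion fixing two distinct points
vanishes. -/
theorem eq_zero_of_edgeDifferential_eq_zero {x : Fin N → Vec2} (h : G.InfinitesimallyRigid x)
    {i j : Fin N} (hne : x i ≠ x j) {w : Fin N → Vec2} (hw : G.edgeDifferential x w = 0)
    (hi : w i = 0) (hj : w j = 0) : w = 0 := by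
  let K := LinearMap.ker (G.edgeDifferential x)
  have hK : Module.finrank ℝ K = 3 := G.finrank_ker_edgeDifferential h
  let d : Vec2 := x i - x j
  have hd : d 0 ^ 2 + d 1 ^ 2 ≠ 0 := by
    intro h0
    have h1 : d 0 = 0 := by nlinarith [sq_nonneg (d 0), sq_nonneg (d 1)]
    have h2 : d 1 = 0 := by nlinarith [sq_nonneg (d 0), sq_nonneg (d 1)]
    exact hne (sub_eq_zero.1 (funext (Fin.forall_fin_two.2 ⟨h1, h2⟩)))
  -- The velocity of point i and the rotational part of the relative velocity of i and j.
  -- Translations and rotations realize all values inside the three-dimensional kernel, so this map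
  -- is injective on the kernel.
  let Ψ : (Fin N → Vec2) →ₗ[ℝ] (Fin 3 → ℝ) :=
    { toFun := fun w => ![w i 0, w i 1, (w i 1 - w j 1) * d 0 - (w i 0 - w j 0) * d 1]
      map_add' := fun a b => by ext m; fin_cases m <;> simp; ring
      map_smul' := fun c a => by ext m; fin_cases m <;> simp; ring }
  have hsurj : Function.Surjective (Ψ ∘ₗ K.subtype) := by
    intro y
    let c := y 2 / (d 0 ^ 2 + d 1 ^ 2)
    -- Translation plus rotation about `x i` with angular velocity `c`.
    let u : Fin N → Vec2 := fun m =>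
      ![y 0 - c * (x m 1 - x i 1), y 1 + c * (x m 0 - x i 0)]
    have hu : u ∈ K := by
      rw [LinearMap.mem_ker]
      ext k
      simp [edgeDifferential, u]
      ring
    refine ⟨⟨u, hu⟩, ?_⟩
    have hc : c * (d 0 ^ 2 + d 1 ^ 2) = y 2 := div_mul_cancel₀ _ hd
    ext m
    fin_cases m
    · simp [Ψ, u]
    · simp [Ψ, u]
    · simp only [Ψ, u, LinearMap.comp_apply, Submodule.subtype_apply, LinearMap.coe_mk,
        AddHom.coe_mk]
      simp only [d, Pi.sub_apply] at hc ⊢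
      simp
      linear_combination hc
  have hinj : Function.Injective (Ψ ∘ₗ K.subtype) :=
    (LinearMap.injective_iff_surjective_of_finrank_eq_finrank (by rw [hK]; simp)).2 hsurj
  have hwK : w ∈ K := by rw [LinearMap.mem_ker]; exact hw
  have : (⟨w, hwK⟩ : K) = 0 := hinj (by
    ext m
    fin_cases m <;> simp [Ψ, hi, hj])
  exact congrArg Subtype.val this

theorem abs_apply_le_norm (w : Fin N → Vec2) (m : Fin N) (a : Fin 2) : |w m a| ≤ ‖w‖ :=
  (norm_le_pi_norm (w m) a).trans (norm_le_pi_norm w m)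

theorem norm_le_of_abs_apply_le {w : Fin N → Vec2} {r : ℝ} (hr : 0 ≤ r)
    (h : ∀ m a, |w m a| ≤ r) : ‖w‖ ≤ r :=
  (pi_norm_le_iff_of_nonneg hr).2 fun m => (pi_norm_le_iff_of_nonneg hr).2 fun a => h m a

/-- An infinitesimally rigid framework with two points pinned is locally unique. -/
theorem exists_pinned_unique {x : Fin N → Vec2} (h : G.InfinitesimallyRigid x) {i j : Fin N}
    (hne : x i ≠ x j) : ∃ ε : ℝ, 0 < ε ∧ ∀ w : Fin N → Vec2, w i = 0 → w j = 0 →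
      G.f .distance (x + w) = G.f .distance x → ‖w‖ < ε → w = 0 := by
  let Λ := (G.edgeDifferential x).prod
    ((LinearMap.proj (R := ℝ) (φ := fun _ : Fin N => Vec2) i).prod (LinearMap.proj j))
  have hΛ : LinearMap.ker Λ = ⊥ := by
    refine LinearMap.ker_eq_bot'.2 fun w hw => ?_
    have h1 : (G.edgeDifferential x w, w i, w j) = 0 := hw
    simp only [Prod.mk_eq_zero] at h1
    exact G.eq_zero_of_edgeDifferential_eq_zero h hne h1.1 h1.2.1 h1.2.2
  obtain ⟨K, hK0, hK⟩ := LinearMap.exists_antilipschitzWith Λ hΛ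
  have hbound : ∀ w : Fin N → Vec2, w i = 0 → w j = 0 →
      ‖w‖ ≤ K * ‖G.edgeDifferential x w‖ := by
    intro w hi hj
    have h1 := hK.le_mul_dist w 0
    have h2 : Λ w = (G.edgeDifferential x w, 0, 0) := by
      change (G.edgeDifferential x w, w i, w j) = _
      rw [hi, hj]
    rw [map_zero, dist_zero_right, dist_zero_right, h2] at h1
    simpa [Prod.norm_def] using h1
  have hK0' : (0 : ℝ) < K := hK0
  -- The constraint is exactly quadratic, so the differential at `w` equals minus squared edge
  -- differences, at most 2 (2‖w‖)² = 8‖w‖². Hence ‖w‖ ≤ 8K‖w‖², which forces `w = 0` when ‖w‖ is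
  -- below this radius.
  refine ⟨1 / (8 * K), by positivity, fun w hi hj hf hw => ?_⟩
  have h1 : ‖G.edgeDifferential x w‖ ≤ 8 * ‖w‖ ^ 2 := by
    refine (pi_norm_le_iff_of_nonneg (by positivity)).2 fun k => ?_
    have h2 := G.f_distance_eq_iff.1 hf k
    simp only [Pi.add_apply] at h2
    have h3 : G.edgeDifferential x w k = -((w (G.tail k) 0 - w (G.head k) 0) ^ 2
        + (w (G.tail k) 1 - w (G.head k) 1) ^ 2) := by
      simp only [edgeDifferential, LinearMap.coe_mk, AddHom.coe_mk]
      linear_combination h2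
    have h4 : ∀ b, (w (G.tail k) b - w (G.head k) b) ^ 2 ≤ (2 * ‖w‖) ^ 2 := fun b => by
      refine sq_le_sq.2 ?_
      rw [abs_of_nonneg (by positivity : 0 ≤ 2 * ‖w‖)]
      linarith [abs_sub (w (G.tail k) b) (w (G.head k) b), abs_apply_le_norm w (G.tail k) b,
        abs_apply_le_norm w (G.head k) b]
    rw [h3, norm_neg, Real.norm_of_nonneg (by positivity)]
    linarith [h4 0, h4 1]
  have h2 := hbound w hi hj
  by_contra h0
  have h3 : 0 < ‖w‖ := norm_pos_iff.2 h0
  have h4 : (K : ℝ) * ‖G.edgeDifferential x w‖ ≤ K * (8 * ‖w‖ ^ 2) := by gcongr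
  rw [lt_div_iff₀ (by positivity)] at hw
  nlinarith

/-- The configuration obtained from `x` by a rotation and a translation. -/
def move (a b : ℝ) (c : Vec2) (x : Fin N → Vec2) : Fin N → Vec2 := fun m =>
  ![a * x m 0 - b * x m 1 + c 0, b * x m 0 + a * x m 1 + c 1]

theorem mem_shapeSet_iff {x y : Fin N → Vec2} :
    y ∈ shapeSet x ↔ ∃ a b c, a ^ 2 + b ^ 2 = 1 ∧ y = move a b c x := by
  constructor
  · rintro ⟨R, hR, c, hy⟩
    obtain ⟨h00, h01, hunit⟩ := Matrix.mem_specialOrthogonalGroup_fin_two_iff.1 hR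
    refine ⟨R 0 0, R 1 0, c, by rw [← hunit, h01]; ring, funext fun m => ?_⟩
    rw [hy m]
    ext l
    fin_cases l
    · simp [move, h01]; ring
    · simp [move, h00]
  · rintro ⟨a, b, c, hab, rfl⟩
    refine ⟨!![a, -b; b, a], ?_, c, fun m => ?_⟩
    · rw [Matrix.of_mem_specialOrthogonalGroup_fin_two_iff]
      exact ⟨rfl, rfl, by rw [← hab]; ring⟩
    · ext l
      fin_cases l
      · simp [move, dotProduct, Fin.sum_univ_two]; ring
      · simp [move, dotProduct, Fin.sum_univ_two]

theorem f_distance_move {a b : ℝ} (hab : a ^ 2 + b ^ 2 = 1) (c : Vec2) (x : Fin N → Vec2) :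
    G.f .distance (move a b c x) = G.f .distance x := by
  refine G.f_distance_eq_iff.2 fun k => ?_
  simp only [move, Matrix.cons_val_zero, Matrix.cons_val_one]
  linear_combination ((x (G.tail k) 0 - x (G.head k) 0) ^ 2
    + (x (G.tail k) 1 - x (G.head k) 1) ^ 2) * hab

/-- With vectors read as complex numbers, a + bi is the quotient d'/d, of modulus one. -/
theorem exists_rotation {d d' : Vec2} (hd : 0 < d 0 ^ 2 + d 1 ^ 2)
    (hd' : d' 0 ^ 2 + d' 1 ^ 2 = d 0 ^ 2 + d 1 ^ 2) :
    ∃ a b : ℝ, a ^ 2 + b ^ 2 = 1 ∧ a * d 0 - b * d 1 = d' 0 ∧ b * d 0 + a * d 1 = d' 1 := by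
  let a := (d 0 * d' 0 + d 1 * d' 1) / (d 0 ^ 2 + d 1 ^ 2)
  let b := (d 0 * d' 1 - d 1 * d' 0) / (d 0 ^ 2 + d 1 ^ 2)
  have ha : a * (d 0 ^ 2 + d 1 ^ 2) = d 0 * d' 0 + d 1 * d' 1 := div_mul_cancel₀ _ hd.ne'
  have hb : b * (d 0 ^ 2 + d 1 ^ 2) = d 0 * d' 1 - d 1 * d' 0 := div_mul_cancel₀ _ hd.ne'
  have hrot0 : a * d 0 - b * d 1 = d' 0 := by
    apply mul_right_cancel₀ hd.ne'
    linear_combination d 0 * ha - d 1 * hb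
  have hrot1 : b * d 0 + a * d 1 = d' 1 := by
    apply mul_right_cancel₀ hd.ne'
    linear_combination d 0 * hb + d 1 * ha
  refine ⟨a, b, ?_, hrot0, hrot1⟩
  apply mul_right_cancel₀ hd.ne'
  rw [← hrot0, ← hrot1] at hd'
  linear_combination hd'

/-- Rotations agreeing approximately on a nonzero vector are close. -/
theorem abs_le_of_rotation {A B D r : ℝ} {d e : Vec2} (hD : 0 < D) (hD2 : D ^ 2 = d 0 ^ 2 + d 1 ^ 2)
    (he : ∀ c, |e c| ≤ 2 * r) (h0 : A * d 0 - B * d 1 = e 0) (h1 : B * d 0 + A * d 1 = e 1) :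
    |A| ≤ 3 * r / D ∧ |B| ≤ 3 * r / D := by
  have hr : 0 ≤ r := by linarith [(abs_nonneg _).trans (he 0)]
  have hsq : (A ^ 2 + B ^ 2) * D ^ 2 ≤ (3 * r) ^ 2 := by
    -- Multiplicativity of the complex modulus; the right-hand side is at most 8 r², rounded up to
    -- (3r)².
    have h3 : (A ^ 2 + B ^ 2) * D ^ 2 = e 0 ^ 2 + e 1 ^ 2 := by
      rw [hD2, ← h0, ← h1]
      ring
    have h2 : ∀ c, e c ^ 2 ≤ (2 * r) ^ 2 := fun c => by
      refine sq_le_sq.2 ?_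
      rw [abs_of_nonneg (by positivity : 0 ≤ 2 * r)]
      exact he c
    rw [h3]
    nlinarith [h2 0, h2 1, sq_nonneg r]
  constructor
  · rw [le_div_iff₀ hD, ← abs_of_pos hD, ← abs_mul]
    exact abs_le_of_sq_le_sq (by nlinarith [mul_nonneg (sq_nonneg B) (sq_nonneg D)]) (by positivity)
  · rw [le_div_iff₀ hD, ← abs_of_pos hD, ← abs_mul]
    exact abs_le_of_sq_le_sq (by nlinarith [mul_nonneg (sq_nonneg A) (sq_nonneg D)]) (by positivity)

/-- A configuration near one congruent to `x` that agrees with `x` on the distance of two distinct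
points is congruent to a small perturbation of `x` fixing these points. -/
theorem exists_move_add {x : Fin N → Vec2} {i j : Fin N} (hne : x i ≠ x j) :
    ∃ Q : ℝ, 0 < Q ∧ ∀ z ∈ shapeSet x, ∀ y : Fin N → Vec2,
      (y i 0 - y j 0) ^ 2 + (y i 1 - y j 1) ^ 2 = (x i 0 - x j 0) ^ 2 + (x i 1 - x j 1) ^ 2 →
      ∃ a b c w, a ^ 2 + b ^ 2 = 1 ∧ y = move a b c (x + w) ∧ w i = 0 ∧ w j = 0 ∧
        ‖w‖ ≤ Q * dist z y := by
  let d : Vec2 := x i - x j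
  have hd : 0 < d 0 ^ 2 + d 1 ^ 2 := by
    refine lt_of_le_of_ne (by positivity) fun h0 => ?_
    have h1 : d 0 = 0 := by nlinarith [sq_nonneg (d 0), sq_nonneg (d 1)]
    have h2 : d 1 = 0 := by nlinarith [sq_nonneg (d 0), sq_nonneg (d 1)]
    exact hne (sub_eq_zero.1 (funext (Fin.forall_fin_two.2 ⟨h1, h2⟩)))
  let D := Real.sqrt (d 0 ^ 2 + d 1 ^ 2)
  have hD : 0 < D := Real.sqrt_pos.2 hd
  have hD2 : D ^ 2 = d 0 ^ 2 + d 1 ^ 2 := Real.sq_sqrt hd.le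
  -- Each coordinate of the residual `u` below is at most 2 (3r/D)(2‖x‖) + 2r = (Q/2) r; rotating it
  -- back adds two such terms.
  let Q := 24 * ‖x‖ / D + 4
  refine ⟨Q, by positivity, fun z hz y hy => ?_⟩
  obtain ⟨a₀, b₀, c₀, -, rfl⟩ := mem_shapeSet_iff.1 hz
  -- The exact rotation taking the segment from `x j` to `x i` onto that from `y j` to `y i`; with
  -- the translation `c` it pins both points.
  obtain ⟨a, b, hab, hrot0, hrot1⟩ := exists_rotation (d' := y i - y j) hd hy
  set r := dist (move a₀ b₀ c₀ x) y
  have hr : 0 ≤ r := dist_nonneg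
  let η : Fin N → Vec2 := y - move a₀ b₀ c₀ x
  have hη : ∀ m a, |η m a| ≤ r := fun m a =>
    (abs_apply_le_norm η m a).trans (by rw [← dist_eq_norm, dist_comm])
  have hη0 : ∀ m, η m 0 = y m 0 - (a₀ * x m 0 - b₀ * x m 1 + c₀ 0) := fun _ => rfl
  have hη1 : ∀ m, η m 1 = y m 1 - (b₀ * x m 0 + a₀ * x m 1 + c₀ 1) := fun _ => rfl
  have hd0 : ∀ c, d c = x i c - x j c := fun _ => rfl
  rw [Pi.sub_apply, hd0, hd0] at hrot0 hrot1
  obtain ⟨hA, hB⟩ := abs_le_of_rotation (A := a₀ - a) (B := b₀ - b) (e := η j - η i) (r := r) hD hD2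
    (fun c => by
      rw [Pi.sub_apply]
      linarith [abs_sub (η j c) (η i c), hη i c, hη j c])
    (by rw [Pi.sub_apply, hη0, hη0, hd0, hd0]; linear_combination -hrot0)
    (by rw [Pi.sub_apply, hη1, hη1, hd0, hd0]; linear_combination -hrot1)
  let c : Vec2 := ![y i 0 - (a * x i 0 - b * x i 1), y i 1 - (b * x i 0 + a * x i 1)]
  have hc0 : c 0 = y i 0 - (a * x i 0 - b * x i 1) := rfl
  have hc1 : c 1 = y i 1 - (b * x i 0 + a * x i 1) := rfl
  let u : Fin N → Fin 2 → ℝ := fun m =>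
    ![y m 0 - (a * x m 0 - b * x m 1) - c 0, y m 1 - (b * x m 0 + a * x m 1) - c 1]
  have hu0 : ∀ m, u m 0 = y m 0 - (a * x m 0 - b * x m 1) - c 0 := fun _ => rfl
  have hu1 : ∀ m, u m 1 = y m 1 - (b * x m 0 + a * x m 1) - c 1 := fun _ => rfl
  have hx2 : ∀ m c, |x m c - x i c| ≤ 2 * ‖x‖ := fun m c => by
    linarith [abs_sub (x m c) (x i c), abs_apply_le_norm x m c, abs_apply_le_norm x i c]
  have hu : ∀ m, |u m 0| ≤ Q / 2 * r ∧ |u m 1| ≤ Q / 2 * r := by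
    intro m
    have hQr : Q / 2 * r = 3 * r / D * (2 * ‖x‖) + 3 * r / D * (2 * ‖x‖) + r + r := by
      simp only [Q]; ring
    have hm : ∀ s t : ℝ, |s| ≤ 3 * r / D → |t| ≤ 2 * ‖x‖ → |s * t| ≤ 3 * r / D * (2 * ‖x‖) :=
      fun s t hs ht => by rw [abs_mul]; gcongr
    rw [hQr]
    constructor
    · have h1 : u m 0 = (a₀ - a) * (x m 0 - x i 0) - (b₀ - b) * (x m 1 - x i 1)
          + η m 0 - η i 0 := by
        rw [hu0, hc0, hη0, hη0]; ring
      rw [h1]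
      have h2 := abs_le.1 (hm _ _ hA (hx2 m 0))
      have h3 := abs_le.1 (hm _ _ hB (hx2 m 1))
      have h4 := abs_le.1 (hη m 0)
      have h5 := abs_le.1 (hη i 0)
      rw [abs_le]; constructor <;> linarith
    · have h1 : u m 1 = (b₀ - b) * (x m 0 - x i 0) + (a₀ - a) * (x m 1 - x i 1)
          + η m 1 - η i 1 := by
        rw [hu1, hc1, hη1, hη1]; ring
      rw [h1]
      have h2 := abs_le.1 (hm _ _ hB (hx2 m 0))
      have h3 := abs_le.1 (hm _ _ hA (hx2 m 1))
      have h4 := abs_le.1 (hη m 1)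
      have h5 := abs_le.1 (hη i 1)
      rw [abs_le]; constructor <;> linarith
  -- The residual of `y` after the pinned motion, carried back by the inverse rotation.
  let w : Fin N → Vec2 := fun m => ![a * u m 0 + b * u m 1, -b * u m 0 + a * u m 1]
  have hw : ∀ m, u m 0 = 0 → u m 1 = 0 → w m = 0 := by
    intro m h0 h1
    ext l
    fin_cases l <;> simp [w, h0, h1]
  have ha1 : |a| ≤ 1 := abs_le_one_iff_mul_self_le_one.2 (by nlinarith [sq_nonneg b])
  have hb1 : |b| ≤ 1 := abs_le_one_iff_mul_self_le_one.2 (by nlinarith [sq_nonneg a])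
  refine ⟨a, b, c, w, hab, funext fun m => funext (Fin.forall_fin_two.2 ⟨?_, ?_⟩),
    hw i ?_ ?_, hw j ?_ ?_, norm_le_of_abs_apply_le (by positivity) fun m => ?_⟩
  · change y m 0 = a * (x m 0 + (a * u m 0 + b * u m 1))
      - b * (x m 1 + (-b * u m 0 + a * u m 1)) + c 0
    rw [hu0, hu1]
    linear_combination -(y m 0 - (a * x m 0 - b * x m 1) - c 0) * hab
  · change y m 1 = b * (x m 0 + (a * u m 0 + b * u m 1))
      + a * (x m 1 + (-b * u m 0 + a * u m 1)) + c 1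
    rw [hu0, hu1]
    linear_combination -(y m 1 - (b * x m 0 + a * x m 1) - c 1) * hab
  · rw [hu0, hc0]; ring
  · rw [hu1, hc1]; ring
  · rw [hu0, hc0]; linear_combination hrot0
  · rw [hu1, hc1]; linear_combination hrot1
  · have hm : ∀ s t : ℝ, |s| ≤ 1 → |t| ≤ Q / 2 * r → |s * t| ≤ Q / 2 * r :=
      fun s t hs ht => by
        rw [abs_mul]
        exact (mul_le_of_le_one_left (abs_nonneg _) hs).trans ht
    refine Fin.forall_fin_two.2 ⟨?_, ?_⟩
    · change |a * u m 0 + b * u m 1| ≤ _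
      linarith [abs_add_le (a * u m 0) (b * u m 1), hm _ _ ha1 (hu m).1, hm _ _ hb1 (hu m).2]
    · change |-b * u m 0 + a * u m 1| ≤ _
      linarith [abs_add_le (-b * u m 0) (a * u m 1),
        hm _ _ (by rwa [abs_neg] : |-b| ≤ 1) (hu m).1, hm _ _ ha1 (hu m).2]

/-- Under the standing assumption on the framework, the desired shapes are isolated among the
solutions of the edge constraints. -/
theorem Admissible.exists_shapeSet_isolated {G : FormationGraph N} {x : Fin N → Vec2} {M : Method}
    (h : G.Admissible x M) : ∃ r : ℝ, 0 < r ∧ ∀ z ∈ shapeSet x, ∀ y, G.f M y = G.f M x →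
      dist z y < r → y ∈ shapeSet x := by
  cases M with
  | distance =>
    obtain ⟨e, hne⟩ := G.exists_edge_ne_of_infinitesimallyRigid h
    obtain ⟨ε, hε, hpin⟩ := G.exists_pinned_unique h hne
    obtain ⟨Q, hQ, hmove⟩ := exists_move_add hne
    refine ⟨ε / Q, by positivity, fun z hz y hy hzy => ?_⟩
    obtain ⟨a, b, c, w, hab, rfl, hi, hj, hw⟩ := hmove z hz y (G.f_distance_eq_iff.1 hy e)
    rw [lt_div_iff₀ hQ, mul_comm] at hzy
    have := hpin w hi hj (by rw [← hy, G.f_distance_move hab]) (hw.trans_lt hzy)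
    rw [this, add_zero]
    exact mem_shapeSet_iff.2 ⟨a, b, c, hab, rfl⟩
  | displacement =>
    -- Here the radius plays no role: `y - x` is constant along edges, hence on the connected graph,
    -- so `y` is a translate of `x`.
    refine ⟨1, one_pos, fun z _ y hy _ => ?_⟩
    have hconn : G.toSimpleGraph.Connected := h
    obtain ⟨i₀⟩ := hconn.nonempty
    have hedge : ∀ k, y (G.tail k) - x (G.tail k) = y (G.head k) - x (G.head k) := by
      intro k
      have h1 : y (G.tail k) - y (G.head k) = x (G.tail k) - x (G.head k) := congrFun hy k
      rw [sub_eq_sub_iff_add_eq_add] at h1 ⊢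
      rw [h1]
      abel
    have hadj : ∀ i j, G.toSimpleGraph.Adj i j → y i - x i = y j - x j := by
      intro i j hij
      rw [toSimpleGraph, SimpleGraph.fromRel_adj] at hij
      rcases hij.2 with ⟨k, rfl, rfl⟩ | ⟨k, rfl, rfl⟩
      · exact hedge k
      · exact (hedge k).symm
    have hall : ∀ i, y i - x i = y i₀ - x i₀ := by
      intro i
      obtain ⟨p⟩ := hconn.preconnected i i₀
      induction p with
      | nil => rfl
      | cons hij _ ih => exact (hadj _ _ hij).trans ih
    exact ⟨1, one_mem _, y i₀ - x i₀, fun i => by rw [Matrix.one_mulVec, ← hall i]; abel⟩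

end FormationGraph

/-! ### Mechanics of a single manipulator -/

namespace Manipulator

variable (P : Manipulator)

theorem α₁_pos : 0 < P.α₁ := by
  have := P.m_pos 0; have := P.m_pos 1; have := P.L_pos 0; have := P.l_pos 0
  have := P.inertia_pos 0
  unfold α₁; positivity

theorem α₂_pos : 0 < P.α₂ := by
  have := P.m_pos 1; have := P.l_pos 1; have := P.inertia_pos 1
  unfold α₂; positivity

theorem α₃_pos : 0 < P.α₃ := by
  have := P.m_pos 1; have := P.l_pos 1; have := P.L_pos 0
  unfold α₃; positivity

/-- The factors on the right strictly exceed m L² and m l², whose product is α₃², because masses and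
inertias are positive. This makes the mass matrix positive definite uniformly in the angles. -/
theorem α₃_sq_lt : P.α₃ ^ 2 < P.α₁ * P.α₂ := by
  have h1 := P.m_pos 0; have h2 := P.m_pos 1; have h3 := P.L_pos 0; have h4 := P.l_pos 0
  have h5 := P.inertia_pos 0; have h6 := P.inertia_pos 1; have h7 := P.l_pos 1
  have h8 : P.m 1 * P.L 0 ^ 2 < P.α₁ := by unfold α₁; nlinarith [mul_pos h1 (pow_pos h4 2)]
  have h9 : P.m 1 * P.l 1 ^ 2 < P.α₂ := by unfold α₂; linarith
  have h10 := mul_lt_mul'' h8 h9 (by positivity) (by positivity)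
  refine lt_of_eq_of_lt ?_ h10
  unfold α₃; ring

/-- Determinant of the mass matrix. -/
def massDet (q : Vec2) : ℝ := P.α₁ * P.α₂ - P.α₃ ^ 2 * Real.cos (q 1) ^ 2

theorem massDet_pos (q : Vec2) : 0 < P.massDet q := by
  have h1 := P.α₃_sq_lt
  have h2 : P.α₃ ^ 2 * Real.cos (q 1) ^ 2 ≤ P.α₃ ^ 2 :=
    mul_le_of_le_one_right (sq_nonneg _) (Real.cos_sq_le_one _)
  unfold massDet; linarith

/-- Kinetic energy is coercive in the velocities, uniformly in the configuration. -/
theorem exists_kinetic_lower_bound : ∃ c : ℝ, 0 < c ∧ ∀ q v : Vec2, ∀ j,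
    c * v j ^ 2 ≤ v ⬝ᵥ (P.massMatrix q *ᵥ v) := by
  have h1 := P.α₁_pos
  have h2 := P.α₂_pos
  have h3 := P.α₃_sq_lt
  -- In the rates of the absolute link angles, v₀ and v₀ + v₁, the form has diagonal α₁, α₂ and
  -- off-diagonal α₃ cos q₁; determinant over trace, at cos² = 1, bounds its lower eigenvalue from
  -- below.
  let l := (P.α₁ * P.α₂ - P.α₃ ^ 2) / (P.α₁ + P.α₂)
  have hl : l * (P.α₁ + P.α₂) = P.α₁ * P.α₂ - P.α₃ ^ 2 := div_mul_cancel₀ _ (by positivity)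
  have hl0 : 0 < l := div_pos (by linarith) (by positivity)
  have hl1 : 0 < P.α₁ - l := by nlinarith [sq_nonneg P.α₃, mul_pos hl0 h2]
  -- The factor 1/2 pays for returning to joint velocities: v₁² ≤ 2 (v₀² + (v₀ + v₁)²).
  refine ⟨l / 2, by positivity, fun q v j => ?_⟩
  have hexp : v ⬝ᵥ (P.massMatrix q *ᵥ v) = P.α₁ * v 0 ^ 2 + P.α₂ * (v 0 + v 1) ^ 2
      + 2 * P.α₃ * Real.cos (q 1) * (v 0 * (v 0 + v 1)) := by
    simp [massMatrix, dotProduct, Fin.sum_univ_two]; ring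
  have hc := Real.cos_sq_le_one (q 1)
  have hquad : l * (v 0 ^ 2 + (v 0 + v 1) ^ 2) ≤ v ⬝ᵥ (P.massMatrix q *ᵥ v) := by
    rw [hexp]
    set x := v 0
    set y := v 0 + v 1
    set c := Real.cos (q 1)
    have h4 : 0 ≤ (P.α₁ - l) * ((P.α₁ - l) * x ^ 2 + (P.α₂ - l) * y ^ 2
        + 2 * P.α₃ * c * (x * y)) := by
      have h5 : (P.α₁ - l) * (P.α₂ - l) = P.α₃ ^ 2 + l ^ 2 := by linear_combination -hl
      have h6 : P.α₃ ^ 2 * c ^ 2 ≤ P.α₃ ^ 2 := mul_le_of_le_one_right (sq_nonneg _) hc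
      have h7 : (P.α₁ - l) * ((P.α₁ - l) * x ^ 2 + (P.α₂ - l) * y ^ 2 + 2 * P.α₃ * c * (x * y))
          = ((P.α₁ - l) * x + P.α₃ * c * y) ^ 2 + (P.α₃ ^ 2 - P.α₃ ^ 2 * c ^ 2 + l ^ 2) * y ^ 2 := by
        linear_combination y ^ 2 * h5
      rw [h7]
      have : 0 ≤ P.α₃ ^ 2 - P.α₃ ^ 2 * c ^ 2 + l ^ 2 := by nlinarith [sq_nonneg l]
      positivity
    have h8 := nonneg_of_mul_nonneg_right h4 hl1
    linarith
  refine le_trans ?_ hquad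
  revert j
  refine Fin.forall_fin_two.2 ⟨?_, ?_⟩
  · nlinarith [sq_nonneg (v 0), sq_nonneg (v 0 + v 1)]
  · nlinarith [sq_nonneg (2 * v 0 + v 1)]

theorem kinetic_nonneg (q v : Vec2) : 0 ≤ v ⬝ᵥ (P.massMatrix q *ᵥ v) := by
  obtain ⟨c, hc, h⟩ := P.exists_kinetic_lower_bound
  exact le_trans (by positivity) (h q v 0)

/-- Indicator of the active joints. -/
def active : Vec2 :=
  match P.kind with
  | .fa => ![1, 1]
  | .ap => ![1, 0]
  | .pa => ![0, 1]

/-- Spring stiffnesses that are not compensated by the controller. -/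
def spring : Vec2 :=
  match P.kind with
  | .fa => ![0, 0]
  | .ap => ![0, P.K 1]
  | .pa => ![P.K 0, 0]

theorem spring_nonneg (j : Fin 2) : 0 ≤ P.spring j := by
  have h0 := P.K_pos 0; have h1 := P.K_pos 1
  unfold spring
  cases P.kind <;> fin_cases j <;> simp [h0.le, h1.le]

theorem active_eq (j : Fin 2) :
    (P.active j = 1 ∧ P.spring j = 0) ∨ (P.active j = 0 ∧ 0 < P.spring j) := by
  have h0 := P.K_pos 0; have h1 := P.K_pos 1
  unfold spring active
  cases P.kind <;> fin_cases j <;> simp [h0, h1]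

theorem passiveStiffness_mul_sq (q : Vec2) :
    P.passiveStiffness * P.passiveAngle q ^ 2 = P.spring 0 * q 0 ^ 2 + P.spring 1 * q 1 ^ 2 := by
  unfold passiveStiffness passiveAngle spring
  cases P.kind <;> simp

/-- Torque of the force `w` at the virtual end-effector about the two arms, with reversed sign. -/
def armTorque (w q : Vec2) (j : Fin 2) : ℝ :=
  P.armLength j * (Real.cos (P.armAngle q j) * w 0 + Real.sin (P.armAngle q j) * w 1)

/-- Rates of change of the arm angles. -/
def armRate (v : Vec2) : Vec2 :=
  match P.kind with
  | .fa => ![v 0, v 0 + v 1]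
  | .ap => ![v 0, 0]
  | .pa => ![0, v 1]

/-- Joint torques generated by the virtual springs. -/
def virtualTorque (w q : Vec2) : Vec2 :=
  match P.kind with
  | .fa => ![P.armTorque w q 0 + P.armTorque w q 1, P.armTorque w q 1]
  | .ap => ![P.armTorque w q 0, 0]
  | .pa => ![0, P.armTorque w q 1]

/-- Applied torques minus spring torques, with the compensated terms removed. -/
def feedback (kD : ℝ) (w q v : Vec2) : Vec2 := fun j =>
  P.virtualTorque w q j - kD * P.active j * v j - P.spring j * q j

theorem torque_sub_stiffness (kD : ℝ) (w q v : Vec2) :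
    P.torque kD w q v - P.stiffness *ᵥ q = P.feedback kD w q v := by
  have hs : P.stiffness *ᵥ q = ![P.K 0 * q 0, P.K 1 * q 1] := by
    ext j; fin_cases j <;> simp [stiffness, Matrix.mulVec_diagonal]
  have hv : kD • v = ![kD * v 0, kD * v 1] := by ext j; fin_cases j <;> rfl
  rw [hs]
  ext j
  cases hk : P.kind <;> fin_cases j <;>
    simp [torque, feedback, virtualTorque, armTorque, armLength, armAngle, active, spring, hk, hs,
      hv, J, Jbar, dotProduct, Fin.sum_univ_two, Matrix.transpose] <;> ring

theorem virtualTorque_dotProduct (w q v : Vec2) :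
    P.virtualTorque w q ⬝ᵥ v =
      P.armTorque w q 0 * P.armRate v 0 + P.armTorque w q 1 * P.armRate v 1 := by
  cases hk : P.kind <;>
    simp [virtualTorque, armRate, hk, dotProduct, Fin.sum_univ_two]
  ring

theorem virtualTorque_eq_zero_iff {w q : Vec2} :
    P.virtualTorque w q = 0 ↔ P.Balanced q w := by
  have hB : P.Balanced q w ↔ P.armTorque w q 0 = 0 ∧ P.armTorque w q 1 = 0 := Fin.forall_fin_two
  rw [hB, funext_iff, Fin.forall_fin_two]
  cases hk : P.kind
  · simp only [virtualTorque, hk, Matrix.cons_val_zero, Matrix.cons_val_one, Pi.zero_apply]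
    constructor <;> rintro ⟨h1, h2⟩ <;> exact ⟨by linarith, h2⟩
  · have : P.armTorque w q 1 = 0 := by simp [armTorque, armLength, hk]
    simp [virtualTorque, hk, this]
  · have : P.armTorque w q 0 = 0 := by simp [armTorque, armLength, hk]
    simp [virtualTorque, hk, this]

theorem hasDerivAt_armAngle {q : ℝ → Vec2} {v : Vec2} {t : ℝ} (hq : HasDerivAt q v t) (j : Fin 2) :
    HasDerivAt (fun s => P.armAngle (q s) j) (P.armRate v j) t := by
  have h0 := hasDerivAt_pi.1 hq 0
  have h1 := hasDerivAt_pi.1 hq 1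
  revert j
  cases hk : P.kind <;> simp only [armAngle, armRate, hk] <;> refine Fin.forall_fin_two.2 ⟨?_, ?_⟩
  · exact h0.add_const _
  · exact (h0.add h1).add_const _
  · exact h0.add_const _
  · exact hasDerivAt_const _ _
  · exact hasDerivAt_const _ _
  · exact h1.add_const _

/-- Virtual work: the velocity of the virtual end-effector is described by its pairing with all
forces, which is the form that cancels against the virtual torques in the energy balance. -/
theorem hasDerivAt_xHat {q : ℝ → Vec2} {v : Vec2} {t : ℝ} (hq : HasDerivAt q v t) :
    ∃ x', HasDerivAt (fun s => P.xHat (q s)) x' t ∧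
      ∀ w, w ⬝ᵥ x' = -(P.virtualTorque w (q t) ⬝ᵥ v) := by
  have h0 := P.hasDerivAt_armAngle hq 0
  have h1 := P.hasDerivAt_armAngle hq 1
  refine ⟨![-(P.armLength 0 * (Real.cos (P.armAngle (q t) 0) * P.armRate v 0))
      - P.armLength 1 * (Real.cos (P.armAngle (q t) 1) * P.armRate v 1),
    P.armLength 0 * (-Real.sin (P.armAngle (q t) 0) * P.armRate v 0)
      + P.armLength 1 * (-Real.sin (P.armAngle (q t) 1) * P.armRate v 1)],
    hasDerivAt_pi.2 (Fin.forall_fin_two.2 ⟨?_, ?_⟩), fun w => ?_⟩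
  · simp only [xHat_zero]
    exact ((h0.sin.const_mul (P.armLength 0)).const_sub (P.armOffset 0)).sub
      (h1.sin.const_mul (P.armLength 1))
  · simp only [xHat_one]
    exact ((h0.cos.const_mul (P.armLength 0)).const_add (P.armOffset 1)).add
      (h1.cos.const_mul (P.armLength 1))
  · rw [virtualTorque_dotProduct]
    simp [dotProduct, Fin.sum_univ_two, armTorque]
    ring

/-- Joint accelerations of the closed loop. -/
def accel (kD : ℝ) (w q v : Vec2) : Vec2 :=
  let r := P.feedback kD w q v - P.coriolis q v *ᵥ v
  ![(P.α₂ * r 0 - (P.α₂ + P.α₃ * Real.cos (q 1)) * r 1) / P.massDet q,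
    ((P.α₁ + P.α₂ + 2 * P.α₃ * Real.cos (q 1)) * r 1
      - (P.α₂ + P.α₃ * Real.cos (q 1)) * r 0) / P.massDet q]

theorem massMatrix_mulVec_eq_iff {q a r : Vec2} : P.massMatrix q *ᵥ a = r ↔
    a = ![(P.α₂ * r 0 - (P.α₂ + P.α₃ * Real.cos (q 1)) * r 1) / P.massDet q,
      ((P.α₁ + P.α₂ + 2 * P.α₃ * Real.cos (q 1)) * r 1
        - (P.α₂ + P.α₃ * Real.cos (q 1)) * r 0) / P.massDet q] := by
  have hd := (P.massDet_pos q).ne'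
  have hdet : P.massDet q = P.α₁ * P.α₂ - P.α₃ ^ 2 * Real.cos (q 1) ^ 2 := rfl
  rw [funext_iff, funext_iff, Fin.forall_fin_two, Fin.forall_fin_two]
  simp only [massMatrix, Matrix.mulVec, dotProduct, Fin.sum_univ_two, Matrix.of_apply,
    Matrix.cons_val_zero, Matrix.cons_val_one, Matrix.cons_val', Matrix.cons_val_fin_one]
  rw [eq_div_iff hd, eq_div_iff hd]
  constructor
  · rintro ⟨h0, h1⟩
    rw [hdet, ← h0, ← h1]
    constructor <;> ring
  · rintro ⟨h0, h1⟩
    constructor <;> apply mul_right_cancel₀ hd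
    · linear_combination (P.α₁ + P.α₂ + 2 * P.α₃ * Real.cos (q 1)) * h0
        + (P.α₂ + P.α₃ * Real.cos (q 1)) * h1 - r 0 * hdet
    · linear_combination (P.α₂ + P.α₃ * Real.cos (q 1)) * h0 + P.α₂ * h1 - r 1 * hdet

theorem massMatrix_mulVec_accel (kD : ℝ) (w q v : Vec2) :
    P.massMatrix q *ᵥ P.accel kD w q v = P.feedback kD w q v - P.coriolis q v *ᵥ v :=
  P.massMatrix_mulVec_eq_iff.2 rfl

/-- The equations of motion determine the accelerations. -/
theorem equation_of_motion_iff {kD : ℝ} {w q v a : Vec2} :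
    P.massMatrix q *ᵥ a + P.coriolis q v *ᵥ v + P.stiffness *ᵥ q = P.torque kD w q v ↔
      a = P.accel kD w q v := by
  rw [← eq_sub_iff_add_eq, torque_sub_stiffness, ← eq_sub_iff_add_eq]
  exact P.massMatrix_mulVec_eq_iff

/-- Power balance: Coriolis forces do no work. -/
theorem hasDerivAt_kinetic {q v : ℝ → Vec2} {a : Vec2} {t : ℝ} (hq : HasDerivAt q (v t) t)
    (hv : HasDerivAt v a t) :
    HasDerivAt (fun s => v s ⬝ᵥ (P.massMatrix (q s) *ᵥ v s))
      (2 * (v t ⬝ᵥ (P.massMatrix (q t) *ᵥ a + P.coriolis (q t) (v t) *ᵥ v t))) t := by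
  have h1 := (hasDerivAt_pi.1 hq 1).cos.const_mul P.α₃
  have hv0 := hasDerivAt_pi.1 hv 0
  have hv1 := hasDerivAt_pi.1 hv 1
  have hexp : (fun s => v s ⬝ᵥ (P.massMatrix (q s) *ᵥ v s)) = fun s =>
      P.α₁ * v s 0 ^ 2 + P.α₂ * (v s 0 + v s 1) ^ 2
      + 2 * (P.α₃ * Real.cos (q s 1)) * (v s 0 * (v s 0 + v s 1)) := by
    ext s
    simp [massMatrix, dotProduct, Fin.sum_univ_two]; ring
  rw [hexp]
  refine (((hv0.pow 2).const_mul P.α₁).add (((hv0.add hv1).pow 2).const_mul P.α₂)).add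
    ((h1.const_mul 2).mul (hv0.mul (hv0.add hv1))) |>.congr_deriv ?_
  simp [massMatrix, coriolis, dotProduct, Fin.sum_univ_two]
  ring

/-! ### Invariance under full turns of the active joints -/

/-- Full turns of the active joints. -/
def turn (n : Fin 2 → ℤ) : Vec2 := fun j => P.active j * (n j * (2 * Real.pi))

theorem exists_turn_eq (n : Fin 2 → ℤ) (j : Fin 2) :
    ∃ k : ℤ, P.turn n j = k * (2 * Real.pi) := by
  rcases P.active_eq j with ⟨h, -⟩ | ⟨h, -⟩
  · exact ⟨n j, by simp [turn, h]⟩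
  · exact ⟨0, by simp [turn, h]⟩

theorem cos_add_turn (q : Vec2) (n : Fin 2 → ℤ) (j : Fin 2) :
    Real.cos ((q + P.turn n) j) = Real.cos (q j) := by
  obtain ⟨k, hk⟩ := P.exists_turn_eq n j
  rw [Pi.add_apply, hk, Real.cos_add_int_mul_two_pi]

theorem sin_add_turn (q : Vec2) (n : Fin 2 → ℤ) (j : Fin 2) :
    Real.sin ((q + P.turn n) j) = Real.sin (q j) := by
  obtain ⟨k, hk⟩ := P.exists_turn_eq n j
  rw [Pi.add_apply, hk, Real.sin_add_int_mul_two_pi]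

/-- Only the uncompensated springs could break 2π-periodicity, and they sit at the passive joints,
which `turn` leaves fixed. -/
theorem spring_mul_add_turn (q : Vec2) (n : Fin 2 → ℤ) (j : Fin 2) :
    P.spring j * (q + P.turn n) j = P.spring j * q j := by
  rcases P.active_eq j with ⟨-, h⟩ | ⟨h, -⟩ <;> simp [turn, h]

theorem exists_armAngle_add_turn (q : Vec2) (n : Fin 2 → ℤ) (j : Fin 2) :
    ∃ k : ℤ, P.armAngle (q + P.turn n) j = P.armAngle q j + k * (2 * Real.pi) := by
  obtain ⟨k, hk⟩ := P.exists_turn_eq n 0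
  obtain ⟨l, hl⟩ := P.exists_turn_eq n 1
  revert j
  cases hP : P.kind <;> simp only [armAngle, hP, Pi.add_apply, hk, hl] <;>
    refine Fin.forall_fin_two.2 ⟨?_, ?_⟩
  · exact ⟨k, by simp; ring⟩
  · exact ⟨k + l, by simp; ring⟩
  · exact ⟨k, by simp; ring⟩
  · exact ⟨0, by simp⟩
  · exact ⟨0, by simp⟩
  · exact ⟨l, by simp; ring⟩

theorem cos_armAngle_add_turn (q : Vec2) (n : Fin 2 → ℤ) (j : Fin 2) :
    Real.cos (P.armAngle (q + P.turn n) j) = Real.cos (P.armAngle q j) := by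
  obtain ⟨k, hk⟩ := P.exists_armAngle_add_turn q n j
  rw [hk, Real.cos_add_int_mul_two_pi]

theorem sin_armAngle_add_turn (q : Vec2) (n : Fin 2 → ℤ) (j : Fin 2) :
    Real.sin (P.armAngle (q + P.turn n) j) = Real.sin (P.armAngle q j) := by
  obtain ⟨k, hk⟩ := P.exists_armAngle_add_turn q n j
  rw [hk, Real.sin_add_int_mul_two_pi]

theorem xHat_add_turn (q : Vec2) (n : Fin 2 → ℤ) : P.xHat (q + P.turn n) = P.xHat q := by
  refine funext (Fin.forall_fin_two.2 ⟨?_, ?_⟩)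
  · simp only [xHat_zero, sin_armAngle_add_turn]
  · simp only [xHat_one, cos_armAngle_add_turn]

theorem massMatrix_add_turn (q : Vec2) (n : Fin 2 → ℤ) :
    P.massMatrix (q + P.turn n) = P.massMatrix q := by
  simp only [massMatrix, cos_add_turn]

theorem passive_energy_add_turn (q : Vec2) (n : Fin 2 → ℤ) :
    P.passiveStiffness * P.passiveAngle (q + P.turn n) ^ 2 =
      P.passiveStiffness * P.passiveAngle q ^ 2 := by
  rw [passiveStiffness_mul_sq, passiveStiffness_mul_sq]
  congr 1
  · rw [pow_two, ← mul_assoc, spring_mul_add_turn]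
    linear_combination q 0 * P.spring_mul_add_turn q n 0
  · rw [pow_two, ← mul_assoc, spring_mul_add_turn]
    linear_combination q 1 * P.spring_mul_add_turn q n 1

theorem accel_add_turn (kD : ℝ) (w q v : Vec2) (n : Fin 2 → ℤ) :
    P.accel kD w (q + P.turn n) v = P.accel kD w q v := by
  have harm : P.armTorque w (q + P.turn n) = P.armTorque w q := by
    ext j
    simp only [armTorque, cos_armAngle_add_turn, sin_armAngle_add_turn]
  have hfb : P.feedback kD w (q + P.turn n) v = P.feedback kD w q v := by
    ext j
    simp only [feedback, virtualTorque, harm, spring_mul_add_turn]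
  simp only [accel, hfb, coriolis, massDet, cos_add_turn, sin_add_turn]

/-- Up to full turns of the active joints, a configuration is determined by the passive angles and
a bounded set of active angles. -/
theorem exists_abs_add_turn_le (q : Vec2) : ∃ n : Fin 2 → ℤ, ∀ j,
    (P.spring j = 0 → |(q + P.turn n) j| ≤ 2 * Real.pi) ∧
    (P.spring j ≠ 0 → (q + P.turn n) j = q j) := by
  refine ⟨fun j => -⌊q j / (2 * Real.pi)⌋, fun j => ?_⟩
  rcases P.active_eq j with ⟨h, hs⟩ | ⟨h, hs⟩
  · refine ⟨fun _ => ?_, fun h' => absurd hs h'⟩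
    have hpi : 0 < 2 * Real.pi := Real.two_pi_pos
    have h1 := (le_div_iff₀ hpi).1 (Int.floor_le (q j / (2 * Real.pi)))
    have h2 := (div_lt_iff₀ hpi).1 (Int.lt_floor_add_one (q j / (2 * Real.pi)))
    simp only [turn, h, Pi.add_apply]
    push_cast
    rw [abs_le]
    constructor <;> nlinarith
  · exact ⟨fun h' => absurd h' hs.ne', fun _ => by simp [turn, h]⟩

/-! ### Smoothness of the closed loop -/

theorem contDiff_armAngle (j : Fin 2) : ContDiff ℝ 1 fun q : Vec2 => P.armAngle q j := by
  revert j
  cases hk : P.kind <;> simp only [armAngle, hk] <;>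
    refine Fin.forall_fin_two.2 ⟨?_, ?_⟩ <;> simp <;> fun_prop

theorem contDiff_xHat : ContDiff ℝ 1 P.xHat := by
  have h := P.contDiff_armAngle
  refine contDiff_pi.2 (Fin.forall_fin_two.2 ⟨?_, ?_⟩)
  · simp only [xHat_zero]
    exact ((contDiff_const.sub (contDiff_const.mul (h 0).sin))).sub (contDiff_const.mul (h 1).sin)
  · simp only [xHat_one]
    exact ((contDiff_const.add (contDiff_const.mul (h 0).cos))).add (contDiff_const.mul (h 1).cos)

theorem contDiff_accel {E : Type*} [NormedAddCommGroup E] [NormedSpace ℝ E] (kD : ℝ)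
    {w q v : E → Vec2} (hw : ContDiff ℝ 1 w) (hq : ContDiff ℝ 1 q) (hv : ContDiff ℝ 1 v) :
    ContDiff ℝ 1 fun x => P.accel kD (w x) (q x) (v x) := by
  have hw' := contDiff_pi.1 hw
  have hq' := contDiff_pi.1 hq
  have hv' := contDiff_pi.1 hv
  have harm : ∀ j, ContDiff ℝ 1 fun x => P.armTorque (w x) (q x) j := by
    intro j
    have h := (P.contDiff_armAngle j).comp hq
    exact contDiff_const.mul ((h.cos.mul (hw' 0)).add (h.sin.mul (hw' 1)))
  have hvt : ∀ j, ContDiff ℝ 1 fun x => P.virtualTorque (w x) (q x) j := by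
    intro j
    revert j
    cases hk : P.kind <;> simp only [virtualTorque, hk] <;> refine Fin.forall_fin_two.2 ⟨?_, ?_⟩
    · exact (harm 0).add (harm 1)
    · exact harm 1
    · exact harm 0
    · exact contDiff_const
    · exact contDiff_const
    · exact harm 1
  have hfb : ∀ j, ContDiff ℝ 1 fun x => P.feedback kD (w x) (q x) (v x) j := fun j =>
    ((hvt j).sub (contDiff_const.mul (hv' j))).sub (contDiff_const.mul (hq' j))
  have hr : ∀ j, ContDiff ℝ 1 fun x =>
      (P.feedback kD (w x) (q x) (v x) - P.coriolis (q x) (v x) *ᵥ v x) j := by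
    refine fun j => (hfb j).sub ?_
    have := (hq' 1).sin
    revert j
    simp only [coriolis, Matrix.mulVec, dotProduct, Fin.sum_univ_two]
    have h0 := hv' 0
    have h1 := hv' 1
    refine Fin.forall_fin_two.2 ⟨?_, ?_⟩ <;> simp <;> fun_prop
  have hc := (hq' 1).cos
  have hd : ContDiff ℝ 1 fun x => P.massDet (q x) := by unfold massDet; fun_prop
  have h0 := hr 0
  have h1 := hr 1
  refine contDiff_pi.2 (Fin.forall_fin_two.2 ⟨?_, ?_⟩)
  · exact ((contDiff_const.mul h0).sub
      ((contDiff_const.add (contDiff_const.mul hc)).mul h1)).div hd fun x => (P.massDet_pos _).ne'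
  · exact (((contDiff_const.add (contDiff_const.mul hc)).mul h1).sub
      ((contDiff_const.add (contDiff_const.mul hc)).mul h0)).div hd fun x => (P.massDet_pos _).ne'

end Manipulator

namespace Method

theorem contDiff_edgeFun (M : Method) (a : Fin M.p) :
    ContDiff ℝ 1 fun z : Vec2 => M.edgeFun z a := by
  cases M
  · simp only [edgeFun]; fun_prop
  · simp only [edgeFun]; fun_prop

theorem contDiff_D (M : Method) (b : Fin 2) (a : Fin M.p) :
    ContDiff ℝ 1 fun z : Vec2 => M.D z b a := by
  cases M
  · simp only [D]; fun_prop
  · exact contDiff_const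

end Method

namespace Setup

variable {N : ℕ} (S : Setup N)

theorem contDiff_err (k : Fin S.G.numEdges) (a : Fin S.method.p) :
    ContDiff ℝ 1 fun x => S.err x k a := by
  have h : ContDiff ℝ 1 fun x : Fin N → Vec2 => x (S.G.tail k) - x (S.G.head k) := by fun_prop
  exact ((S.method.contDiff_edgeFun a).comp h).sub contDiff_const

theorem contDiff_V : ContDiff ℝ 1 S.V :=
  contDiff_const.mul (ContDiff.sum fun k _ => ContDiff.sum fun a _ =>
    contDiff_const.mul ((S.contDiff_err k a).pow 2))

theorem contDiff_eHat (i : Fin N) : ContDiff ℝ 1 fun x => S.eHat x i := by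
  refine contDiff_pi.2 fun b => ?_
  simp only [eHat, Finset.sum_apply, Pi.smul_apply, Matrix.mulVec, dotProduct]
  refine ContDiff.sum fun k _ => contDiff_const.mul (ContDiff.sum fun a _ => ?_)
  have h : ContDiff ℝ 1 fun x : Fin N → Vec2 => x (S.G.tail k) - x (S.G.head k) := by fun_prop
  exact ((S.method.contDiff_D b a).comp h).mul (contDiff_const.mul (S.contDiff_err k a))

theorem contDiff_xHat : ContDiff ℝ 1 S.xHat :=
  contDiff_pi.2 fun i => (S.manip i).contDiff_xHat.comp (contDiff_apply ℝ Vec2 i)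

theorem V_nonneg (x : Fin N → Vec2) : 0 ≤ S.V x :=
  mul_nonneg (by norm_num) (Finset.sum_nonneg fun k _ => Finset.sum_nonneg fun a _ =>
    mul_nonneg (S.kS_pos k a).le (sq_nonneg _))

theorem V_eq_zero_iff {x : Fin N → Vec2} :
    S.V x = 0 ↔ S.G.f S.method x = S.G.f S.method S.xstar := by
  have h0 : ∀ k a, 0 ≤ S.kS k a * S.err x k a ^ 2 := fun k a =>
    mul_nonneg (S.kS_pos k a).le (sq_nonneg _)
  rw [← sub_eq_zero (a := S.G.f S.method x)]
  constructor
  · intro h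
    have h1 : ∑ k, ∑ a, S.kS k a * S.err x k a ^ 2 = 0 := by simpa [V] using h
    ext k a
    have h2 := (Finset.sum_eq_zero_iff_of_nonneg fun k _ =>
      Finset.sum_nonneg fun a _ => h0 k a).1 h1 k (Finset.mem_univ _)
    have h3 := (Finset.sum_eq_zero_iff_of_nonneg fun a _ => h0 k a).1 h2 a (Finset.mem_univ _)
    exact pow_eq_zero_iff two_ne_zero |>.1 ((mul_eq_zero.1 h3).resolve_left (S.kS_pos k a).ne')
  · intro h
    have : S.err x = 0 := h
    simp [V, this]

/-! ### Energy balance and global solutions -/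

/-- Closed-loop vector field on the states `(q, v)`. -/
def field (x : (Fin N → Vec2) × (Fin N → Vec2)) : (Fin N → Vec2) × (Fin N → Vec2) :=
  (x.2, fun i => (S.manip i).accel S.kD (S.eHat (S.xHat x.1) i) (x.1 i) (x.2 i))

theorem contDiff_field : ContDiff ℝ 1 S.field := by
  refine contDiff_snd.prodMk (contDiff_pi.2 fun i => ?_)
  exact (S.manip i).contDiff_accel S.kD
    ((S.contDiff_eHat i).comp (S.contDiff_xHat.comp contDiff_fst))
    ((contDiff_apply ℝ Vec2 i).comp contDiff_fst) ((contDiff_apply ℝ Vec2 i).comp contDiff_snd)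

theorem isSolution_iff {q v : ℝ → Fin N → Vec2} :
    S.IsSolution q v ↔ IsTrajectory S.field fun t => (q t, v t) := by
  refine forall₂_congr fun t _ => ?_
  simp only [control, Manipulator.equation_of_motion_iff]
  constructor
  · rintro ⟨hq, a, hv, ha⟩
    obtain rfl : a = (S.field (q t, v t)).2 := funext ha
    exact hq.prodMk hv
  · intro h
    exact ⟨h.fst, _, h.snd, fun i => rfl⟩

/-- Total energy as a function of the state. -/
def totalEnergy (x : (Fin N → Vec2) × (Fin N → Vec2)) : ℝ := S.energy x.1 x.2

/-- Rate at which the controller dissipates energy. -/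
def dissipation (v : Fin N → Vec2) : ℝ :=
  S.kD * ∑ i, ∑ j, (S.manip i).active j * v i j ^ 2

theorem differentiable_totalEnergy : Differentiable ℝ S.totalEnergy := by
  have hq : ∀ i j, ContDiff ℝ 1 fun x : (Fin N → Vec2) × (Fin N → Vec2) => x.1 i j := by
    intro i j; fun_prop
  have hv : ∀ i j, ContDiff ℝ 1 fun x : (Fin N → Vec2) × (Fin N → Vec2) => x.2 i j := by
    intro i j; fun_prop
  have : ContDiff ℝ 1 S.totalEnergy := by
    unfold totalEnergy energy
    simp only [Manipulator.passiveStiffness_mul_sq]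
    refine ((S.contDiff_V.comp (S.contDiff_xHat.comp contDiff_fst)).add
      (contDiff_const.mul (ContDiff.sum fun i _ => ?_))).add
      (contDiff_const.mul (ContDiff.sum fun i _ => ?_))
    · have hc := (hq i 1).cos
      have h0 := hv i 0
      have h1 := hv i 1
      simp only [Manipulator.massMatrix, Matrix.mulVec, dotProduct, Fin.sum_univ_two]
      simp
      fun_prop
    · have h0 := hq i 0
      have h1 := hq i 1
      fun_prop
  exact this.differentiable one_ne_zero

/-- The power of the virtual springs cancels that of the virtual torques, the passive springs
exchange energy with their potential, and Coriolis forces do no work; only the damping of the active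
joints remains. -/
theorem hasDerivAt_energy {q v : ℝ → Fin N → Vec2} {t : ℝ}
    (h : HasDerivAt (fun s => (q s, v s)) (S.field (q t, v t)) t) :
    HasDerivAt (fun s => S.energy (q s) (v s)) (-S.dissipation (v t)) t := by
  have hq : HasDerivAt q (v t) t := h.fst
  have hv : HasDerivAt v (S.field (q t, v t)).2 t := h.snd
  have hqi := hasDerivAt_pi.1 hq
  have hvi := hasDerivAt_pi.1 hv
  choose x' hx' hpow using fun i => (S.manip i).hasDerivAt_xHat (hqi i)
  have hV := S.hasDerivAt_V (x := fun s => S.xHat (q s)) (hasDerivAt_pi.2 hx')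
  have hkin := (HasDerivAt.fun_sum (u := Finset.univ) fun i _ =>
    (S.manip i).hasDerivAt_kinetic (hqi i) (hvi i)).const_mul (1 / 2 : ℝ)
  have hpas := (HasDerivAt.fun_sum (u := Finset.univ) fun i _ =>
    (((hasDerivAt_pi.1 (hqi i) 0).pow 2).const_mul ((S.manip i).spring 0)).add
      (((hasDerivAt_pi.1 (hqi i) 1).pow 2).const_mul ((S.manip i).spring 1))).const_mul (1 / 2 : ℝ)
  simp only [energy, Manipulator.passiveStiffness_mul_sq]
  refine ((hV.add hkin).add hpas).congr_deriv ?_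
  simp only [dissipation, Finset.mul_sum, ← Finset.sum_add_distrib, ← Finset.sum_neg_distrib]
  refine Finset.sum_congr rfl fun i _ => ?_
  rw [hpow i]
  simp only [field, Manipulator.massMatrix_mulVec_accel, sub_add_cancel]
  simp only [dotProduct, Fin.sum_univ_two, Manipulator.feedback]
  push_cast
  ring

/-- The energy balance uses the state and its derivative at a single time, so it applies to the
straight line through `x` tangent to the field, without solving the equation. -/
theorem fderiv_totalEnergy_field (x : (Fin N → Vec2) × (Fin N → Vec2)) :
    fderiv ℝ S.totalEnergy x (S.field x) = -S.dissipation x.2 := by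
  let y : ℝ → (Fin N → Vec2) × (Fin N → Vec2) := fun s => x + s • S.field x
  have hy0 : y 0 = x := by simp [y]
  have hy : HasDerivAt y (S.field (y 0)) 0 := by
    rw [hy0]
    simpa [y] using ((hasDerivAt_id (0 : ℝ)).smul_const (S.field x)).const_add x
  have h1 := S.hasDerivAt_energy (q := fun s => (y s).1) (v := fun s => (y s).2) (t := 0) hy
  have h2 : HasDerivAt (S.totalEnergy ∘ y) (fderiv ℝ S.totalEnergy (y 0) (S.field (y 0))) 0 :=
    (S.differentiable_totalEnergy _).hasFDerivAt.comp_hasDerivAt 0 hy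
  rw [hy0] at h2
  rw [h2.unique h1, hy0]

theorem active_mul_sq_nonneg (v : Fin N → Vec2) (i : Fin N) (j : Fin 2) :
    0 ≤ (S.manip i).active j * v i j ^ 2 := by
  rcases (S.manip i).active_eq j with ⟨h, -⟩ | ⟨h, -⟩ <;> rw [h] <;> positivity

theorem dissipation_nonneg (v : Fin N → Vec2) : 0 ≤ S.dissipation v :=
  mul_nonneg S.kD_pos.le (Finset.sum_nonneg fun i _ => Finset.sum_nonneg fun j _ =>
    S.active_mul_sq_nonneg v i j)

theorem active_mul_eq_zero_of_dissipation_eq_zero {v : Fin N → Vec2} (h : S.dissipation v = 0)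
    (i : Fin N) (j : Fin 2) : (S.manip i).active j * v i j = 0 := by
  have h0 := S.active_mul_sq_nonneg v
  have h1 := (mul_eq_zero.1 h).resolve_left S.kD_pos.ne'
  have h2 := (Finset.sum_eq_zero_iff_of_nonneg fun i _ =>
      Finset.sum_nonneg fun j _ => h0 i j).1 h1 i (Finset.mem_univ _)
  have h3 := (Finset.sum_eq_zero_iff_of_nonneg fun j _ => h0 i j).1 h2 j (Finset.mem_univ _)
  rcases mul_eq_zero.1 h3 with h4 | h4
  · rw [h4, zero_mul]
  · rw [pow_eq_zero_iff two_ne_zero] at h4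
    rw [h4, mul_zero]

theorem fderiv_totalEnergy_field_nonpos (x : (Fin N → Vec2) × (Fin N → Vec2)) :
    fderiv ℝ S.totalEnergy x (S.field x) ≤ 0 := by
  rw [fderiv_totalEnergy_field]
  exact neg_nonpos.2 (S.dissipation_nonneg _)

theorem V_le_energy (q v : Fin N → Vec2) : S.V (S.xHat q) ≤ S.energy q v := by
  have h1 : 0 ≤ ∑ i, v i ⬝ᵥ ((S.manip i).massMatrix (q i) *ᵥ v i) :=
    Finset.sum_nonneg fun i _ => (S.manip i).kinetic_nonneg _ _
  have h2 : 0 ≤ ∑ i, (S.manip i).passiveStiffness * (S.manip i).passiveAngle (q i) ^ 2 :=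
    Finset.sum_nonneg fun i _ => by
      rw [Manipulator.passiveStiffness_mul_sq]
      have := (S.manip i).spring_nonneg
      exact add_nonneg (mul_nonneg (this 0) (sq_nonneg _)) (mul_nonneg (this 1) (sq_nonneg _))
  unfold energy
  linarith

theorem kinetic_le_energy (q v : Fin N → Vec2) (i : Fin N) :
    v i ⬝ᵥ ((S.manip i).massMatrix (q i) *ᵥ v i) ≤ 2 * S.energy q v := by
  have h0 := S.V_nonneg (S.xHat q)
  have h1 := Finset.single_le_sum (f := fun i => v i ⬝ᵥ ((S.manip i).massMatrix (q i) *ᵥ v i))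
    (fun i _ => (S.manip i).kinetic_nonneg _ _) (Finset.mem_univ i)
  have h2 : 0 ≤ ∑ i, (S.manip i).passiveStiffness * (S.manip i).passiveAngle (q i) ^ 2 :=
    Finset.sum_nonneg fun i _ => by
      rw [Manipulator.passiveStiffness_mul_sq]
      have := (S.manip i).spring_nonneg
      exact add_nonneg (mul_nonneg (this 0) (sq_nonneg _)) (mul_nonneg (this 1) (sq_nonneg _))
  unfold energy
  linarith

theorem spring_le_energy (q v : Fin N → Vec2) (i : Fin N) (j : Fin 2) :
    (S.manip i).spring j * q i j ^ 2 ≤ 2 * S.energy q v := by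
  have h0 := S.V_nonneg (S.xHat q)
  have h1 : 0 ≤ ∑ i, v i ⬝ᵥ ((S.manip i).massMatrix (q i) *ᵥ v i) :=
    Finset.sum_nonneg fun i _ => (S.manip i).kinetic_nonneg _ _
  have hs := fun i j => mul_nonneg ((S.manip i).spring_nonneg j) (sq_nonneg (q i j))
  have h2 := Finset.single_le_sum
    (f := fun i => (S.manip i).passiveStiffness * (S.manip i).passiveAngle (q i) ^ 2)
    (fun i _ => by
      rw [Manipulator.passiveStiffness_mul_sq]
      exact add_nonneg (hs i 0) (hs i 1)) (Finset.mem_univ i)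
  have h3 : (S.manip i).spring j * q i j ^ 2 ≤
      (S.manip i).passiveStiffness * (S.manip i).passiveAngle (q i) ^ 2 := by
    rw [Manipulator.passiveStiffness_mul_sq]
    revert j
    exact Fin.forall_fin_two.2 ⟨le_add_of_nonneg_right (hs i 1), le_add_of_nonneg_left (hs i 0)⟩
  unfold energy
  linarith

theorem energy_nonneg (q v : Fin N → Vec2) : 0 ≤ S.energy q v :=
  (S.V_nonneg _).trans (S.V_le_energy q v)

/-- Velocities and passive angles are controlled by the energy. -/
theorem exists_energy_bound : ∃ c : ℝ, 0 < c ∧ ∀ q v : Fin N → Vec2, ∀ i j,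
    v i j ^ 2 ≤ c * S.energy q v ∧
    ((S.manip i).spring j ≠ 0 → q i j ^ 2 ≤ c * S.energy q v) := by
  choose c hc hkin using fun i => (S.manip i).exists_kinetic_lower_bound
  have hs0 := fun i j => (S.manip i).spring_nonneg j
  -- At active joints the spring constant is 0 and the quotient is 0 by convention, so these terms
  -- are harmless.
  let C : Fin N → ℝ := fun i => 2 / c i + ∑ j, 2 / (S.manip i).spring j
  have hC : ∀ i, 0 ≤ C i := fun i => by
    have := hc i
    have h2 := Finset.sum_nonneg fun j (_ : j ∈ Finset.univ) =>
      div_nonneg zero_le_two (hs0 i j)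
    positivity
  refine ⟨∑ i, C i + 1, by linarith [Finset.sum_nonneg fun i (_ : i ∈ Finset.univ) => hC i],
    fun q v i j => ?_⟩
  have hE := S.energy_nonneg q v
  have hle : C i * S.energy q v ≤ (∑ i, C i + 1) * S.energy q v := by
    have := Finset.single_le_sum (fun i _ => hC i) (Finset.mem_univ i)
    gcongr
    linarith
  have hC1 : 2 / c i ≤ C i :=
    le_add_of_nonneg_right (Finset.sum_nonneg fun j _ => div_nonneg zero_le_two (hs0 i j))
  have hC2 : 2 / (S.manip i).spring j ≤ C i :=
    (Finset.single_le_sum (f := fun j => 2 / (S.manip i).spring j)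
      (fun j _ => div_nonneg zero_le_two (hs0 i j)) (Finset.mem_univ j)).trans
      (le_add_of_nonneg_left (div_nonneg zero_le_two (hc i).le))
  refine ⟨le_trans ?_ hle, fun hs => le_trans ?_ hle⟩
  · have h1 := (hkin i (q i) (v i) j).trans (S.kinetic_le_energy q v i)
    refine le_trans ?_ (mul_le_mul_of_nonneg_right hC1 hE)
    rw [div_mul_eq_mul_div, le_div_iff₀ (hc i)]
    linarith
  · have hs' : 0 < (S.manip i).spring j := lt_of_le_of_ne (hs0 i j) hs.symm
    have h1 := S.spring_le_energy q v i j
    refine le_trans ?_ (mul_le_mul_of_nonneg_right hC2 hE)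
    rw [div_mul_eq_mul_div, le_div_iff₀ hs']
    linarith

/-- Full turns of the active joints of all manipulators. -/
def turn (n : Fin N → Fin 2 → ℤ) : (Fin N → Vec2) × (Fin N → Vec2) :=
  (fun i => (S.manip i).turn (n i), 0)

theorem xHat_add_turn (q : Fin N → Vec2) (n : Fin N → Fin 2 → ℤ) :
    S.xHat (q + (S.turn n).1) = S.xHat q :=
  funext fun i => (S.manip i).xHat_add_turn (q i) (n i)

theorem field_add_turn (x : (Fin N → Vec2) × (Fin N → Vec2)) (n : Fin N → Fin 2 → ℤ) :
    S.field (x + S.turn n) = S.field x := by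
  have h2 : (x + S.turn n).2 = x.2 := add_zero _
  simp only [field, h2, Prod.fst_add, xHat_add_turn]
  exact congrArg _ (funext fun i => (S.manip i).accel_add_turn _ _ _ _ _)

theorem totalEnergy_add_turn (x : (Fin N → Vec2) × (Fin N → Vec2)) (n : Fin N → Fin 2 → ℤ) :
    S.totalEnergy (x + S.turn n) = S.totalEnergy x := by
  have h2 : (x + S.turn n).2 = x.2 := add_zero _
  have h1 : ∀ i, (x + S.turn n).1 i = x.1 i + (S.manip i).turn (n i) := fun _ => rfl
  simp only [totalEnergy, energy, h2, h1, Manipulator.massMatrix_add_turn,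
    Manipulator.passive_energy_add_turn]
  rw [Prod.fst_add, xHat_add_turn]

/-- The energy bounds velocities and passive angles; the active angles are reduced modulo 2π. Modulo
turns, sublevel sets are thus bounded, which supplies the compactness for the limiting argument. -/
theorem exists_norm_add_turn_le (γ : ℝ) : ∃ R : ℝ, ∀ x, S.totalEnergy x ≤ γ →
    ∃ n, ‖x + S.turn n‖ ≤ R := by
  obtain ⟨c, hc, hbd⟩ := S.exists_energy_bound
  refine ⟨2 * Real.pi + Real.sqrt (c * γ), fun x hx => ?_⟩
  choose n hn using fun i => (S.manip i).exists_abs_add_turn_le (x.1 i)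
  have hpi := Real.pi_pos
  have hR : 0 ≤ 2 * Real.pi + Real.sqrt (c * γ) := by positivity
  have hle : c * S.energy x.1 x.2 ≤ c * γ := mul_le_mul_of_nonneg_left hx hc.le
  refine ⟨n, norm_prod_le_iff.2 ⟨?_, ?_⟩⟩
  · refine FormationGraph.norm_le_of_abs_apply_le hR fun i j => ?_
    change |(x.1 i + (S.manip i).turn (n i)) j| ≤ _
    by_cases hs : (S.manip i).spring j = 0
    · exact ((hn i j).1 hs).trans (le_add_of_nonneg_right (Real.sqrt_nonneg _))
    · rw [(hn i j).2 hs]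
      refine le_trans ?_ (le_add_of_nonneg_left (by positivity))
      exact Real.abs_le_sqrt (((hbd x.1 x.2 i j).2 hs).trans hle)
  · refine FormationGraph.norm_le_of_abs_apply_le hR fun i j => ?_
    change |(x.2 + 0) i j| ≤ _
    rw [add_zero]
    refine le_trans ?_ (le_add_of_nonneg_left (by positivity))
    exact Real.abs_le_sqrt ((hbd x.1 x.2 i j).1.trans hle)

theorem exists_norm_field_le (γ : ℝ) : ∃ C : ℝ, ∀ x, S.totalEnergy x ≤ γ → ‖S.field x‖ ≤ C := by
  obtain ⟨R, hR⟩ := S.exists_norm_add_turn_le γ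
  obtain ⟨C, hC⟩ := (isCompact_closedBall (0 : (Fin N → Vec2) × (Fin N → Vec2)) R).exists_bound_of_continuousOn
    S.contDiff_field.continuous.continuousOn
  refine ⟨C, fun x hx => ?_⟩
  obtain ⟨n, hn⟩ := hR x hx
  rw [← S.field_add_turn x n]
  exact hC _ (mem_closedBall_zero_iff.2 hn)

/-- The level γ is taken to be the initial energy itself, so no smallness is needed. -/
theorem exists_isSolution (q₀ v₀ : Fin N → Vec2) :
    ∃ q v : ℝ → Fin N → Vec2, S.IsSolution q v ∧ q 0 = q₀ ∧ v 0 = v₀ := by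
  obtain ⟨C, hC⟩ := S.exists_norm_field_le (S.energy q₀ v₀)
  obtain ⟨x, hx, hx0⟩ := exists_isTrajectory_of_lyapunov S.contDiff_field
    S.differentiable_totalEnergy S.fderiv_totalEnergy_field_nonpos hC (x₀ := (q₀, v₀)) le_rfl
  exact ⟨fun t => (x t).1, fun t => (x t).2, S.isSolution_iff.2 hx, by simp [hx0], by simp [hx0]⟩

end Setup

/-! ### Functions on a half-line: constant derivatives and countable ranges -/

section HalfLine

open Set

variable {f : ℝ → ℝ}

theorem eq_of_hasDerivWithinAt_Ici_zero (h : ∀ t, 0 ≤ t → HasDerivWithinAt f 0 (Ici 0) t) {t : ℝ}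
    (ht : 0 ≤ t) : f t = f 0 := by
  have := Convex.norm_image_sub_le_of_norm_hasDerivWithin_le (C := 0)
    (fun s (hs : s ∈ Ici (0 : ℝ)) => h s hs) (fun s _ => by simp) (convex_Ici 0) self_mem_Ici ht
  rw [zero_mul, norm_le_zero_iff] at this
  exact sub_eq_zero.1 this

theorem eq_zero_of_hasDerivWithinAt_Ici_of_forall_eq {c f' : ℝ} (hc : ∀ t, 0 ≤ t → f t = c) {t : ℝ}
    (ht : 0 ≤ t) (h : HasDerivWithinAt f f' (Ici 0) t) : f' = 0 :=
  (uniqueDiffOn_Ici (0 : ℝ) t ht).eq_deriv _ h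
    ((hasDerivWithinAt_const t (Ici 0) c).congr (fun s hs => hc s hs) (hc t ht))

/-- Such a function is affine with slope c; a nonzero slope would make it unbounded. -/
theorem eq_zero_of_hasDerivWithinAt_Ici_of_bounded {c B : ℝ}
    (h : ∀ t, 0 ≤ t → HasDerivWithinAt f c (Ici 0) t) (hB : ∀ t, 0 ≤ t → |f t| ≤ B) : c = 0 := by
  have h1 : ∀ t, 0 ≤ t → f t = f 0 + c * t := by
    intro t ht
    have := eq_of_hasDerivWithinAt_Ici_zero (f := fun s => f s - c * s) (fun s hs =>
      ((h s hs).sub ((hasDerivWithinAt_id s _).const_mul c)).congr_deriv (by simp)) ht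
    simp only [mul_zero, sub_zero] at this
    linarith
  by_contra hc
  have hc' : 0 < |c| := abs_pos.2 hc
  have hB0 : 0 ≤ B := (abs_nonneg _).trans (hB 0 le_rfl)
  let t := (2 * B + 1) / |c|
  have ht : 0 ≤ t := by positivity
  have h2 : |c * t| = 2 * B + 1 := by
    rw [abs_mul, abs_of_nonneg ht]
    exact mul_div_cancel₀ _ hc'.ne'
  have h3 : c * t = f t - f 0 := by rw [h1 t ht]; ring
  rw [h3] at h2
  linarith [abs_sub (f t) (f 0), hB t ht, hB 0 le_rfl]

/-- The image of the half-line is connected, and a countable set of reals is totally disconnected.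
-/
theorem eq_of_continuousOn_Ici_of_countable {s : Set ℝ} (hs : s.Countable)
    (hf : ContinuousOn f (Ici 0)) (hfs : ∀ t, 0 ≤ t → f t ∈ s) {t : ℝ} (ht : 0 ≤ t) :
    f t = f 0 :=
  hs.isTotallyDisconnected (f '' Ici 0) (image_subset_iff.2 fun t ht => hfs t ht)
    (isPreconnected_Ici.image f hf) (mem_image_of_mem f ht) (mem_image_of_mem f self_mem_Ici)

theorem countable_setOf_cos_eq (c : ℝ) : {x : ℝ | Real.cos x = c}.Countable := by
  rcases {x : ℝ | Real.cos x = c}.eq_empty_or_nonempty with h | ⟨x₀, hx₀⟩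
  · rw [h]; exact countable_empty
  · refine (countable_iUnion fun k : ℤ =>
      ((countable_singleton (2 * k * Real.pi - x₀)).insert (2 * k * Real.pi + x₀))).mono ?_
    intro x hx
    have h1 : Real.cos x₀ = Real.cos x := Eq.trans hx₀ (Eq.symm hx)
    obtain ⟨k, hk⟩ := Real.cos_eq_cos_iff.1 h1
    exact mem_iUnion.2 ⟨k, hk⟩

theorem countable_setOf_quadratic_eq_zero {a b c : ℝ} (h : a ≠ 0 ∨ b ≠ 0) :
    {x : ℝ | a * x ^ 2 + b * x + c = 0}.Countable := by
  let p : Polynomial ℝ := .C a * .X ^ 2 + .C b * .X + .C c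
  have hp : p ≠ 0 := by
    intro h0
    have h2 : p.coeff 2 = 0 := by rw [h0]; simp
    have h1 : p.coeff 1 = 0 := by rw [h0]; simp
    simp [p, Polynomial.coeff_C] at h1 h2
    tauto
  refine (p.finite_setOfPred_isRoot hp).countable.mono fun x hx => ?_
  simpa [p, Polynomial.IsRoot] using hx

end HalfLine

/-! ### Motions with active joints at rest are equilibria -/

namespace Manipulator

open Set

variable {P : Manipulator}

/-- A motion of one manipulator under a constant force `w` at the virtual end-effector along which
the active joints are at rest. -/
structure IsRestMotion (P : Manipulator) (kD : ℝ) (w : Vec2) (q v : ℝ → Vec2) : Prop where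
  hasDeriv_q : ∀ t, 0 ≤ t → HasDerivWithinAt q (v t) (Ici 0) t
  hasDeriv_v : ∀ t, 0 ≤ t → HasDerivWithinAt v (P.accel kD w (q t) (v t)) (Ici 0) t
  active_mul_v : ∀ t, 0 ≤ t → ∀ j, P.active j * v t j = 0

namespace IsRestMotion

variable {kD : ℝ} {w : Vec2} {q v : ℝ → Vec2}

theorem hasDeriv_q_apply (h : P.IsRestMotion kD w q v) {t : ℝ} (ht : 0 ≤ t) (j : Fin 2) :
    HasDerivWithinAt (fun s => q s j) (v t j) (Ici 0) t :=
  hasDerivWithinAt_pi.1 (h.hasDeriv_q t ht) j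

theorem hasDeriv_v_apply (h : P.IsRestMotion kD w q v) {t : ℝ} (ht : 0 ≤ t) (j : Fin 2) :
    HasDerivWithinAt (fun s => v s j) (P.accel kD w (q t) (v t) j) (Ici 0) t :=
  hasDerivWithinAt_pi.1 (h.hasDeriv_v t ht) j

theorem v_eq_zero (h : P.IsRestMotion kD w q v) {j : Fin 2} (hj : P.active j = 1) {t : ℝ}
    (ht : 0 ≤ t) : v t j = 0 := by
  simpa [hj] using h.active_mul_v t ht j

theorem accel_eq_zero (h : P.IsRestMotion kD w q v) {j : Fin 2} (hj : ∀ t, 0 ≤ t → v t j = 0)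
    {t : ℝ} (ht : 0 ≤ t) : P.accel kD w (q t) (v t) j = 0 :=
  eq_zero_of_hasDerivWithinAt_Ici_of_forall_eq hj ht (h.hasDeriv_v_apply ht j)

theorem q_eq (h : P.IsRestMotion kD w q v) {j : Fin 2} (hj : ∀ t, 0 ≤ t → v t j = 0)
    {t : ℝ} (ht : 0 ≤ t) : q t j = q 0 j :=
  eq_of_hasDerivWithinAt_Ici_zero (fun s hs => by
    simpa [hj s hs] using h.hasDeriv_q_apply hs j) ht

theorem v_eq_zero_of_q_eq (h : P.IsRestMotion kD w q v) {j : Fin 2} {c : ℝ}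
    (hj : ∀ t, 0 ≤ t → q t j = c) {t : ℝ} (ht : 0 ≤ t) : v t j = 0 :=
  eq_zero_of_hasDerivWithinAt_Ici_of_forall_eq hj ht (h.hasDeriv_q_apply ht j)

theorem continuousOn_q (h : P.IsRestMotion kD w q v) (j : Fin 2) :
    ContinuousOn (fun s => q s j) (Ici 0) :=
  fun _ ht => (h.hasDeriv_q_apply ht j).continuousWithinAt

end IsRestMotion

theorem equation_of_motion_zero (P : Manipulator) (kD : ℝ) (w q v : Vec2) :
    (P.α₁ + P.α₂ + 2 * P.α₃ * Real.cos (q 1)) * P.accel kD w q v 0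
      + (P.α₂ + P.α₃ * Real.cos (q 1)) * P.accel kD w q v 1 =
    P.virtualTorque w q 0 - kD * P.active 0 * v 0 - P.spring 0 * q 0
      + P.α₃ * Real.sin (q 1) * (2 * v 0 * v 1 + v 1 ^ 2) := by
  have := congrFun (P.massMatrix_mulVec_accel kD w q v) 0
  simp [massMatrix, coriolis, feedback, dotProduct, Fin.sum_univ_two, Matrix.mulVec] at this
  linear_combination this

theorem equation_of_motion_one (P : Manipulator) (kD : ℝ) (w q v : Vec2) :
    (P.α₂ + P.α₃ * Real.cos (q 1)) * P.accel kD w q v 0 + P.α₂ * P.accel kD w q v 1 =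
    P.virtualTorque w q 1 - kD * P.active 1 * v 1 - P.spring 1 * q 1
      - P.α₃ * Real.sin (q 1) * v 0 ^ 2 := by
  have := congrFun (P.massMatrix_mulVec_accel kD w q v) 1
  simp [massMatrix, coriolis, feedback, dotProduct, Fin.sum_univ_two, Matrix.mulVec] at this
  linear_combination this

namespace IsRestMotion

variable {kD : ℝ} {w : Vec2} {q v : ℝ → Vec2}

/-- With the first joint at rest, its equation is an exact derivative and can be integrated twice.
Boundedness kills both integration constants, so at each time either α₂ + α₃ cos q₁ vanishes or v₁
does; in the second case both equations together give q₁ = 0. -/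
theorem passive_eq_zero_of_ap (h : P.IsRestMotion kD w q v) (hk : P.kind = .ap) {B : ℝ}
    (hB : ∀ t, 0 ≤ t → |q t 1| ≤ B ∧ |v t 1| ≤ B) {t : ℝ} (ht : 0 ≤ t) : q t 1 = 0 := by
  have hα₂ := P.α₂_pos
  have hα₃ := P.α₃_pos
  have hK := P.K_pos 1
  have hact0 : P.active 0 = 1 := by simp [active, hk]
  have hact1 : P.active 1 = 0 := by simp [active, hk]
  have hspr0 : P.spring 0 = 0 := by simp [spring, hk]
  have hspr1 : P.spring 1 = P.K 1 := by simp [spring, hk]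
  have hv0 : ∀ s, 0 ≤ s → v s 0 = 0 := fun s hs => h.v_eq_zero hact0 hs
  have ha0 : ∀ s, 0 ≤ s → P.accel kD w (q s) (v s) 0 = 0 := fun s hs => h.accel_eq_zero hv0 hs
  have hκ : ∀ s, 0 ≤ s → P.virtualTorque w (q s) 0 = P.virtualTorque w (q 0) 0 := by
    intro s hs
    simp [virtualTorque, hk, armTorque, armAngle, h.q_eq hv0 hs]
  set κ := P.virtualTorque w (q 0) 0
  have hvt1 : ∀ s, P.virtualTorque w (q s) 1 = 0 := fun s => by simp [virtualTorque, hk]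
  have row0 : ∀ s, 0 ≤ s → (P.α₂ + P.α₃ * Real.cos (q s 1)) * P.accel kD w (q s) (v s) 1
      - P.α₃ * Real.sin (q s 1) * v s 1 ^ 2 = κ := by
    intro s hs
    have := P.equation_of_motion_zero kD w (q s) (v s)
    rw [ha0 s hs, hv0 s hs, hκ s hs, hspr0] at this
    linear_combination this
  have row1 : ∀ s, 0 ≤ s → P.α₂ * P.accel kD w (q s) (v s) 1 = -P.K 1 * q s 1 := by
    intro s hs
    have := P.equation_of_motion_one kD w (q s) (v s)
    rw [ha0 s hs, hv0 s hs, hvt1, hact1, hspr1] at this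
    linear_combination this
  -- First integration: the momentum conjugate to the resting joint grows at the constant rate κ,
  -- yet is bounded.
  have hg : ∀ s, 0 ≤ s →
      HasDerivWithinAt (fun s => (P.α₂ + P.α₃ * Real.cos (q s 1)) * v s 1) κ (Ici 0) s := by
    intro s hs
    refine ((((h.hasDeriv_q_apply hs 1).cos.const_mul P.α₃).const_add P.α₂).mul
      (h.hasDeriv_v_apply hs 1)).congr_deriv ?_
    rw [← row0 s hs]
    ring
  have hcoef : ∀ x : ℝ, |P.α₂ + P.α₃ * Real.cos x| ≤ P.α₂ + P.α₃ := by
    intro x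
    rw [abs_le]
    constructor <;> nlinarith [Real.neg_one_le_cos x, Real.cos_le_one x]
  have hκ0 : κ = 0 := eq_zero_of_hasDerivWithinAt_Ici_of_bounded hg
    (B := (P.α₂ + P.α₃) * B) fun s hs => by
      rw [abs_mul]
      exact mul_le_mul (hcoef _) (hB s hs).2 (abs_nonneg _) (by positivity)
  rw [hκ0] at hg row0
  have hgc : ∀ s, 0 ≤ s → (P.α₂ + P.α₃ * Real.cos (q s 1)) * v s 1 =
      (P.α₂ + P.α₃ * Real.cos (q 0 1)) * v 0 1 := fun s hs =>
    eq_of_hasDerivWithinAt_Ici_zero hg hs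
  -- Second integration: the conserved momentum is itself the derivative of a bounded function of
  -- q₁, hence zero.
  have hG : ∀ s, 0 ≤ s → HasDerivWithinAt (fun s => P.α₂ * q s 1 + P.α₃ * Real.sin (q s 1))
      ((P.α₂ + P.α₃ * Real.cos (q 0 1)) * v 0 1) (Ici 0) s := by
    intro s hs
    refine (((h.hasDeriv_q_apply hs 1).const_mul P.α₂).add
      ((h.hasDeriv_q_apply hs 1).sin.const_mul P.α₃)).congr_deriv ?_
    rw [← hgc s hs]
    ring
  have hc0 := eq_zero_of_hasDerivWithinAt_Ici_of_bounded hG (B := P.α₂ * B + P.α₃) fun s hs => by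
    refine (abs_add_le _ _).trans (add_le_add ?_ ?_)
    · rw [abs_mul, abs_of_pos hα₂]
      exact mul_le_mul_of_nonneg_left (hB s hs).1 hα₂.le
    · rw [abs_mul, abs_of_pos hα₃]
      exact mul_le_of_le_one_right hα₃.le (Real.abs_sin_le_one _)
  have hval : ∀ s, 0 ≤ s → q s 1 ∈ insert 0 {x : ℝ | Real.cos x = -P.α₂ / P.α₃} := by
    intro s hs
    have h1 := (hgc s hs).trans hc0
    have h2 := row0 s hs
    by_cases h3 : P.α₂ + P.α₃ * Real.cos (q s 1) = 0
    · right
      rw [mem_ofPred_eq, eq_div_iff hα₃.ne']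
      linear_combination h3
    · left
      have h4 := (mul_eq_zero.1 h1).resolve_left h3
      rw [h4] at h2
      have h5 : P.accel kD w (q s) (v s) 1 = 0 := by
        refine (mul_eq_zero.1 ?_).resolve_left h3
        linear_combination h2
      have h6 := row1 s hs
      rw [h5] at h6
      refine (mul_eq_zero.1 ?_).resolve_left hK.ne'
      linear_combination h6
  have hconst : ∀ s, 0 ≤ s → q s 1 = q 0 1 := fun s hs =>
    eq_of_continuousOn_Ici_of_countable ((countable_setOf_cos_eq _).insert 0)
      (h.continuousOn_q 1) hval hs
  have h1 := h.accel_eq_zero (fun s hs => h.v_eq_zero_of_q_eq hconst hs) ht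
  have h2 := row1 t ht
  rw [h1] at h2
  refine (mul_eq_zero.1 ?_).resolve_left hK.ne'
  linear_combination h2

/-- With the second joint at rest the first is a harmonic oscillator with conserved energy E.
Eliminating acceleration and squared velocity from the second equation leaves a quadratic equation
for q₀ with constant coefficients, so q₀ has finitely many possible values. -/
theorem passive_eq_zero_of_pa (h : P.IsRestMotion kD w q v) (hk : P.kind = .pa)
    (hα : P.α₂ ≠ P.α₃) {t : ℝ} (ht : 0 ≤ t) : q t 0 = 0 := by
  have hα₂ := P.α₂_pos
  have hα₃ := P.α₃_pos
  have hK := P.K_pos 0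
  have hact0 : P.active 0 = 0 := by simp [active, hk]
  have hact1 : P.active 1 = 1 := by simp [active, hk]
  have hspr0 : P.spring 0 = P.K 0 := by simp [spring, hk]
  have hspr1 : P.spring 1 = 0 := by simp [spring, hk]
  have hv1 : ∀ s, 0 ≤ s → v s 1 = 0 := fun s hs => h.v_eq_zero hact1 hs
  have ha1 : ∀ s, 0 ≤ s → P.accel kD w (q s) (v s) 1 = 0 := fun s hs => h.accel_eq_zero hv1 hs
  have hq1 : ∀ s, 0 ≤ s → q s 1 = q 0 1 := fun s hs => h.q_eq hv1 hs
  have hκ : ∀ s, 0 ≤ s → P.virtualTorque w (q s) 1 = P.virtualTorque w (q 0) 1 := by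
    intro s hs
    simp [virtualTorque, hk, armTorque, armAngle, hq1 s hs]
  set κ := P.virtualTorque w (q 0) 1
  have hvt0 : ∀ s, P.virtualTorque w (q s) 0 = 0 := fun s => by simp [virtualTorque, hk]
  let m := P.α₁ + P.α₂ + 2 * P.α₃ * Real.cos (q 0 1)
  let b := P.α₂ + P.α₃ * Real.cos (q 0 1)
  let c := P.α₃ * Real.sin (q 0 1)
  have row0 : ∀ s, 0 ≤ s → m * P.accel kD w (q s) (v s) 0 = -P.K 0 * q s 0 := by
    intro s hs
    have := P.equation_of_motion_zero kD w (q s) (v s)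
    rw [ha1 s hs, hv1 s hs, hvt0, hact0, hspr0, hq1 s hs] at this
    linear_combination this
  have row1 : ∀ s, 0 ≤ s → b * P.accel kD w (q s) (v s) 0 + c * v s 0 ^ 2 = κ := by
    intro s hs
    have := P.equation_of_motion_one kD w (q s) (v s)
    rw [ha1 s hs, hv1 s hs, hκ s hs, hspr1, hq1 s hs] at this
    linear_combination this
  let E := m * v 0 0 ^ 2 + P.K 0 * q 0 0 ^ 2
  have hE : ∀ s, 0 ≤ s → m * v s 0 ^ 2 + P.K 0 * q s 0 ^ 2 = E := by
    intro s hs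
    refine eq_of_hasDerivWithinAt_Ici_zero
      (f := fun s => m * v s 0 ^ 2 + P.K 0 * q s 0 ^ 2) (fun s hs => ?_) hs
    refine ((((h.hasDeriv_v_apply hs 0).pow 2).const_mul m).add
      (((h.hasDeriv_q_apply hs 0).pow 2).const_mul (P.K 0))).congr_deriv ?_
    push_cast
    linear_combination 2 * v s 0 * row0 s hs
  -- The quadratic degenerates only if sin q₁ = 0 and α₂ = -α₃ cos q₁, that is, only if α₂ = α₃.
  have hbc : c * P.K 0 ≠ 0 ∨ b * P.K 0 ≠ 0 := by
    by_contra! h0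
    have hc0 := (mul_eq_zero.1 h0.1).resolve_right hK.ne'
    have hb0 : b = 0 := (mul_eq_zero.1 h0.2).resolve_right hK.ne'
    have hs0 := (mul_eq_zero.1 hc0).resolve_left hα₃.ne'
    have h1 := Real.sin_sq_add_cos_sq (q 0 1)
    rw [hs0] at h1
    have h2 : (P.α₂ - P.α₃) * (P.α₂ + P.α₃) = 0 := by
      simp only [b] at hb0
      linear_combination (P.α₂ - P.α₃ * Real.cos (q 0 1)) * hb0 + P.α₃ ^ 2 * h1
    rcases mul_eq_zero.1 h2 with h3 | h3
    · exact hα (sub_eq_zero.1 h3)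
    · linarith
  have hconst : ∀ s, 0 ≤ s → q s 0 = q 0 0 := fun s hs =>
    eq_of_continuousOn_Ici_of_countable
      (countable_setOf_quadratic_eq_zero (c := m * κ - c * E) hbc) (h.continuousOn_q 0)
      (fun s hs => by
        rw [mem_ofPred_eq]
        linear_combination -m * row1 s hs + b * row0 s hs + c * hE s hs) hs
  have h1 := h.accel_eq_zero (fun s hs => h.v_eq_zero_of_q_eq hconst hs) ht
  have h2 := row0 t ht
  rw [h1] at h2
  refine (mul_eq_zero.1 ?_).resolve_left hK.ne'
  linear_combination h2

/-- Along a bounded motion whose active joints are at rest, the manipulator is in equilibrium. -/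
theorem equilibrium (h : P.IsRestMotion kD w q v) (hα : P.kind = .pa → P.α₂ ≠ P.α₃) {B : ℝ}
    (hB : ∀ t, 0 ≤ t → ∀ j, P.spring j ≠ 0 → |q t j| ≤ B ∧ |v t j| ≤ B) {t : ℝ} (ht : 0 ≤ t) :
    v t = 0 ∧ P.passiveAngle (q t) = 0 ∧ P.Balanced (q t) w := by
  have hpas : ∀ s, 0 ≤ s → ∀ j, P.spring j ≠ 0 → q s j = 0 := by
    intro s hs j
    cases hk : P.kind
    · intro hj; fin_cases j <;> simp [spring, hk] at hj
    · have hs1 : P.spring 1 ≠ 0 := by simp [spring, hk, (P.K_pos 1).ne']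
      have := h.passive_eq_zero_of_ap hk (fun s hs => hB s hs 1 hs1) hs
      intro hj
      fin_cases j
      · simp [spring, hk] at hj
      · exact this
    · have := h.passive_eq_zero_of_pa hk (hα hk) hs
      intro hj
      fin_cases j
      · exact this
      · simp [spring, hk] at hj
  have hv : ∀ j, ∀ s, 0 ≤ s → v s j = 0 := by
    intro j s hs
    rcases P.active_eq j with ⟨hj, -⟩ | ⟨-, hj⟩
    · exact h.v_eq_zero hj hs
    · exact h.v_eq_zero_of_q_eq (fun s hs => hpas s hs j hj.ne') hs
  have hvt : v t = 0 := funext fun j => hv j t ht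
  refine ⟨hvt, ?_, ?_⟩
  · have hK0 := P.K_pos 0
    have hK1 := P.K_pos 1
    cases hk : P.kind <;> simp only [passiveAngle, hk]
    · exact hpas t ht 1 (by simp [spring, hk, hK1.ne'])
    · exact hpas t ht 0 (by simp [spring, hk, hK0.ne'])
  · rw [← virtualTorque_eq_zero_iff]
    have ha : P.accel kD w (q t) (v t) = 0 := funext fun j => h.accel_eq_zero (hv j) ht
    have heq := P.massMatrix_mulVec_accel kD w (q t) (v t)
    rw [ha, hvt, Matrix.mulVec_zero, Matrix.mulVec_zero, sub_zero] at heq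
    ext j
    have h1 := congrFun heq j
    have h2 : P.spring j * q t j = 0 := by
      by_cases hj : P.spring j = 0
      · rw [hj, zero_mul]
      · rw [hpas t ht j hj, mul_zero]
    simp only [feedback, Pi.zero_apply, mul_zero, h2, sub_zero] at h1
    exact h1.symm

end IsRestMotion

theorem xHat_congr (P : Manipulator) {q q' : Vec2} (h : ∀ j, P.active j = 1 → q j = q' j) :
    P.xHat q = P.xHat q' := by
  have ha : P.armAngle q = P.armAngle q' := by
    ext j
    cases hk : P.kind <;> simp only [active, hk] at h <;> simp only [armAngle, hk] <;> fin_cases j <;>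
      simp [h 1] <;> exact h _ (by simp)
  refine funext (Fin.forall_fin_two.2 ⟨?_, ?_⟩)
  · simp only [xHat_zero, ha]
  · simp only [xHat_one, ha]

end Manipulator

/-! ### The invariance principle: decay of the energy -/

namespace Setup

variable {N : ℕ} (S : Setup N)

/-- If the energy is constant along a motion, then the motion is a critical equilibrium. -/
theorem equilibrium_of_energy_eq
    (hpa : ∀ i, (S.manip i).kind = Kind.pa → (S.manip i).α₂ ≠ (S.manip i).α₃)
    {z : ℝ → (Fin N → Vec2) × (Fin N → Vec2)} (hz : IsTrajectory S.field z) {c : ℝ}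
    (hc : ∀ t, 0 ≤ t → S.totalEnergy (z t) = c) :
    (z 0).2 = 0 ∧ (∀ i, (S.manip i).passiveAngle ((z 0).1 i) = 0) ∧
      ∀ i, (S.manip i).Balanced ((z 0).1 i) (S.eHat (S.xHat (z 0).1) i) := by
  have hdiss : ∀ t, 0 ≤ t → S.dissipation (z t).2 = 0 := by
    intro t ht
    have h1 : HasDerivWithinAt (fun s => S.totalEnergy (z s))
        (fderiv ℝ S.totalEnergy (z t) (S.field (z t))) (Set.Ici 0) t :=
      (S.differentiable_totalEnergy _).hasFDerivAt.comp_hasDerivWithinAt t (hz t ht)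
    have h2 := eq_zero_of_hasDerivWithinAt_Ici_of_forall_eq hc ht h1
    rw [fderiv_totalEnergy_field] at h2
    linarith
  have hq : ∀ i t, 0 ≤ t → HasDerivWithinAt (fun s => (z s).1 i) ((z t).2 i) (Set.Ici 0) t :=
    fun i t ht => hasDerivWithinAt_pi.1 (hz t ht).fst i
  have hv : ∀ i t, 0 ≤ t →
      HasDerivWithinAt (fun s => (z s).2 i) ((S.field (z t)).2 i) (Set.Ici 0) t :=
    fun i t ht => hasDerivWithinAt_pi.1 (hz t ht).snd i
  have hact : ∀ t, 0 ≤ t → ∀ i j, (S.manip i).active j * (z t).2 i j = 0 := fun t ht i j =>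
    S.active_mul_eq_zero_of_dissipation_eq_zero (hdiss t ht) i j
  -- The virtual end-effectors depend on active angles only. As these are at rest, the forces are
  -- constant and the manipulators decouple.
  have hx : ∀ t, 0 ≤ t → S.xHat (z t).1 = S.xHat (z 0).1 := by
    intro t ht
    refine funext fun i => (S.manip i).xHat_congr fun j hj => ?_
    refine eq_of_hasDerivWithinAt_Ici_zero (f := fun s => (z s).1 i j) (fun s hs => ?_) ht
    have h1 := hasDerivWithinAt_pi.1 (hq i s hs) j
    have h2 := hact s hs i j
    rw [hj, one_mul] at h2
    rwa [h2] at h1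
  obtain ⟨C, hC, hbd⟩ := S.exists_energy_bound
  have hrest : ∀ i, (S.manip i).IsRestMotion S.kD (S.eHat (S.xHat (z 0).1) i)
      (fun t => (z t).1 i) fun t => (z t).2 i := fun i =>
    { hasDeriv_q := hq i
      hasDeriv_v := fun t ht => by
        have := hv i t ht
        simpa only [field, hx t ht] using this
      active_mul_v := fun t ht j => hact t ht i j }
  have heq := fun i => (hrest i).equilibrium (hpa i) (B := Real.sqrt (C * c))
    (fun t ht j hj => by
      have h1 := hbd (z t).1 (z t).2 i j
      have h2 : S.energy (z t).1 (z t).2 = c := hc t ht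
      rw [h2] at h1
      exact ⟨Real.abs_le_sqrt (h1.2 hj), Real.abs_le_sqrt h1.1⟩) le_rfl
  exact ⟨funext fun i => (heq i).1, fun i => (heq i).2.1, fun i => (heq i).2.2⟩

theorem antitoneOn_energy {x : ℝ → (Fin N → Vec2) × (Fin N → Vec2)} (hx : IsTrajectory S.field x) :
    AntitoneOn (fun t => S.totalEnergy (x t)) (Set.Ici 0) :=
  antitoneOn_of_isTrajectory S.differentiable_totalEnergy S.fderiv_totalEnergy_field_nonpos hx

theorem exists_tendsto_energy {x : ℝ → (Fin N → Vec2) × (Fin N → Vec2)}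
    (hx : IsTrajectory S.field x) :
    ∃ c, Tendsto (fun t => S.totalEnergy (x t)) atTop (𝓝 c) := by
  have h1 : Antitone fun t => S.totalEnergy (x (max t 0)) := fun s t hst =>
    S.antitoneOn_energy hx (le_max_right s 0) (le_max_right t 0) (max_le_max_right 0 hst)
  have h2 : BddBelow (Set.range fun t => S.totalEnergy (x (max t 0))) :=
    ⟨0, by rintro _ ⟨t, rfl⟩; exact S.energy_nonneg _ _⟩
  refine ⟨_, (tendsto_atTop_ciInf h1 h2).congr' ?_⟩
  filter_upwards [eventually_ge_atTop 0] with t ht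
  rw [max_eq_left ht]

/-- Limiting motion of a trajectory: the energy along it is the limit of the energy. -/
theorem exists_limit_trajectory {x : ℝ → (Fin N → Vec2) × (Fin N → Vec2)}
    (hx : IsTrajectory S.field x) {c : ℝ}
    (hc : Tendsto (fun t => S.totalEnergy (x t)) atTop (𝓝 c)) :
    ∃ z, IsTrajectory S.field z ∧ ∀ t, 0 ≤ t → S.totalEnergy (z t) = c := by
  have hanti := S.antitoneOn_energy hx
  have hle : ∀ t, 0 ≤ t → S.totalEnergy (x t) ≤ S.totalEnergy (x 0) := fun t ht =>
    hanti Set.self_mem_Ici ht ht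
  obtain ⟨C, hC⟩ := S.exists_norm_field_le (S.totalEnergy (x 0))
  obtain ⟨R, hR⟩ := S.exists_norm_add_turn_le (S.totalEnergy (x 0))
  choose n hn using fun k : ℕ => hR (x k) (hle k k.cast_nonneg)
  -- Time shifts, turned back so that their initial states lie in a fixed ball; they remain
  -- trajectories by invariance of the field.
  let y : ℕ → ℝ → (Fin N → Vec2) × (Fin N → Vec2) := fun k t => x (k + t) + S.turn (n k)
  have hy : ∀ k, IsTrajectory S.field (y k) := fun k t ht => by
    simp only [y, field_add_turn]
    exact ((hx.comp_add k.cast_nonneg) t ht).add_const _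
  have hy0 : ∀ k, y k 0 = x k + S.turn (n k) := fun k => by simp [y]
  obtain ⟨s, -, φ, hφ, hs⟩ := (isCompact_closedBall (0 : (Fin N → Vec2) × (Fin N → Vec2)) R).tendsto_subseq
    (x := fun k => y k 0) fun k => by rw [hy0]; exact mem_closedBall_zero_iff.2 (hn k)
  obtain ⟨z, hz, -, hlim⟩ := exists_isTrajectory_tendsto S.contDiff_field
    S.differentiable_totalEnergy S.fderiv_totalEnergy_field_nonpos hC (y := fun k => y (φ k))
    (fun k => hy _) (fun k => by
      rw [hy0, totalEnergy_add_turn]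
      exact hle _ (Nat.cast_nonneg _)) hs
  refine ⟨z, hz, fun t ht => ?_⟩
  have h1 := (S.differentiable_totalEnergy.continuous.tendsto (z t)).comp (hlim t ht)
  have h2 : Tendsto (fun k => (φ k : ℝ) + t) atTop atTop :=
    tendsto_atTop_add_const_right _ _ (tendsto_natCast_atTop_atTop.comp hφ.tendsto_atTop)
  refine tendsto_nhds_unique h1 ((hc.comp h2).congr fun k => ?_)
  simp [y, totalEnergy_add_turn]

/-- The energy tends to zero along motions with small initial energy. -/
theorem exists_tendsto_energy_zero
    (hpa : ∀ i, (S.manip i).kind = Kind.pa → (S.manip i).α₂ ≠ (S.manip i).α₃) :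
    ∃ γ : ℝ, 0 < γ ∧ ∀ x, IsTrajectory S.field x → S.totalEnergy (x 0) ≤ γ →
      Tendsto (fun t => S.totalEnergy (x t)) atTop (𝓝 0) := by
  obtain ⟨γ, hγ, hcrit⟩ := S.exists_isolated_critical_value
  refine ⟨γ, hγ, fun x hx hxγ => ?_⟩
  obtain ⟨c, hc⟩ := S.exists_tendsto_energy hx
  obtain ⟨z, hz, hzc⟩ := S.exists_limit_trajectory hx hc
  obtain ⟨hv, hp, hb⟩ := S.equilibrium_of_energy_eq hpa hz hzc
  -- At an equilibrium the kinetic and passive-spring terms vanish, so the limit of the energy is a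
  -- critical value of V.
  have hU : S.totalEnergy (z 0) = S.V (S.xHat (z 0).1) := by
    simp [totalEnergy, energy, hv, hp]
  have hcγ : c ≤ γ := by
    refine le_of_tendsto hc ?_
    filter_upwards [eventually_ge_atTop 0] with t ht
    exact (S.antitoneOn_energy hx Set.self_mem_Ici ht ht).trans hxγ
  have h0 := hzc 0 le_rfl
  have h1 := hcrit _ hb (by rw [← hU, h0]; exact hcγ)
  rw [← hU, h0] at h1
  have h2 : 0 ≤ c := h0 ▸ S.energy_nonneg _ _
  rwa [le_antisymm h1 h2] at hc

end Setup

/-! ### Compactness and connectedness arguments in metric spaces -/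

section Metric

open Set Metric

variable {X : Type*} [MetricSpace X]

/-- On the compact part of K at distance at least ε from the zeros, f attains a positive minimum;
half of it serves as γ. -/
theorem exists_forall_infDist_lt {K : Set X} (hK : IsCompact K) {f : X → ℝ} (hf : Continuous f)
    (hf0 : ∀ x, 0 ≤ f x) {ε : ℝ} (hε : 0 < ε) :
    ∃ γ : ℝ, 0 < γ ∧ ∀ x ∈ K, f x ≤ γ → infDist x {x | x ∈ K ∧ f x = 0} < ε := by
  let Z := {x | x ∈ K ∧ f x = 0}
  have hC : IsCompact (K ∩ {x | ε ≤ infDist x Z}) :=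
    hK.inter_right (isClosed_le continuous_const (continuous_infDist_pt Z))
  rcases (K ∩ {x | ε ≤ infDist x Z}).eq_empty_or_nonempty with h | h
  · refine ⟨1, one_pos, fun x hx _ => lt_of_not_ge fun hle => ?_⟩
    exact (h ▸ (⟨hx, hle⟩ : x ∈ K ∩ {x | ε ≤ infDist x Z}) : x ∈ (∅ : Set X))
  · obtain ⟨x₀, hx₀, hmin⟩ := hC.exists_isMinOn h hf.continuousOn
    have hpos : 0 < f x₀ := (hf0 x₀).lt_of_ne' fun h0 => by
      have h1 : infDist x₀ Z = 0 := infDist_zero_of_mem ⟨hx₀.1, h0⟩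
      have h2 : ε ≤ infDist x₀ Z := hx₀.2
      linarith
    refine ⟨f x₀ / 2, half_pos hpos, fun x hx hle => lt_of_not_ge fun hge => ?_⟩
    have : f x₀ ≤ f x := hmin ⟨hx, hge⟩
    linarith

/-- A path that stays close to a set cannot leave the vicinity of a part of it that is separated
from the rest. -/
theorem infDist_inter_le_of_continuousOn {Z T : Set X} {r : ℝ}
    (hsep : ∀ z ∈ Z ∩ T, ∀ y ∈ Z, dist z y < r → y ∈ T) (hZ : Z.Nonempty) {c : ℝ → X}
    (hc : ContinuousOn c (Ici 0)) (hclose : ∀ t, 0 ≤ t → infDist (c t) Z < r / 2)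
    (h0 : ∃ x ∈ Z ∩ T, dist (c 0) x < r / 2) {t : ℝ} (ht : 0 ≤ t) :
    infDist (c t) (Z ∩ T) ≤ infDist (c t) Z := by
  -- Points of the two pieces with intersecting r/2-balls would be closer than r, against the
  -- separation; the connected path then stays in one of the two open sets.
  have hdisj : Disjoint (thickening (r / 2) (Z ∩ T)) (thickening (r / 2) (Z \ T)) := by
    rw [Set.disjoint_left]
    intro x hx hy
    obtain ⟨a, ha, hxa⟩ := mem_thickening_iff.1 hx
    obtain ⟨b, hb, hxb⟩ := mem_thickening_iff.1 hy
    refine hb.2 (hsep a ha b hb.1 ?_)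
    linarith [dist_triangle_left a b x]
  have hsub : c '' Ici 0 ⊆ thickening (r / 2) (Z ∩ T) := by
    refine (isPreconnected_Ici.image c hc).subset_left_of_subset_union isOpen_thickening
      isOpen_thickening hdisj ?_ ?_
    · rintro _ ⟨s, hs, rfl⟩
      obtain ⟨y, hy, hd⟩ := (infDist_lt_iff hZ).1 (hclose s hs)
      by_cases hyT : y ∈ T
      · exact Or.inl (mem_thickening_iff.2 ⟨y, ⟨hy, hyT⟩, hd⟩)
      · exact Or.inr (mem_thickening_iff.2 ⟨y, ⟨hy, hyT⟩, hd⟩)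
    · obtain ⟨x, hx, hd⟩ := h0
      exact ⟨c 0, mem_image_of_mem c self_mem_Ici, mem_thickening_iff.2 ⟨x, hx, hd⟩⟩
  refine le_of_forall_gt fun b hb => ?_
  obtain ⟨y, hy, hd⟩ := (infDist_lt_iff hZ).1 (lt_min hb (hclose t ht))
  have hyT : y ∈ T := by
    by_contra hyT
    exact Set.disjoint_left.1 hdisj (hsub (mem_image_of_mem c ht))
      (mem_thickening_iff.2 ⟨y, ⟨hy, hyT⟩, hd.trans_le (min_le_right _ _)⟩)
  exact (infDist_le_dist_of_mem (show y ∈ Z ∩ T from ⟨hy, hyT⟩)).trans_lt (hd.trans_le (min_le_left _ _))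

theorem tendsto_infDist_of_tendsto_dist {ι : Type*} {l : Filter ι} {x y : ι → X} {Z : Set X}
    (hx : Tendsto (fun t => infDist (x t) Z) l (𝓝 0))
    (hxy : Tendsto (fun t => dist (y t) (x t)) l (𝓝 0)) :
    Tendsto (fun t => infDist (y t) Z) l (𝓝 0) :=
  squeeze_zero (fun _ => infDist_nonneg) (fun _ => infDist_le_infDist_add_dist)
    (by simpa using hx.add hxy)

end Metric

theorem tendsto_zero_of_sq_le {ι : Type*} {l : Filter ι} {f g : ι → ℝ} {c : ℝ}
    (hg : Tendsto g l (𝓝 0)) (h : ∀ t, f t ^ 2 ≤ c * g t) : Tendsto f l (𝓝 0) := by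
  refine squeeze_zero_norm (fun t => Real.abs_le_sqrt (h t)) ?_
  simpa using (hg.const_mul c).sqrt

/-! ### Geometry of actual and virtual end-effectors -/

namespace Manipulator

variable (P : Manipulator)

/-- By periodicity every value is attained with active angles in [-2π, 2π] and passive angle 0. -/
theorem isCompact_range_xHat : IsCompact (Set.range P.xHat) := by
  have h : Set.range P.xHat = P.xHat '' Metric.closedBall 0 (2 * Real.pi) := by
    refine (Set.image_subset_range _ _).antisymm' ?_
    rintro _ ⟨q, rfl⟩
    obtain ⟨n, hn⟩ := P.exists_abs_add_turn_le q
    refine ⟨fun j => P.active j * (q + P.turn n) j, ?_, ?_⟩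
    · rw [mem_closedBall_zero_iff, pi_norm_le_iff_of_nonneg Real.two_pi_pos.le]
      intro j
      rcases P.active_eq j with ⟨ha, hs⟩ | ⟨ha, -⟩
      · rw [ha, one_mul]
        exact (hn j).1 hs
      · simpa [ha] using Real.pi_pos.le
    · rw [← P.xHat_add_turn q n]
      exact P.xHat_congr fun j hj => by rw [hj, one_mul]
  rw [h]
  exact (isCompact_closedBall _ _).image P.contDiff_xHat.continuous

theorem abs_xEnd_sub_xHat_le (q : Vec2) (a : Fin 2) :
    |(P.xEnd q - P.xHat q) a| ≤ (P.L 0 + P.L 1) * |P.passiveAngle q| := by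
  have h0 := P.L_pos 0
  have h1 := P.L_pos 1
  have hs : ∀ x y d : ℝ, x - y = d → |Real.sin x - Real.sin y| ≤ |d| := by
    rintro x y _ rfl
    exact Real.abs_sin_sub_sin_le x y
  have hc : ∀ x y d : ℝ, x - y = d → |Real.cos x - Real.cos y| ≤ |d| := by
    rintro x y _ rfl
    exact Real.abs_cos_sub_cos_le x y
  have key : ∀ A B x y d : ℝ, |x| ≤ |d| → |y| ≤ |d| → 0 ≤ A → 0 ≤ B →
      |A * x + B * y| ≤ (A + B) * |d| := by
    intro A B x y d hx hy hA hB
    calc |A * x + B * y| ≤ |A * x| + |B * y| := abs_add_le _ _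
      _ = A * |x| + B * |y| := by rw [abs_mul, abs_mul, abs_of_nonneg hA, abs_of_nonneg hB]
      _ ≤ A * |d| + B * |d| := by gcongr
      _ = (A + B) * |d| := by ring
  revert a
  refine Fin.forall_fin_two.2 ⟨?_, ?_⟩
  · cases hk : P.kind <;> simp only [xEnd, xHat, h, passiveAngle, hk]
    · simp
    · refine (le_of_eq ?_).trans (key (P.L 0) (P.L 1) (Real.sin (q 0 + P.β) - Real.sin (q 0 + P.β))
        (Real.sin (q 0 + 0 + P.β) - Real.sin (q 0 + q 1 + P.β)) (q 1) (by simp) ?_ h0.le h1.le)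
      · congr 1
        simp
        ring
      · rw [← abs_neg (q 1)]; exact hs _ _ _ (by ring)
    · refine (le_of_eq ?_).trans (key (P.L 0) (P.L 1) (Real.sin (0 + P.β) - Real.sin (q 0 + P.β))
        (Real.sin (0 + q 1 + P.β) - Real.sin (q 0 + q 1 + P.β)) (q 0) ?_ ?_ h0.le h1.le)
      · congr 1
        simp
        ring
      · rw [← abs_neg (q 0)]; exact hs _ _ _ (by ring)
      · rw [← abs_neg (q 0)]; exact hs _ _ _ (by ring)
  · cases hk : P.kind <;> simp only [xEnd, xHat, h, passiveAngle, hk]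
    · simp
    · refine (le_of_eq ?_).trans (key (P.L 0) (P.L 1) (Real.cos (q 0 + P.β) - Real.cos (q 0 + P.β))
        (Real.cos (q 0 + q 1 + P.β) - Real.cos (q 0 + 0 + P.β)) (q 1) (by simp) ?_ h0.le h1.le)
      · congr 1
        simp
        ring
      · exact hc _ _ _ (by ring)
    · refine (le_of_eq ?_).trans (key (P.L 0) (P.L 1) (Real.cos (q 0 + P.β) - Real.cos (0 + P.β))
        (Real.cos (q 0 + q 1 + P.β) - Real.cos (0 + q 1 + P.β)) (q 0) ?_ ?_ h0.le h1.le)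
      · congr 1
        simp
        ring
      · exact hc _ _ _ (by ring)
      · exact hc _ _ _ (by ring)

/-- The virtual end-effector position is a function of the positions of the middle joint and of the
end-effector. -/
theorem xHat_eq_of_xEnd_eq_of_xMid_eq {q q' : Vec2} (he : P.xEnd q = P.xEnd q')
    (hm : P.xMid q = P.xMid q') : P.xHat q = P.xHat q' := by
  have hL0 := (P.L_pos 0).ne'
  have hL1 := (P.L_pos 1).ne'
  have hs : Real.sin (q 0 + P.β) = Real.sin (q' 0 + P.β) := by
    simpa [xMid, hL0] using congrFun hm 0
  have hc : Real.cos (q 0 + P.β) = Real.cos (q' 0 + P.β) := by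
    simpa [xMid, hL0] using congrFun hm 1
  have hs' : Real.sin (q 0 + q 1 + P.β) = Real.sin (q' 0 + q' 1 + P.β) := by
    simpa [xEnd, h, hs, hL1] using congrFun he 0
  have hc' : Real.cos (q 0 + q 1 + P.β) = Real.cos (q' 0 + q' 1 + P.β) := by
    simpa [xEnd, h, hc, hL1] using congrFun he 1
  -- The middle joint and the end-effector determine the two absolute link directions; the relative
  -- angle is their difference.
  have hr : ∀ q : Vec2, q 1 + P.β = (q 0 + q 1 + P.β) - (q 0 + P.β) + P.β := fun q => by ring
  have hs'' : Real.sin (q 1 + P.β) = Real.sin (q' 1 + P.β) := by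
    rw [hr q, hr q', Real.sin_add _ P.β, Real.sin_add _ P.β, Real.sin_sub, Real.sin_sub,
      Real.cos_sub, Real.cos_sub, hs, hc, hs', hc']
  have hc'' : Real.cos (q 1 + P.β) = Real.cos (q' 1 + P.β) := by
    rw [hr q, hr q', Real.cos_add _ P.β, Real.cos_add _ P.β, Real.sin_sub, Real.sin_sub,
      Real.cos_sub, Real.cos_sub, hs, hc, hs', hc']
  cases hk : P.kind <;> simp only [xHat, h, hk]
  · exact he
  · simp [hs, hc]
  · simp [hs'', hc'']

end Manipulator

/-! ### Distributed control and consequences of vanishing energy -/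

namespace Setup

variable {N : ℕ} (S : Setup N)

theorem isCompact_reachable : IsCompact S.reachable := by
  have h : S.reachable = Set.univ.pi fun i => Set.range (S.manip i).xHat := by
    ext x
    simp [reachable]
  rw [h]
  exact isCompact_univ_pi fun i => (S.manip i).isCompact_range_xHat

theorem xHat_mem_reachable (q : Fin N → Vec2) : S.xHat q ∈ S.reachable :=
  fun i => Set.mem_range_self (q i)

theorem exists_infDist_SW_lt {ε : ℝ} (hε : 0 < ε) :
    ∃ γ : ℝ, 0 < γ ∧ ∀ q, S.V (S.xHat q) ≤ γ → Metric.infDist (S.xHat q) S.SW < ε := by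
  obtain ⟨γ, hγ, h⟩ := exists_forall_infDist_lt S.isCompact_reachable S.contDiff_V.continuous
    S.V_nonneg hε
  refine ⟨γ, hγ, fun q hq => ?_⟩
  have hZ : S.SW = {x | x ∈ S.reachable ∧ S.V x = 0} :=
    Set.ext fun x => and_congr_right fun _ => S.V_eq_zero_iff.symm
  rw [hZ]
  exact h _ (S.xHat_mem_reachable q) hq

theorem dist_xEnd_xHat_le (q : Fin N → Vec2) : dist (S.xEnd q) (S.xHat q) ≤
    ∑ i, ((S.manip i).L 0 + (S.manip i).L 1) * |(S.manip i).passiveAngle (q i)| := by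
  have hL : ∀ i, 0 ≤ ((S.manip i).L 0 + (S.manip i).L 1) * |(S.manip i).passiveAngle (q i)| :=
    fun i => mul_nonneg (add_pos ((S.manip i).L_pos 0) ((S.manip i).L_pos 1)).le (abs_nonneg _)
  rw [dist_eq_norm, pi_norm_le_iff_of_nonneg (Finset.sum_nonneg fun i _ => hL i)]
  refine fun i => le_trans ?_ (Finset.single_le_sum (fun i _ => hL i) (Finset.mem_univ i))
  exact (pi_norm_le_iff_of_nonneg (hL i)).2 fun a => (S.manip i).abs_xEnd_sub_xHat_le (q i) a

theorem B_eq_zero {i : Fin N} {k : Fin S.G.numEdges} (ht : i ≠ S.G.tail k) (hh : i ≠ S.G.head k) :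
    S.G.B i k = 0 := by
  simp [FormationGraph.B, ht, hh]

/-- The virtual force at a vertex depends on the positions of this vertex and of its neighbours. -/
theorem eHat_congr {x y : Fin N → Vec2} {i : Fin N} (hi : x i = y i)
    (h : ∀ j, S.G.toSimpleGraph.Adj i j → x j = y j) : S.eHat x i = S.eHat y i := by
  refine Finset.sum_congr rfl fun k _ => ?_
  by_cases ht : i = S.G.tail k
  · have hh : x (S.G.head k) = y (S.G.head k) := h _ <| by
      rw [FormationGraph.toSimpleGraph, SimpleGraph.fromRel_adj]
      exact ⟨ht ▸ S.G.loopless k, Or.inl ⟨k, ht.symm, rfl⟩⟩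
    have ht' : x (S.G.tail k) = y (S.G.tail k) := ht ▸ hi
    simp only [err, FormationGraph.f, Pi.sub_apply, hh, ht']
  · by_cases hh : i = S.G.head k
    · have ht' : x (S.G.tail k) = y (S.G.tail k) := h _ <| by
        rw [FormationGraph.toSimpleGraph, SimpleGraph.fromRel_adj]
        exact ⟨ht, Or.inr ⟨k, rfl, hh.symm⟩⟩
      have hh' : x (S.G.head k) = y (S.G.head k) := hh ▸ hi
      simp only [err, FormationGraph.f, Pi.sub_apply, hh', ht']
    · rw [S.B_eq_zero ht hh, zero_smul, zero_smul]

theorem isDistributed : S.IsDistributed := by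
  classical
  intro i
  let g : (Fin N → Vec2) → {j // S.G.toSimpleGraph.Adj i j} → Vec2 × Vec2 := fun q j =>
    ((S.manip j).xEnd (q j), (S.manip j).xMid (q j))
  let F : (Fin N → Vec2) → Vec2 → Vec2 := fun q v =>
    (S.manip i).torque S.kD (S.eHat (S.xHat q) i) (q i) v
  -- The torque is evaluated at any configuration with the same local data; the choice does not
  -- matter, since the force depends only on those data. The value 0 at unrealizable data is never
  -- used.
  refine ⟨fun p a b => if h : ∃ q, g q = p ∧ q i = a then F h.choose b else 0, fun q v => ?_⟩
  have h : ∃ q', g q' = g q ∧ q' i = q i := ⟨q, rfl, rfl⟩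
  refine Eq.trans ?_ (dif_pos h).symm
  obtain ⟨hg, hi⟩ := h.choose_spec
  have hw : S.eHat (S.xHat h.choose) i = S.eHat (S.xHat q) i := by
    refine S.eHat_congr (congrArg (S.manip i).xHat hi) fun j hj => ?_
    have := Prod.ext_iff.1 (congrFun hg ⟨j, hj⟩)
    exact (S.manip j).xHat_eq_of_xEnd_eq_of_xMid_eq this.1 this.2
  simp only [F, hw, hi, control]

variable {q v : ℝ → Fin N → Vec2}

theorem tendsto_infDist_xHat (hU : Tendsto (fun t => S.energy (q t) (v t)) atTop (𝓝 0)) :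
    Tendsto (fun t => Metric.infDist (S.xHat (q t)) S.SW) atTop (𝓝 0) := by
  refine tendsto_order.2 ⟨fun a ha => .of_forall fun t => ha.trans_le Metric.infDist_nonneg,
    fun ε hε => ?_⟩
  obtain ⟨γ, hγ, h⟩ := S.exists_infDist_SW_lt hε
  filter_upwards [hU.eventually_lt_const hγ] with t ht
  exact h _ ((S.V_le_energy _ _).trans ht.le)

theorem tendsto_velocity (hU : Tendsto (fun t => S.energy (q t) (v t)) atTop (𝓝 0)) :
    Tendsto v atTop (𝓝 0) := by
  obtain ⟨c, -, hbd⟩ := S.exists_energy_bound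
  refine tendsto_pi_nhds.2 fun i => tendsto_pi_nhds.2 fun j => ?_
  exact tendsto_zero_of_sq_le (c := c) hU fun t => (hbd (q t) (v t) i j).1

theorem tendsto_passiveAngle (hU : Tendsto (fun t => S.energy (q t) (v t)) atTop (𝓝 0))
    (i : Fin N) : Tendsto (fun t => (S.manip i).passiveAngle (q t i)) atTop (𝓝 0) := by
  obtain ⟨c, -, hbd⟩ := S.exists_energy_bound
  have h0 := ((S.manip i).K_pos 0).ne'
  have h1 := ((S.manip i).K_pos 1).ne'
  have hj : ∀ j, (S.manip i).spring j ≠ 0 → Tendsto (fun t => q t i j) atTop (𝓝 0) := fun j hj =>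
    tendsto_zero_of_sq_le (c := c) hU fun t => (hbd (q t) (v t) i j).2 hj
  cases hk : (S.manip i).kind <;> simp only [Manipulator.passiveAngle, hk]
  · exact tendsto_const_nhds
  · exact hj 1 (by simpa [Manipulator.spring, hk] using h1)
  · exact hj 0 (by simpa [Manipulator.spring, hk] using h0)

theorem tendsto_dist_xEnd_xHat (hU : Tendsto (fun t => S.energy (q t) (v t)) atTop (𝓝 0)) :
    Tendsto (fun t => dist (S.xEnd (q t)) (S.xHat (q t))) atTop (𝓝 0) := by
  refine squeeze_zero (fun _ => dist_nonneg) (fun t => S.dist_xEnd_xHat_le (q t)) ?_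
  simpa using tendsto_finsetSum Finset.univ fun i _ =>
    (S.tendsto_passiveAngle hU i).abs.const_mul ((S.manip i).L 0 + (S.manip i).L 1)

end Setup

end FormationControl
end

/-! ### Assembly of the theorem -/

theorem theorem1 {N : ℕ} (S : Setup N)
    (hG : S.G.Admissible S.xstar S.method)
    (hpa : ∀ i, (S.manip i).kind = Kind.pa → (S.manip i).α₂ ≠ (S.manip i).α₃)
    (hS : S.AvoidsSingularities) :
    S.IsDistributed ∧
    ∃ γ : ℝ, 0 < γ ∧
      (∀ q₀ v₀ : Fin N → Vec2, S.energy q₀ v₀ ≤ γ →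
        ∃ q v : ℝ → Fin N → Vec2, S.IsSolution q v ∧ q 0 = q₀ ∧ v 0 = v₀) ∧
      (∀ q v : ℝ → Fin N → Vec2, S.IsSolution q v → S.energy (q 0) (v 0) ≤ γ →
        Tendsto (fun t => Metric.infDist (S.xHat (q t)) S.SW) atTop (𝓝 0) ∧
        Tendsto (fun t => Metric.infDist (S.xEnd (q t)) S.SW) atTop (𝓝 0) ∧
        (∀ i, Tendsto (fun t => (S.manip i).passiveAngle (q t i)) atTop (𝓝 0)) ∧
        Tendsto (fun t => S.xEnd (q t) - S.xHat (q t)) atTop (𝓝 0) ∧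
        Tendsto v atTop (𝓝 0)) ∧
      (∃ δ : ℝ, 0 < δ ∧ ∀ q v : ℝ → Fin N → Vec2, S.IsSolution q v →
        S.energy (q 0) (v 0) ≤ γ →
        (∃ x ∈ S.SW ∩ shapeSet S.xstar, dist (S.xHat (q 0)) x ≤ δ) →
        Tendsto (fun t => Metric.infDist (S.xHat (q t)) (S.SW ∩ shapeSet S.xstar)) atTop (𝓝 0) ∧
        Tendsto (fun t => Metric.infDist (S.xEnd (q t)) (S.SW ∩ shapeSet S.xstar)) atTop (𝓝 0)) := by
  obtain ⟨γ₀, hγ₀, hdecay⟩ := S.exists_tendsto_energy_zero hpa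
  obtain ⟨r, hr, hsep⟩ := hG.exists_shapeSet_isolated
  -- Below this energy the virtual end-effectors stay within r/2 of S_W for all time, as the
  -- trapping argument requires.
  obtain ⟨γ₁, hγ₁, hclose⟩ := S.exists_infDist_SW_lt (half_pos hr)
  have hU : ∀ q v : ℝ → Fin N → Vec2, S.IsSolution q v → S.energy (q 0) (v 0) ≤ min γ₀ γ₁ →
      Tendsto (fun t => S.energy (q t) (v t)) atTop (𝓝 0) := fun q v h h0 =>
    hdecay (fun t => (q t, v t)) (S.isSolution_iff.1 h) (h0.trans (min_le_left _ _))
  -- The choice δ = r/4 turns the non-strict bound at time 0 into a strict one by r/2.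
  refine ⟨S.isDistributed, min γ₀ γ₁, lt_min hγ₀ hγ₁, fun q₀ v₀ _ => S.exists_isSolution q₀ v₀,
    fun q v h h0 => ?_, r / 4, by positivity, fun q v h h0 hx => ?_⟩
  · have hU := hU q v h h0
    have hd := S.tendsto_dist_xEnd_xHat hU
    have hH := S.tendsto_infDist_xHat hU
    refine ⟨hH, tendsto_infDist_of_tendsto_dist hH hd, S.tendsto_passiveAngle hU, ?_,
      S.tendsto_velocity hU⟩
    simpa only [dist_eq_norm, ← tendsto_zero_iff_norm_tendsto_zero] using hd
  · have hU := hU q v h h0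
    have hanti : AntitoneOn (fun t => S.energy (q t) (v t)) (Set.Ici 0) :=
      S.antitoneOn_energy (x := fun t => (q t, v t)) (S.isSolution_iff.1 h)
    have hq : ContinuousOn q (Set.Ici 0) := fun t ht => (h t ht).1.continuousWithinAt
    have hH : Tendsto (fun t => Metric.infDist (S.xHat (q t)) (S.SW ∩ shapeSet S.xstar))
        atTop (𝓝 0) := by
      refine squeeze_zero' (.of_forall fun _ => Metric.infDist_nonneg) ?_ (S.tendsto_infDist_xHat hU)
      filter_upwards [eventually_ge_atTop 0] with t ht
      have hc : ContinuousOn (fun t => S.xHat (q t)) (Set.Ici 0) :=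
        S.contDiff_xHat.continuous.comp_continuousOn hq
      refine infDist_inter_le_of_continuousOn (r := r)
        (fun z hz y hy => hsep z hz.2 y hy.2) hS.1 hc (fun s hs => hclose (q s) ?_) ?_ ht
      · exact (S.V_le_energy _ (v s)).trans ((hanti Set.self_mem_Ici hs hs).trans
          (h0.trans (min_le_right _ _)))
      · obtain ⟨x, hx, hd⟩ := hx
        exact ⟨x, hx, by linarith⟩
    exact ⟨hH, tendsto_infDist_of_tendsto_dist hH (S.tendsto_dist_xEnd_xHat hU)⟩
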